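/- Let $\mathcal{R}$ be a commutative ring containing a regular local ring $\Lambda$ such that $\mathcal{R}$ is free of finite rank over $\Lambda$ and $\mathrm{Hom}_\Lambda(\mathcal{R},\Lambda)\simeq\mathcal{R}$ as $\mathcal{R}$-modules, where $(a\phi)(x)=\phi(ax)$. Write $M^*=\mathrm{Hom}_{\mathcal{R}}(M,\mathcal{R})$. For an $\mathcal{R}$-module $M$ let $M_{\mathrm{tor}}$ be the submodule of elements killed by a non-zero-divisor of $\mathcal{R}$, and call $M$ pseudo-null if $M_{\mathfrak{Q}}=0$ for every prime $\mathfrak{Q}$ of $\mathcal{R}$ of height at most one. Exterior powers whose exponent is a locally constant function on $\mathrm{Spec}\,\mathcal{R}$ are formed separately over each piece where the exponent is constant (and are zero where it is negative); in particular $\det F=\bigwedge^{\mathrm{rank} F}_{\mathcal{R}}F$ for a finitely generated projective module $F$. Let $C$ be a perfect complex over $\mathcal{R}$, isomorphic in the derived category to a complex $0\to C^a\to\cdots\to C^b\to 0$ of finitely generated projective modules, with $a\le 1\le b$ (which is no restriction). Put $$l=\chi_{\mathcal{R}}(C)=\sum_i(-1)^{i-1}\,\mathrm{rank}(C^i),\qquad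 \mathrm{Det}_{\mathcal{R}}(C)=\bigotimes_i{\det}^{(-1)^i}(C^i),\qquad \mathrm{Det}^{-1}_{\mathcal{R}}(C)=\mathrm{Det}_{\mathcal{R}}(C)^*,$$ where $\det^{-1}(F)=(\det F)^*$ and the order of the tensor factors is disregarded. For a module $M$ let $\bigcap^l_{\mathcal{R}}M=\left(\bigwedge^l_{\mathcal{R}}M^*\right)^*$ be the exterior power bidual, with the natural map $\alpha^l_M:\bigwedge^l M\to\bigcap^l M$, $x_1\wedge\cdots\wedge x_l\mapsto[\phi_1\wedge\cdots\wedge\phi_l\mapsto\det(\phi_i(x_j))]$. Suppose that $H^i(C)$ is pseudo-null for every $i\neq 1$ and that $H^1(C)_{\mathrm{tor}}$ is pseudo-null. Then there is a natural isomorphism $$\eta:\ \bigcap\nolimits^l_{\mathcal{R}}H^1(C)\ \simeq\ \mathrm{Det}^{-1}_{\mathcal{R}}(C).$$ In particular, $\bigcap^l_{\mathcal{R}}H^1(C)$ is free of rank one over $\mathcal{R}$. Here natural means that $\eta$ is the isomorphism that becomes, over the total ring of fractions of $\mathcal{R}$, the canonical identification of $\bigwedge^l H^1(C)$ with $\mathrm{Det}^{-1}(C)$.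 Explicitly, $\eta$ is the unique isomorphism such that $\Psi=\eta\circ\alpha^l_{H^1(C)}$ has the following property. Let $s_i$ be locally constant functions on $\mathrm{Spec}\,\mathcal{R}$ with $s_i=0$ for $i<a$ and for $i\ge b$, with $s_{i-1}+s_i=\mathrm{rank}(C^i)$ for $i\ne1$ and $s_0+l+s_1=\mathrm{rank}(C^1)$. Let $c_i\in\bigwedge^{s_i}C^i$, with $c_i=1$ for $i<a$ and for $i\ge b$, and let $z\in\bigwedge^l\ker(d:C^1\to C^2)$ have class $[z]\in\bigwedge^l H^1(C)$. Put $w_i=d(c_{i-1})\wedge c_i$ for $i\neq 1$ and $w_1=d(c_0)\wedge z\wedge c_1$, so that $w_i\in\det(C^i)$. Then for all $\varphi_i\in\det(C^i)^*$ ($i$ odd) the element $\Psi([z])$ of $\mathrm{Det}_{\mathcal{R}}(C)^*$ satisfies $$\Psi([z])\Big(\bigotimes_{i\text{ even}}w_i\otimes\bigotimes_{i\text{ odd}}\varphi_i\Big)=\prod_{i\text{ odd}}\varphi_i(w_i).$$ -/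

import Mathlib

open CategoryTheory
open scoped TensorProduct DirectSum

universe w u v

noncomputable section

/-- A module `M` over a ring `R` is pseudo-null if `M_𝔔 = 0` for every prime `𝔔` of `R` of
height at most one. -/
def IsPseudoNull (R : Type u) [CommRing R] (M : Type v) [AddCommGroup M] [Module R M] : Prop :=
  ∀ (Q : Ideal R) [Q.IsPrime], Q.height ≤ 1 → Subsingleton (LocalizedModule Q.primeCompl M)

/-- The exterior power `⋀^s M` whose exponent `s` is a (locally constant) integer-valued function
on `Spec R`, as a submodule of the exterior algebra of `M`. It is spanned by the elements
`ε • y`, where `ε` is an idempotent such that `s` is constant of value `n ≥ 0` on the open and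
closed subset `D(ε)` and `y ∈ ⋀^n M`. If `s` is constant of value `n`, this is the usual `⋀^n M`;
in general it is the usual exterior power over each piece of `Spec R` on which `s` is constant
(and zero over the pieces on which `s` is negative). -/
def extPow (R : Type u) [CommRing R] (M : Type v) [AddCommGroup M] [Module R M]
    (s : PrimeSpectrum R → ℤ) : Submodule R (ExteriorAlgebra R M) :=
  Submodule.span R {x | ∃ (n : ℕ) (ε : R), IsIdempotentElem ε ∧
    (∀ p : PrimeSpectrum R, ε ∉ p.asIdeal → s p = n) ∧ ∃ y ∈ ⋀[R]^n M, x = ε • y}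

/-- The pairing between the exterior algebras of `M` and of its dual: different degrees are
orthogonal, and `x₁ ∧ ⋯ ∧ xₙ` is sent to `φ₁ ∧ ⋯ ∧ φₙ ↦ det (φᵢ (xⱼ))`. -/
def extPairing (R : Type u) [CommRing R] (M : Type v) [AddCommGroup M] [Module R M] :
    ExteriorAlgebra R M →ₗ[R] Module.Dual R (ExteriorAlgebra R (Module.Dual R M)) :=
  (DirectSum.toModule R ℕ (Module.Dual R (ExteriorAlgebra R (Module.Dual R M)))
      (fun n : ℕ =>
        (DirectSum.component R ℕ (fun k : ℕ => ⋀[R]^k (Module.Dual R M)) n ∘ₗ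
            (DirectSum.decomposeLinearEquiv
              (fun k : ℕ => ⋀[R]^k (Module.Dual R M))).toLinearMap).dualMap ∘ₗ
          (exteriorPower.pairingDual R M n).flip)) ∘ₗ
    (DirectSum.decomposeLinearEquiv (fun k : ℕ => ⋀[R]^k M)).toLinearMap

/-- The exterior power bidual `⋂^l M = (⋀^l M^*)^*`. -/
abbrev extBidual (R : Type u) [CommRing R] (M : Type v) [AddCommGroup M] [Module R M]
    (l : PrimeSpectrum R → ℤ) : Type (max u v) :=
  Module.Dual R (extPow R (Module.Dual R M) l)

/-- The natural map `⋀^l M → ⋂^l M`,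
`x₁ ∧ ⋯ ∧ x_l ↦ [φ₁ ∧ ⋯ ∧ φ_l ↦ det (φᵢ (xⱼ))]`. -/
def toExtBidual (R : Type u) [CommRing R] (M : Type v) [AddCommGroup M] [Module R M]
    (l : PrimeSpectrum R → ℤ) : extPow R M l →ₗ[R] extBidual R M l :=
  (extPow R (Module.Dual R M) l).subtype.dualMap ∘ₗ extPairing R M ∘ₗ (extPow R M l).subtype

/-- The rank of a module as a function on `Spec R` (locally constant if the module is finitely
generated projective). -/
def rankFun (R : Type u) [CommRing R] (M : Type v) [AddCommGroup M] [Module R M] :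
    PrimeSpectrum R → ℤ :=
  fun p => (Module.rankAtStalk (R := R) M p : ℤ)

/-- `det F = ⋀^{rank F} F`. -/
abbrev detLine (R : Type u) [CommRing R] (M : Type v) [AddCommGroup M] [Module R M] :
    Submodule R (ExteriorAlgebra R M) :=
  extPow R M (rankFun R M)

/-- A presentation of the object `C` of the derived category of `R` as a perfect complex: an
isomorphism with a complex `0 → P^a → ⋯ → P^b → 0` of finitely generated projective modules.
Enlarging the interval `[a, b]` by zero modules we can and do take it to contain `1`. -/
structure PerfectPresentation {R : Type u} [CommRing R]
    [HasDerivedCategory.{w} (ModuleCat.{u} R)] (C : DerivedCategory (ModuleCat.{u} R)) where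
  /-- the complex of projective modules -/
  P : CochainComplex (ModuleCat.{u} R) ℤ
  /-- the lowest degree -/
  a : ℤ
  /-- the highest degree -/
  b : ℤ
  a_le : a ≤ 1
  le_b : 1 ≤ b
  isStrictlyGE : P.IsStrictlyGE a
  isStrictlyLE : P.IsStrictlyLE b
  finite : ∀ i, Module.Finite R (P.X i)
  projective : ∀ i, Module.Projective R (P.X i)
  /-- the isomorphism in the derived category -/
  iso : DerivedCategory.Q.obj P ≅ C

/-- The cohomology module `H^i(C)`. -/
abbrev cohomology {R : Type u} [CommRing R] [HasDerivedCategory.{w} (ModuleCat.{u} R)]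
    (C : DerivedCategory (ModuleCat.{u} R)) (i : ℤ) : ModuleCat.{u} R :=
  (DerivedCategory.homologyFunctor (ModuleCat.{u} R) i).obj C

namespace PerfectPresentation

variable {R : Type u} [CommRing R] [HasDerivedCategory.{w} (ModuleCat.{u} R)]
  {C : DerivedCategory (ModuleCat.{u} R)} (D : PerfectPresentation C)

/-- The Euler characteristic `χ(C) = ∑ᵢ (-1)^{i-1} rank P^i`, a function on `Spec R`. -/
def eulerChar : PrimeSpectrum R → ℤ :=
  fun p => ∑ i ∈ Finset.Icc D.a D.b, ((i - 1).negOnePow : ℤ) * rankFun R (D.P.X i) p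

/-- The even degrees between `a` and `b`. -/
abbrev evenDegrees : Finset ℤ := (Finset.Icc D.a D.b).filter (fun i => Even i)

/-- The odd degrees between `a` and `b`. -/
abbrev oddDegrees : Finset ℤ := (Finset.Icc D.a D.b).filter (fun i => Odd i)

/-- `Det(C) = ⨂ᵢ det^{(-1)^i}(P^i)`, the factors being `det(P^i)` in the even degrees and its
dual in the odd degrees. (The factors of even degree are written first; determinant modules carry
no grading here.) -/
abbrev det : Type u :=
  (⨂[R] i : D.evenDegrees, detLine R (D.P.X i)) ⊗[R]
    (⨂[R] i : D.oddDegrees, Module.Dual R (detLine R (D.P.X i)))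

/-- `Det^{-1}(C) = Det(C)^*`. -/
abbrev detInv : Type u := Module.Dual R D.det

/-- The surjection from the `1`-cocycles of `P` to `H^1(C)`. -/
def cocycleClass : D.P.cycles 1 →ₗ[R] cohomology C 1 :=
  (D.P.homologyπ 1 ≫ (DerivedCategory.homologyFunctorFactors (ModuleCat.{u} R) 1).inv.app D.P ≫
    (DerivedCategory.homologyFunctor (ModuleCat.{u} R) 1).map D.iso.hom).hom

/-- The property that characterizes the natural homomorphism `Ψ : ⋀^l H^1(C) → Det^{-1}(C)`,
where `l = χ(C)`. Over the total ring of fractions, `Ψ` is the identification that the exact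
sequences `0 → Z^i → P^i → B^{i+1} → 0` (where `Z^i = B^i` for `i ≠ 1`) and
`0 → B^1 → Z^1 → H^1(C) → 0` induce on top exterior powers. With denominators cleared this reads
as follows. Let `s i` be the rank of `B^{i+1}`. For `c i ∈ ⋀^{s i} P^i` and `z ∈ ⋀^l Z^1` with
class `x ∈ ⋀^l H^1(C)`, put `w i = d(c (i-1)) ∧ c i ∈ det(P^i)` for `i ≠ 1` and
`w 1 = d(c 0) ∧ z ∧ c 1 ∈ det(P^1)`. Then `Ψ(x)` takes the value `∏_{i odd} φ i (w i)` at
`(⊗_{i even} w i) ⊗ (⊗_{i odd} φ i)`, for all `φ i ∈ det(P^i)^*`. For a complex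
`P^0 → P^1` this is the formula `Ψ(x) = [c 0 ↦ d(c 0) ∧ z]` in
`Hom(det P^0, det P^1) = Det^{-1}(C)`. -/
def IsNaturalMap (Ψ : extPow R (cohomology C 1) D.eulerChar →ₗ[R] D.detInv) : Prop :=
  ∀ (s : ℤ → PrimeSpectrum R → ℤ)
    (_ : ∀ i, i < D.a ∨ D.b ≤ i → s i = 0)
    (_ : ∀ i, i ≠ 1 → s (i - 1) + s i = rankFun R (D.P.X i))
    (_ : s 0 + D.eulerChar + s 1 = rankFun R (D.P.X 1))
    (c : ∀ i, ExteriorAlgebra R (D.P.X i))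
    (_ : ∀ i, c i ∈ extPow R (D.P.X i) (s i))
    (_ : ∀ i, i < D.a ∨ D.b ≤ i → c i = 1)
    (z : ExteriorAlgebra R (D.P.cycles 1))
    (_ : z ∈ extPow R (D.P.cycles 1) D.eulerChar)
    (x : extPow R (cohomology C 1) D.eulerChar)
    (_ : (x : ExteriorAlgebra R (cohomology C 1)) = ExteriorAlgebra.map D.cocycleClass z)
    (w : ∀ i, detLine R (D.P.X i))
    (_ : ∀ i, i ≠ 1 → (w i : ExteriorAlgebra R (D.P.X i)) =
      ExteriorAlgebra.map (D.P.d (i - 1) i).hom (c (i - 1)) * c i)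
    (_ : (w 1 : ExteriorAlgebra R (D.P.X 1)) =
      ExteriorAlgebra.map (D.P.d 0 1).hom (c 0) *
        ExteriorAlgebra.map (D.P.iCycles 1).hom z * c 1)
    (φ : ∀ i : D.oddDegrees, Module.Dual R (detLine R (D.P.X i))),
    Ψ x ((PiTensorProduct.tprod R fun i : D.evenDegrees => w i) ⊗ₜ[R] PiTensorProduct.tprod R φ) =
      ∏ i : D.oddDegrees, φ i (w i)

end PerfectPresentation

end

noncomputable section

/-! ### Regular local rings are integrally closed domains; divisibility is tested in codimension one
-/

section RegularLocalRing

open IsLocalRing Polynomial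

/-! Since `R` is free over the normal noetherian domain `Λ`, divisibility in `R` by a nonzero `σ :
Λ` can be tested at the primes of `R` above those `p` for which `Λ_p` is a principal ideal domain
(`pirLocus`). Compatible fractions given at these primes therefore glue to elements of `R`, and so
do linear forms (`existsUnique_glue`, `exists_linearMap_glue`). These primes have height at most
one, so finitely generated pseudo-null modules vanish there. As `⋂^l H^1` is the dual of `Y = ⋀^l
(H^1)^*`, it suffices to find, at each such prime `Q`, a generator `y₀` of `Y` for which `f ↦ f y₀`,
up to a denominator, satisfies the required formula (`existsUnique_dualEquiv`).

At `Q` the complex splits (`splitsAt`). In degrees above `1` it is exact and bounded with projective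
terms, so splittings descend from the right. Below that one ascends from the left: there the
cokernels are torsion-free at `Q`, and a map to a projective module defined on a submodule with
torsion-free quotient extends, because `Hom_R(E, R) = Hom_Λ(E, Λ)` by the self-duality of `R` and
because torsion-free modules are free over `Λ_p` (`exists_extend_dual_of_selfDual`). The descent
reaches `d : P^1 → P^2` and the ascent reaches `d : P^0 → P^1`; at degree one only the torsion of
`H^1` has to vanish. Hence coboundaries and `H^1` are free at `Q`.

In terms of the resulting bases, `w i` is `γ (i-1) * γ i` times a generator of `det (P^i)`, where `γ
i` is the coordinate of `c i`; for `i = 1` the value of `[z]` on `y₀` is a further factor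
(`exists_comparison`). Each `γ i` occurs exactly once among the even degrees and once among the odd
ones (`prod_sub_one_mul`), so the two products differ, apart from fixed generators, only by the
value of `[z]` on `y₀`. This is the formula that defines `η`.

Localizations are mostly replaced by identities with a denominator `s ∉ Q`. The determinant lines
are trivialized globally because `R` is semilocal (`nonempty_detLine_linearEquiv`). -/

theorem eval_scaleRoots_eq_zero {A : Type*} [CommRing A] [IsDomain A] (K : Type*) [Field K]
    [Algebra A K] [IsFractionRing A K] {p : A[X]} {g : K} (hp : aeval g p = 0) {a b : A}
    (h : algebraMap A K b * g = algebraMap A K a) : (p.scaleRoots b).eval a = 0 := by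
  apply IsFractionRing.injective A K
  have := scaleRoots_eval₂_mul (p := p) (algebraMap A K) (r := g) (s := b)
  rw [aeval_def] at hp
  rw [hp, mul_zero, h, eval₂_at_apply] at this
  rw [this, map_zero]

/-- The integral equation of `g`, scaled by `x`, is a monic equation for `a`. Modulo `x` only its
leading term survives, so a power of `a` vanishes in the domain `A ⧸ (x)`. -/
theorem dvd_of_mul_isIntegral {A : Type*} [CommRing A] [IsDomain A] (K : Type*) [Field K]
    [Algebra A K] [IsFractionRing A K] {x : A} (hx : Prime x) {g : K} (hg : IsIntegral A g)
    {a : A} (h : algebraMap A K x * g = algebraMap A K a) : x ∣ a := by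
  obtain ⟨p, hp, hp0⟩ := hg
  have h0 := eval_scaleRoots_eq_zero K (p := p) hp0 h
  have h1 := congrArg (Ideal.Quotient.mk (Ideal.span {x})) h0
  rw [← eval_map_apply, map_scaleRoots _ _ _ (by
    rw [hp.leadingCoeff, map_one]
    have := (Ideal.span_singleton_prime hx.ne_zero).2 hx
    exact one_ne_zero), Ideal.Quotient.mk_singleton_self, scaleRoots_zero] at h1
  have := (Ideal.span_singleton_prime hx.ne_zero).2 hx
  simp only [(hp.map _).leadingCoeff, one_smul, eval_pow, eval_X, map_zero] at h1
  exact Ideal.mem_span_singleton.1 (Ideal.Quotient.eq_zero_iff_mem.1 (eq_zero_of_pow_eq_zero h1))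

theorem exists_eq_of_prime_mul {A : Type*} [CommRing A] [IsDomain A] (K : Type*) [Field K]
    [Algebra A K] [IsFractionRing A K] {x b : A} (hx : Prime x) (hb : ¬ x ∣ b) {g : K}
    {a c : A} (h : algebraMap A K x * g = algebraMap A K a)
    (h' : algebraMap A K b * g = algebraMap A K c) : ∃ e : A, g = algebraMap A K e := by
  have : b * a = x * c := by
    apply IsFractionRing.injective A K
    rw [map_mul, map_mul, ← h, ← h']; ring
  obtain ⟨e, rfl⟩ := (hx.dvd_or_dvd ⟨c, this⟩).resolve_left hb
  refine ⟨e, ?_⟩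
  have hx0 : algebraMap A K x ≠ 0 := by
    simpa using hx.ne_zero
  apply mul_left_cancel₀ hx0
  rw [h, map_mul]

/-- Write `g = a / (x ^ n * b')` with `x ∤ b'`; by `dvd_of_mul_isIntegral` the factors `x` cancel
one at a time. -/
theorem exists_not_dvd_mul_isIntegral {A : Type*} [CommRing A] [IsDomain A] [IsNoetherianRing A]
    (K : Type*) [Field K] [Algebra A K] [IsFractionRing A K] {x : A} (hx : Prime x) {g : K}
    (hg : IsIntegral A g) : ∃ a b : A, ¬ x ∣ b ∧ algebraMap A K b * g = algebraMap A K a := by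
  obtain ⟨a, b, hb, rfl⟩ := IsFractionRing.div_surjective (A := A) g
  have hb0 : b ≠ 0 := nonZeroDivisors.ne_zero hb
  obtain ⟨n, b', hb', rfl⟩ := WfDvdMonoid.max_power_factor hb0 hx.irreducible
  have hx0 : algebraMap A K x ≠ 0 := by simpa using hx.ne_zero
  have hc0 : algebraMap A K b' ≠ 0 := by
    intro h; apply hb0; rw [(map_eq_zero_iff _ (IsFractionRing.injective A K)).1 h, mul_zero]
  have key : ∀ k ≤ n, ∃ a' : A, algebraMap A K (x ^ (n - k) * b') *
      (algebraMap A K a / algebraMap A K (x ^ n * b')) = algebraMap A K a' := by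
    intro k
    induction k with
    | zero => intro _; refine ⟨a, ?_⟩; simp only [map_mul, map_pow, Nat.sub_zero]; field_simp
    | succ k ih =>
      intro hk
      obtain ⟨a', ha'⟩ := ih (by omega)
      have e : n - k = (n - (k + 1)) + 1 := by omega
      have h2 : algebraMap A K x * (algebraMap A K (x ^ (n - (k + 1)) * b') *
        (algebraMap A K a / algebraMap A K (x ^ n * b'))) = algebraMap A K a' := by
        rw [← ha', e, pow_succ]; simp only [map_mul]; ring
      obtain ⟨d, rfl⟩ := dvd_of_mul_isIntegral K hx (isIntegral_algebraMap.mul hg) h2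
      refine ⟨d, mul_left_cancel₀ hx0 ?_⟩
      rw [h2, map_mul]
  obtain ⟨a', ha'⟩ := key n le_rfl
  exact ⟨a', b', hb', by simpa using ha'⟩

/-- A noetherian local domain is integrally closed if its quotient by a prime element of the
maximal ideal is. -/
theorem IsIntegrallyClosed.of_quotient_prime {A : Type*} [CommRing A] [IsDomain A] [IsLocalRing A]
    [IsNoetherianRing A] (K : Type*) [Field K] [Algebra A K] [IsFractionRing A K] {x : A} (hx : Prime x) (hxm : x ∈ maximalIdeal A)
    [IsIntegrallyClosed (A ⧸ Ideal.span {x})] : IsIntegrallyClosed A := by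
  have hprime := (Ideal.span_singleton_prime hx.ne_zero).2 hx
  rw [isIntegrallyClosed_iff K]
  intro θ hθ
  -- The conductor of `A[θ]`, nonzero because `A[θ]` is a finite `A`-module.
  let c : Ideal A :=
    { carrier := {r | ∀ n : ℕ, ∃ a : A, algebraMap A K r * θ ^ n = algebraMap A K a}
      zero_mem' := fun n => ⟨0, by simp⟩
      add_mem' := by
        intro r s hr hs n
        obtain ⟨a, ha⟩ := hr n
        obtain ⟨b, hb⟩ := hs n
        exact ⟨a + b, by rw [map_add, map_add, add_mul, ha, hb]⟩
      smul_mem' := by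
        intro r s hs n
        obtain ⟨b, hb⟩ := hs n
        exact ⟨r * b, by rw [smul_eq_mul, map_mul, map_mul, mul_assoc, hb]⟩ }
  -- `T = (c : c)` contains `θ` and is a finite `A`-module. Unlike `A[θ]` it allows the division by
  -- `x` in `hdecomp`.
  let T : Subalgebra A K :=
    { carrier := {g | ∀ r ∈ c, ∃ r' ∈ c, algebraMap A K r * g = algebraMap A K r'}
      mul_mem' := by
        intro g h hg hh r hr
        obtain ⟨r', hr', e⟩ := hg r hr
        obtain ⟨r'', hr'', e'⟩ := hh r' hr'
        exact ⟨r'', hr'', by rw [← mul_assoc, e, e']⟩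
      add_mem' := by
        intro g h hg hh r hr
        obtain ⟨r', hr', e⟩ := hg r hr
        obtain ⟨r'', hr'', e'⟩ := hh r hr
        exact ⟨r' + r'', add_mem hr' hr'', by rw [mul_add, e, e', map_add]⟩
      algebraMap_mem' := by
        intro s r hr
        exact ⟨s * r, c.mul_mem_left s hr, by rw [map_mul, mul_comm]⟩ }
  obtain ⟨r₀, hr₀, hr₀0⟩ : ∃ r₀ ∈ c, r₀ ≠ 0 := by
    have hfg := hθ.fg_adjoin_singleton
    obtain ⟨r, hr, hr'⟩ := FractionalIdeal.isFractional_of_fg (S := nonZeroDivisors A) hfg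
    refine ⟨r, fun n => ?_, nonZeroDivisors.ne_zero hr⟩
    obtain ⟨a, ha⟩ := hr' (θ ^ n) (Subalgebra.pow_mem _ (Algebra.self_mem_adjoin_singleton A θ) n)
    exact ⟨a, by rw [ha, Algebra.smul_def]⟩
  have hr₀K : algebraMap A K r₀ ≠ 0 := by simpa using hr₀0
  have hTfg : (Subalgebra.toSubmodule T).FG := by
    have hle : Subalgebra.toSubmodule T ≤ Submodule.span A {(algebraMap A K r₀)⁻¹} := by
      intro g hg
      obtain ⟨r', -, e⟩ := hg r₀ hr₀
      rw [Submodule.mem_span_singleton]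
      refine ⟨r', ?_⟩
      rw [Algebra.smul_def, ← e]; field_simp
    have : IsNoetherian A (Submodule.span A {(algebraMap A K r₀)⁻¹}) :=
      isNoetherian_of_fg_of_noetherian _ (Submodule.fg_span_singleton _)
    have := isNoetherian_of_le hle
    exact Module.Finite.iff_fg.1 inferInstance
  have hTint : ∀ g ∈ T, IsIntegral A g := fun g hg => IsIntegral.of_mem_of_fg T hTfg g hg
  have hθT : θ ∈ T := by
    intro r hr
    obtain ⟨a, ha⟩ := hr 1
    rw [pow_one] at ha
    refine ⟨a, fun n => ?_, ha⟩
    obtain ⟨b, hb⟩ := hr (n + 1)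
    exact ⟨b, by rw [← hb, ← ha, pow_succ]; ring⟩
  -- That is, `T = A + xT`. With `g = a / b` and `x ∤ b`, the residue of `a / b` is integral over
  -- the integrally closed ring `A ⧸ (x)`, so `a ≡ b e` modulo `x`; then `g' = (g - e) / x = f / b`.
  have hdecomp : ∀ g ∈ T, ∃ e : A, ∃ g' ∈ T, g = algebraMap A K e + algebraMap A K x * g' := by
    intro g hg
    obtain ⟨a, b, hb, hab⟩ := exists_not_dvd_mul_isIntegral K hx (hTint g hg)
    obtain ⟨p, hp, hp0⟩ := hTint g hg
    have h0 := eval_scaleRoots_eq_zero K (p := p) hp0 hab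
    let Abar := A ⧸ Ideal.span {x}
    let q := Ideal.Quotient.mk (Ideal.span {x})
    have h1 := congrArg q h0
    have hbq : q b ≠ 0 := fun h =>
      hb (Ideal.mem_span_singleton.1 (Ideal.Quotient.eq_zero_iff_mem.1 h))
    have hbq' : algebraMap Abar (FractionRing Abar) (q b) ≠ 0 := by simpa using hbq
    rw [← eval_map_apply, map_scaleRoots _ _ _ (by
      rw [hp.leadingCoeff, map_one]; exact one_ne_zero), map_zero] at h1
    have hint : IsIntegral Abar (algebraMap Abar (FractionRing Abar) (q a) /
        algebraMap Abar (FractionRing Abar) (q b)) := by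
      refine ⟨p.map q, hp.map q, ?_⟩
      have h2 := scaleRoots_eval₂_mul (p := p.map q) (algebraMap Abar (FractionRing Abar))
        (r := algebraMap Abar (FractionRing Abar) (q a) /
          algebraMap Abar (FractionRing Abar) (q b)) (s := q b)
      rw [mul_div_cancel₀ _ hbq', eval₂_at_apply, h1, map_zero] at h2
      exact (mul_eq_zero.1 h2.symm).resolve_left (pow_ne_zero _ hbq')
    obtain ⟨e', he'⟩ := (isIntegrallyClosed_iff (FractionRing Abar)).1 inferInstance hint
    obtain ⟨e, rfl⟩ := Ideal.Quotient.mk_surjective e'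
    have h3 : q a = q b * q e := by
      apply IsFractionRing.injective Abar (FractionRing Abar)
      rw [map_mul, he', mul_div_cancel₀ _ hbq']
    rw [← map_mul] at h3
    obtain ⟨f, hf⟩ := Ideal.mem_span_singleton.1 (Ideal.Quotient.eq.1 h3)
    have hb0 : algebraMap A K b ≠ 0 := by
      intro h; apply hb
      rw [(map_eq_zero_iff _ (IsFractionRing.injective A K)).1 h]; exact dvd_zero x
    have hxf : algebraMap A K b * (g - algebraMap A K e) = algebraMap A K x * algebraMap A K f := by
      rw [mul_sub, hab, ← map_mul, ← map_sub, hf, map_mul]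
    refine ⟨e, algebraMap A K f / algebraMap A K b, ?_, ?_⟩
    -- Both `x` and `b` carry `r * g' * θ ^ n` into `A`, and `x` is a prime not dividing `b`, so
    -- this element lies in `A`.
    · intro r hr
      have hsub : g - algebraMap A K e ∈ T := T.sub_mem hg (T.algebraMap_mem e)
      obtain ⟨r', hr', e1⟩ := hsub r hr
      have key : ∀ n : ℕ, ∃ d : A, algebraMap A K r * (algebraMap A K f / algebraMap A K b) * θ ^ n
          = algebraMap A K d := by
        intro n
        obtain ⟨d1, hd1⟩ := hr' n
        obtain ⟨d2, hd2⟩ := hr n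
        refine exists_eq_of_prime_mul K hx hb (a := d1) (c := f * d2) ?_ ?_
        · rw [← hd1, ← e1]
          have : g - algebraMap A K e = algebraMap A K x * algebraMap A K f / algebraMap A K b := by
            rw [← hxf]; field_simp
          rw [this]; ring
        · rw [map_mul, ← hd2]; field_simp
      obtain ⟨d, hd⟩ := key 0
      rw [pow_zero, mul_one] at hd
      refine ⟨d, fun n => ?_, hd⟩
      rw [← hd]; exact key n
    · have : g - algebraMap A K e = algebraMap A K x * algebraMap A K f / algebraMap A K b := by
        rw [← hxf]; field_simp
      rw [← sub_eq_iff_eq_add', this]; ring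
  -- Nakayama: `T = A + 𝔪T` forces `T = A`.
  have hle : Subalgebra.toSubmodule T ≤ LinearMap.range (Algebra.linearMap A K) := by
    refine Submodule.le_of_le_smul_of_le_jacobson_bot (I := maximalIdeal A) hTfg
      (IsLocalRing.maximalIdeal_le_jacobson ⊥) ?_
    intro g hg
    obtain ⟨e, g', hg', rfl⟩ := hdecomp g hg
    refine Submodule.add_mem_sup ⟨e, rfl⟩ ?_
    rw [← Algebra.smul_def]
    exact Submodule.smul_mem_smul hxm hg'
  obtain ⟨y, hy⟩ := hle hθT
  exact ⟨y, hy⟩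

open Classical in
theorem IsRegularLocalRing.exists_quotient {A : Type*} [CommRing A] [IsRegularLocalRing A]
    (h : maximalIdeal A ≠ ⊥) :
    ∃ x ∈ maximalIdeal A, (∀ p ∈ minimalPrimes A, x ∉ p) ∧
      ∃ _ : IsRegularLocalRing (A ⧸ Ideal.span {x}),
      (maximalIdeal (A ⧸ Ideal.span {x})).spanFinrank < (maximalIdeal A).spanFinrank := by
  have hfg := (maximalIdeal A).fg_of_isNoetherianRing
  have hd := IsRegularLocalRing.spanFinrank_maximalIdeal (R := A)
  have hpos : (maximalIdeal A).spanFinrank ≠ 0 := by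
    rwa [Ne, Submodule.spanFinrank_eq_zero_iff_eq_bot hfg]
  obtain ⟨x, hxm, hx⟩ : ∃ x ∈ maximalIdeal A, x ∉ maximalIdeal A ^ 2 ∧
      ∀ p ∈ minimalPrimes A, x ∉ p := by
    by_contra! hcon
    have hsub : (maximalIdeal A : Set A) ⊆
        ⋃ I ∈ insert (maximalIdeal A ^ 2) (minimalPrimes A), (I : Set A) := by
      intro x hx
      by_cases hx2 : x ∈ maximalIdeal A ^ 2
      · exact Set.mem_biUnion (Set.mem_insert _ _) hx2
      · obtain ⟨p, hp, hxp⟩ := hcon x hx hx2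
        exact Set.mem_biUnion (Set.mem_insert_of_mem _ hp) hxp
    -- Prime avoidance, with `𝔪 ^ 2` as the only member that need not be prime; it fills both
    -- exceptional places.
    rw [Ideal.subset_union_prime_finite (f := fun I => I)
      ((minimalPrimes.finite_of_isNoetherianRing A).insert _)
      (maximalIdeal A ^ 2) (maximalIdeal A ^ 2)] at hsub
    · obtain ⟨I, hI, hle⟩ := hsub
      rcases hI with rfl | hI
      · apply h
        refine Submodule.eq_bot_of_le_smul_of_le_jacobson_bot (maximalIdeal A) _ hfg ?_
          (IsLocalRing.maximalIdeal_le_jacobson ⊥)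
        rw [smul_eq_mul, ← pow_two]; exact hle
      · have hIp : I.IsPrime := hI.1.1
        have heq : I = maximalIdeal A := le_antisymm (IsLocalRing.le_maximalIdeal hIp.ne_top) hle
        have h0 : (maximalIdeal A).height = 0 := by
          rw [← heq, Ideal.height_eq_zero_iff]; exact hI
        rw [← IsLocalRing.maximalIdeal_height_eq_ringKrullDim, h0] at hd
        exact hpos (by exact_mod_cast hd)
    · rintro I (rfl | hI) hne _
      · exact absurd rfl hne
      · exact hI.1.1
  refine ⟨x, hxm, hx.2, ?_⟩
  have hne : Ideal.span {x} ≠ ⊤ := fun h => by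
    rw [Ideal.span_singleton_eq_top] at h
    exact hxm h
  have : Nontrivial (A ⧸ Ideal.span {x}) := Ideal.Quotient.nontrivial_iff.2 hne
  have : IsLocalRing (A ⧸ Ideal.span {x}) :=
    IsLocalRing.of_surjective' _ Ideal.Quotient.mk_surjective
  obtain ⟨s, hcard, hspan⟩ := Submodule.FG.exists_span_finset_card_eq_spanFinrank hfg
  -- Exchange: since `x ∉ 𝔪 ^ 2`, some coefficient of `x` in the generators is a unit, so `x` can
  -- replace that generator.
  obtain ⟨y, hys, hy⟩ : ∃ y ∈ s, y ∈ Ideal.span (insert x (s.erase y : Set A)) := by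
    rw [← hspan] at hxm
    obtain ⟨f, hf⟩ := Submodule.mem_span_finset.1 hxm
    by_contra! hcon
    apply hx.1
    rw [← hf.2, pow_two]
    refine Ideal.sum_mem _ fun y hy => ?_
    have hym : y ∈ maximalIdeal A := by rw [← hspan]; exact Submodule.subset_span hy
    refine Ideal.mul_mem_mul ?_ hym
    by_contra hunit
    rw [IsLocalRing.mem_maximalIdeal, mem_nonunits_iff, not_not] at hunit
    apply hcon y hy
    have hsum : f y • y = x - ∑ z ∈ s.erase y, f z • z := by
      rw [← hf.2, ← Finset.add_sum_erase s _ hy]; simp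
    have hmem : f y * y ∈ Ideal.span (insert x (s.erase y : Set A)) := by
      rw [← smul_eq_mul, hsum]
      refine sub_mem (Ideal.subset_span (Set.mem_insert _ _)) (Ideal.sum_mem _ fun z hz => ?_)
      exact Ideal.mul_mem_left _ _ (Ideal.subset_span (Set.mem_insert_of_mem _ hz))
    exact (Ideal.unit_mul_mem_iff_mem _ hunit).1 hmem
  have hmax : maximalIdeal (A ⧸ Ideal.span {x}) =
      Ideal.span ((Ideal.Quotient.mk (Ideal.span {x})) '' (s.erase y : Set A)) := by
    have h1 : maximalIdeal A ≤ Ideal.span (insert x (s.erase y : Set A)) := by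
      rw [← hspan]
      refine Submodule.span_le.2 fun z hz => ?_
      by_cases hzy : z = y
      · rw [hzy]; exact hy
      · exact Ideal.subset_span (Set.mem_insert_of_mem _ (Finset.mem_coe.2 (Finset.mem_erase.2 ⟨hzy, hz⟩)))
    apply le_antisymm
    · rw [← IsLocalRing.map_maximalIdeal_of_surjective (Ideal.Quotient.mk (Ideal.span {x}))
        Ideal.Quotient.mk_surjective]
      refine (Ideal.map_mono h1).trans ?_
      rw [Ideal.map_span, Ideal.span_le]
      rintro _ ⟨z, hz | hz, rfl⟩
      · rw [hz, Ideal.Quotient.mk_singleton_self]; exact zero_mem _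
      · exact Ideal.subset_span ⟨z, hz, rfl⟩
    · rw [Ideal.span_le]
      rintro _ ⟨z, hz, rfl⟩
      rw [← IsLocalRing.map_maximalIdeal_of_surjective (Ideal.Quotient.mk (Ideal.span {x}))
        Ideal.Quotient.mk_surjective]
      apply Ideal.mem_map_of_mem
      rw [← hspan]
      exact Submodule.subset_span (Finset.mem_of_mem_erase hz)
  have hlt : (maximalIdeal (A ⧸ Ideal.span {x})).spanFinrank + 1 ≤
      (maximalIdeal A).spanFinrank := by
    have h1 : (maximalIdeal (A ⧸ Ideal.span {x})).spanFinrank ≤ (s.erase y).card := by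
      rw [hmax]
      refine (Submodule.spanFinrank_span_le_ncard_of_finite
        ((s.erase y).finite_toSet.image _)).trans ?_
      exact (Set.ncard_image_le (s.erase y).finite_toSet).trans (by rw [Set.ncard_coe_finset])
    rw [Finset.card_erase_of_mem hys] at h1
    omega
  refine ⟨IsRegularLocalRing.of_spanFinrank_maximalIdeal_le _ ?_, hlt⟩
  have hdim : ringKrullDim A ≤ ringKrullDim (A ⧸ Ideal.span {x}) + 1 := by
    have := ringKrullDim_le_ringKrullDim_quotSMulTop_succ hxm
    rwa [← Submodule.ideal_span_singleton_smul, smul_eq_mul, Ideal.mul_top] at this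
  rw [← hd] at hdim
  have h2 : (((maximalIdeal (A ⧸ Ideal.span {x})).spanFinrank + 1 : ℕ) : WithBot ℕ∞) ≤
      ringKrullDim (A ⧸ Ideal.span {x}) + 1 := le_trans (by exact_mod_cast hlt) hdim
  push_cast at h2
  exact ENat.WithBot.add_le_add_one_right_iff.1 h2

theorem IsRegularLocalRing.isDomain_and_isIntegrallyClosed (n : ℕ) (A : Type*) [CommRing A]
    [IsRegularLocalRing A] (hn : (maximalIdeal A).spanFinrank ≤ n) :
    IsDomain A ∧ IsIntegrallyClosed A := by
  induction n using Nat.strong_induction_on generalizing A with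
  | _ n ih =>
  by_cases hbot : maximalIdeal A = ⊥
  · let := (IsLocalRing.isField_iff_maximalIdeal_eq.2 hbot).toField
    exact ⟨inferInstance, inferInstance⟩
  · obtain ⟨x, hxm, hxp, hreg, hlt⟩ := IsRegularLocalRing.exists_quotient hbot
    obtain ⟨hdom, hic⟩ := ih _ (hlt.trans_le hn) (A ⧸ Ideal.span {x}) le_rfl
    have hprime : (Ideal.span {x}).IsPrime := (Ideal.Quotient.isDomain_iff_prime _).1 hdom
    have : IsDomain A := by
      -- A minimal prime `q ≤ (x)` does not contain `x`, so `q = xq` and `q = 0` by Nakayama.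
      obtain ⟨q, hq, hqx⟩ := Ideal.exists_minimalPrimes_le (I := ⊥) (J := Ideal.span {x}) bot_le
      have hqp : q.IsPrime := hq.1.1
      have hq0 : q = ⊥ := by
        refine Submodule.eq_bot_of_le_smul_of_le_jacobson_bot (maximalIdeal A) _
          q.fg_of_isNoetherianRing ?_ (IsLocalRing.maximalIdeal_le_jacobson ⊥)
        intro y hy
        obtain ⟨a, rfl⟩ := Ideal.mem_span_singleton.1 (hqx hy)
        exact Ideal.mul_mem_mul hxm ((hqp.mem_or_mem hy).resolve_left (hxp q hq))
      rw [hq0] at hqp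
      exact IsDomain.of_bot_isPrime A
    have hx0 : x ≠ 0 := by
      rintro rfl
      obtain ⟨q, hq, -⟩ := Ideal.exists_minimalPrimes_le (I := ⊥) (J := maximalIdeal A) bot_le
      exact hxp q hq (zero_mem q)
    exact ⟨this, IsIntegrallyClosed.of_quotient_prime (FractionRing A)
      ((Ideal.span_singleton_prime hx0).1 hprime) hxm⟩

instance (priority := low) IsRegularLocalRing.isDomain (A : Type*) [CommRing A]
    [IsRegularLocalRing A] : IsDomain A :=
  (IsRegularLocalRing.isDomain_and_isIntegrallyClosed _ A le_rfl).1

instance (priority := low) IsRegularLocalRing.isIntegrallyClosed (A : Type*) [CommRing A]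
    [IsRegularLocalRing A] : IsIntegrallyClosed A :=
  (IsRegularLocalRing.isDomain_and_isIntegrallyClosed _ A le_rfl).2

/-- In an integrally closed noetherian local domain, the maximal ideal is principal if it is the
annihilator of a nonzero element modulo a nonzero principal ideal. -/
theorem isPrincipalIdealRing_of_maximalIdeal_eq_colon {B : Type*} [CommRing B] [IsDomain B]
    [IsLocalRing B] [IsNoetherianRing B] [IsIntegrallyClosed B] {σ g : B} (hσ : σ ≠ 0)
    (hg : ¬ σ ∣ g) (h : ∀ r ∈ maximalIdeal B, σ ∣ r * g) : IsPrincipalIdealRing B := by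
  rw [((tfae_of_isNoetherianRing_of_isLocalRing_of_isDomain B).out 0 4 :)]
  -- The ideal `𝔪 * (g / σ)` of `B` is either contained in `𝔪`, which makes `g / σ` integral and
  -- hence `σ ∣ g`, or is all of `B`, which makes `𝔪` principal.
  by_cases hmem : ∀ r ∈ maximalIdeal B, ∃ r' ∈ maximalIdeal B, r * g = σ * r'
  · by_cases hbot : maximalIdeal B = ⊥
    · rw [hbot]; infer_instance
    exfalso
    let K := FractionRing B
    have hσK : algebraMap B K σ ≠ 0 := by simpa using hσ
    let N : Submodule B K := Submodule.map (Algebra.linearMap B K) (maximalIdeal B)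
    have hint : IsIntegral B (algebraMap B K g / algebraMap B K σ) := by
      refine isIntegral_of_smul_mem_submodule (M := K) N ?_
        (Submodule.FG.map _ (maximalIdeal B).fg_of_isNoetherianRing) _ ?_
      · intro h0
        apply hbot
        exact Submodule.map_injective_of_injective (f := Algebra.linearMap B K)
          (IsFractionRing.injective B K) (by rw [Submodule.map_bot]; exact h0)
      · rintro _ ⟨r, hr, rfl⟩
        obtain ⟨r', hr', e⟩ := hmem r hr
        refine ⟨r', hr', ?_⟩
        have e' := congrArg (algebraMap B K) e
        rw [map_mul, map_mul] at e'
        rw [Algebra.linearMap_apply, Algebra.linearMap_apply, smul_eq_mul, div_mul_eq_mul_div,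
          eq_div_iff hσK, mul_comm, ← e', mul_comm]
    obtain ⟨y, hy⟩ := (isIntegrallyClosed_iff K).1 inferInstance hint
    apply hg
    refine ⟨y, IsFractionRing.injective B K ?_⟩
    rw [map_mul, hy, mul_div_cancel₀ _ hσK]
  · push Not at hmem
    obtain ⟨r, hr, hr'⟩ := hmem
    obtain ⟨u, hu⟩ := h r hr
    have hunit : IsUnit u := by
      by_contra hu'
      exact hr' u ((IsLocalRing.mem_maximalIdeal u).2 hu') hu
    have hg0 : g ≠ 0 := by rintro rfl; exact hg (dvd_zero σ)
    refine ⟨r, le_antisymm (fun t ht => ?_) ((Ideal.span_singleton_le_iff_mem _).2 hr)⟩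
    obtain ⟨c, hc⟩ := h t ht
    rw [Ideal.submodule_span_eq, Ideal.mem_span_singleton]
    have : t * u = r * c := by
      apply mul_left_cancel₀ (mul_ne_zero hσ hg0)
      calc σ * g * (t * u) = (σ * u) * (t * g) := by ring
        _ = σ * g * (r * c) := by rw [← hu, hc]; ring
    exact (hunit.dvd_mul_right).1 ⟨c, this⟩

/-- If `y` is divisible by `σ ≠ 0` locally at every prime `p` of a regular local ring whose
localization is a principal ideal ring, then `y` is divisible by `σ`. -/
theorem IsRegularLocalRing.dvd_of_forall_prime {A : Type*} [CommRing A] [IsRegularLocalRing A]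
    {σ y : A} (hσ : σ ≠ 0)
    (h : ∀ (p : Ideal A) [p.IsPrime], IsPrincipalIdealRing (Localization.AtPrime p) →
      ∃ s ∉ p, σ ∣ s * y) : σ ∣ y := by
  by_contra hy
  have hy0 : Ideal.Quotient.mk (Ideal.span {σ}) y ≠ 0 := fun h0 =>
    hy (Ideal.mem_span_singleton.1 (Ideal.Quotient.eq_zero_iff_mem.1 h0))
  -- An associated prime `p = ((σ) : g)` of `A ⧸ (σ)` containing the annihilator of `y`. By the
  -- preceding theorem `A_p` is a principal ideal ring, so `h` yields an element of that annihilator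
  -- outside `p`.
  obtain ⟨p, hp, hle⟩ := exists_le_isAssociatedPrime_of_isNoetherianRing A _ hy0
  obtain ⟨hpp, g', hg'⟩ := (isAssociatedPrime_iff).1 hp
  obtain ⟨g, rfl⟩ := Ideal.Quotient.mk_surjective g'
  have hmem : ∀ (r z : A), r ∈ (⊥ : Submodule A (A ⧸ Ideal.span {σ})).colon
      {Ideal.Quotient.mk (Ideal.span {σ}) z} ↔ σ ∣ r * z := by
    intro r z
    rw [Submodule.mem_colon_singleton, Submodule.mem_bot, ← Ideal.mem_span_singleton,
      ← Ideal.Quotient.eq_zero_iff_mem, map_mul]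
    rfl
  have hmemp : ∀ r, r ∈ p ↔ σ ∣ r * g := fun r => by rw [← hmem, ← hg']
  have hpir : IsPrincipalIdealRing (Localization.AtPrime p) := by
    have : IsIntegrallyClosed (Localization.AtPrime p) :=
      isIntegrallyClosed_of_isLocalization _ p.primeCompl p.primeCompl_le_nonZeroDivisors
    refine isPrincipalIdealRing_of_maximalIdeal_eq_colon
      (σ := algebraMap A _ σ) (g := algebraMap A _ g) ?_ ?_ ?_
    · have hinj := IsLocalization.injective (Localization.AtPrime p)
        p.primeCompl_le_nonZeroDivisors
      simpa [map_eq_zero_iff _ hinj] using hσ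
    · rintro ⟨b, hb⟩
      obtain ⟨⟨a, s⟩, has⟩ := IsLocalization.surj p.primeCompl b
      have h1 : algebraMap A (Localization.AtPrime p) (s * g) = algebraMap A _ (σ * a) := by
        rw [map_mul, map_mul, ← has, hb]; ring
      obtain ⟨t, ht⟩ := (IsLocalization.eq_iff_exists p.primeCompl _).1 h1
      exact (t * s).2 ((hmemp _).2 ⟨t * a, by
        rw [Submonoid.coe_mul, mul_assoc, ht]; ring⟩)
    · intro r hr
      obtain ⟨a, s, rfl⟩ := IsLocalization.exists_mk'_eq p.primeCompl r
      obtain ⟨c, hc⟩ := (hmemp _).1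
        ((IsLocalization.AtPrime.mk'_mem_maximal_iff (Localization.AtPrime p) p a s).1 hr)
      refine ⟨IsLocalization.mk' _ c s, ?_⟩
      rw [mul_comm, IsLocalization.mul_mk'_eq_mk'_of_mul, IsLocalization.mul_mk'_eq_mk'_of_mul,
        mul_comm g a, ← hc]
  obtain ⟨s, hs, hsy⟩ := h p hpir
  exact hs (hle ((hmem s y).2 hsy))

end RegularLocalRing

theorem isPrincipalIdealRing_localization_of_le {A : Type*} [CommRing A] {p q : Ideal A}
    [p.IsPrime] [q.IsPrime] (hqp : q ≤ p) [h : IsPrincipalIdealRing (Localization.AtPrime p)] :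
    IsPrincipalIdealRing (Localization.AtPrime q) := by
  have hle : p.primeCompl ≤ q.primeCompl := fun x hx hxq => hx (hqp hxq)
  let f : Localization.AtPrime p →+* Localization.AtPrime q :=
    IsLocalization.map (M := p.primeCompl) (T := q.primeCompl) (Localization.AtPrime q)
      (RingHom.id A) hle
  have hf : ∀ a, f (algebraMap A _ a) = algebraMap A _ a := fun a => IsLocalization.map_eq _ a
  refine ⟨fun J => ?_⟩
  obtain ⟨c, hc⟩ := (h.principal (Ideal.comap f J)).principal
  refine ⟨f c, le_antisymm (fun x hx => ?_) ?_⟩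
  · obtain ⟨a, s, rfl⟩ := IsLocalization.exists_mk'_eq q.primeCompl x
    have ha : algebraMap A (Localization.AtPrime q) a ∈ J := by
      rw [← IsLocalization.mk'_spec (Localization.AtPrime q) a s]
      exact J.mul_mem_right _ hx
    have ha' : algebraMap A (Localization.AtPrime p) a ∈ Ideal.comap f J := by
      rw [Ideal.mem_comap, hf]; exact ha
    rw [hc, Ideal.submodule_span_eq, Ideal.mem_span_singleton] at ha'
    obtain ⟨d, hd⟩ := ha'
    rw [Ideal.submodule_span_eq, Ideal.mem_span_singleton]
    refine ⟨f d * IsLocalization.mk' _ 1 s, ?_⟩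
    rw [← mul_assoc, ← map_mul, ← hd, hf, IsLocalization.mul_mk'_eq_mk'_of_mul, mul_one]
  · rw [Ideal.submodule_span_eq, Ideal.span_singleton_le_iff_mem]
    have : c ∈ Ideal.comap f J := by
      rw [hc]; exact Submodule.mem_span_singleton_self c
    exact this

/-! ### The codimension-one locus of `R` and gluing over it -/

section

variable (Λ : Type v) {R : Type u} [CommRing Λ] [CommRing R] [Algebra Λ R]

/-- The primes of `R` lying over the primes of `Λ` whose localization is a principal ideal ring. -/
def pirLocus (R : Type u) [CommRing R] [Algebra Λ R] : Set (PrimeSpectrum R) :=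
  {Q | IsPrincipalIdealRing (Localization.AtPrime (Q.asIdeal.under Λ))}

variable {Λ}

/-- Otherwise some prime `Q ⊇ I` avoids the image of `Λ ∖ p`. It lies over a prime contained in `p`,
hence belongs to `pirLocus`. -/
theorem exists_mem_of_forall_not_le (p : Ideal Λ) [p.IsPrime]
    [IsPrincipalIdealRing (Localization.AtPrime p)] {I : Ideal R}
    (hI : ∀ Q ∈ pirLocus Λ R, ¬ I ≤ Q.asIdeal) : ∃ s ∉ p, algebraMap Λ R s ∈ I := by
  by_contra! hcon
  have hdisj : Disjoint (I : Set R) (Algebra.algebraMapSubmonoid R p.primeCompl) := by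
    rw [Set.disjoint_left]
    rintro _ hx ⟨s, hs, rfl⟩
    exact hcon s hs hx
  obtain ⟨Q, hQ, hIQ, hQd⟩ := Ideal.exists_le_prime_disjoint I _ hdisj
  have hle : Q.under Λ ≤ p := by
    intro s hs
    by_contra hsp
    exact Set.disjoint_left.1 hQd hs ⟨s, hsp, rfl⟩
  exact hI ⟨Q, hQ⟩ (isPrincipalIdealRing_localization_of_le hle) hIQ

theorem height_le_one_of_isPrincipalIdealRing [IsDomain Λ] (p : Ideal Λ) [p.IsPrime]
    [IsPrincipalIdealRing (Localization.AtPrime p)] : p.height ≤ 1 := by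
  have h := IsLocalization.AtPrime.ringKrullDim_eq_height p (Localization.AtPrime p)
  have : Ring.KrullDimLE 1 (Localization.AtPrime p) := inferInstance
  have h1 := (Ring.krullDimLE_iff).1 this
  rw [h] at h1
  exact_mod_cast h1

/-- Incomparability: in the integral extension, strict inclusions of primes stay strict after
contraction to `Λ`. This is what makes the pseudo-nullity hypotheses available on `pirLocus`. -/
theorem height_le_one_of_mem_pirLocus [IsDomain Λ] [Module.Finite Λ R] {Q : PrimeSpectrum R}
    (hQ : Q ∈ pirLocus Λ R) : Q.asIdeal.height ≤ 1 := by
  have : IsPrincipalIdealRing (Localization.AtPrime (Q.asIdeal.under Λ)) := hQ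
  have hp := height_le_one_of_isPrincipalIdealRing (Q.asIdeal.under Λ)
  have hlt : ∀ I J : Ideal R, I.IsPrime → I < J → I.under Λ < J.under Λ := by
    intro I J hI hIJ
    exact Ideal.comap_lt_comap_of_integral_mem_sdiff hIJ.le (Set.exists_of_ssubset hIJ).choose_spec
      (Algebra.IsIntegral.isIntegral _)
  have h1 : ((1 : ℕ) : ℕ∞) = 1 := rfl
  rw [← h1, Ideal.height_le_iff] at hp ⊢
  intro q hq hqQ
  have h2 := hp (q.under Λ) inferInstance (hlt q _ hq hqQ)
  rw [h1, Order.lt_one_iff, Ideal.height_eq_zero_iff] at h2 ⊢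
  refine ⟨⟨hq, bot_le⟩, fun q' hq' hle => ?_⟩
  by_contra hcon
  have h3 := hlt q' q hq'.1 (lt_of_le_not_ge hle hcon)
  have := hq'.1
  exact h3.not_ge (h2.2 ⟨(inferInstance : (q'.under Λ).IsPrime), bot_le⟩ h3.le)

/-- A finitely generated pseudo-null module is killed by an element of `Λ` outside `p`. -/
theorem IsPseudoNull.exists_smul_eq_zero [IsDomain Λ] [Module.Finite Λ R] {M : Type*} [AddCommGroup M]
    [Module R M] [Module.Finite R M] (hM : IsPseudoNull R M) (p : Ideal Λ) [p.IsPrime]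
    [IsPrincipalIdealRing (Localization.AtPrime p)] :
    ∃ s ∉ p, ∀ m : M, algebraMap Λ R s • m = 0 := by
  obtain ⟨s, hs, hsI⟩ := exists_mem_of_forall_not_le p (I := Module.annihilator R M) (by
    intro Q hQ hle
    have h1 := hM Q.asIdeal (height_le_one_of_mem_pirLocus hQ)
    have h2 : Q ∈ Module.support R M := by
      rw [Module.mem_support_iff_of_finite]; exact hle
    rw [Module.mem_support_iff] at h2
    exact not_nontrivial_iff_subsingleton.2 h1 h2)
  exact ⟨s, hs, fun m => Module.mem_annihilator.1 hsI m⟩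

instance isPrincipalIdealRing_localization_bot [IsDomain Λ] [(⊥ : Ideal Λ).IsPrime] :
    IsPrincipalIdealRing (Localization.AtPrime (⊥ : Ideal Λ)) := by
  have : IsField (Localization.AtPrime (⊥ : Ideal Λ)) := by
    rw [IsLocalRing.isField_iff_maximalIdeal_eq, ← Localization.AtPrime.map_eq_maximalIdeal,
      Ideal.map_bot]
  let := this.toField
  infer_instance

/-- The case `p = 0`, where the localization is the fraction field of `Λ`. -/
theorem exists_ne_zero_mem [IsDomain Λ] {I : Ideal R} (hI : ∀ Q ∈ pirLocus Λ R, ¬ I ≤ Q.asIdeal) :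
    ∃ s : Λ, s ≠ 0 ∧ algebraMap Λ R s ∈ I := by
  have : (⊥ : Ideal Λ).IsPrime := Ideal.isPrime_bot
  obtain ⟨s, hs, hsI⟩ := exists_mem_of_forall_not_le (⊥ : Ideal Λ) hI
  exact ⟨s, by simpa using hs, hsI⟩

variable [IsRegularLocalRing Λ] [Module.Free Λ R]

theorem algebraMap_mem_nonZeroDivisors {s : Λ} (hs : s ≠ 0) :
    algebraMap Λ R s ∈ nonZeroDivisors R := by
  rw [mem_nonZeroDivisors_iff_right]
  intro x hx
  rw [mul_comm, ← Algebra.smul_def] at hx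
  exact (smul_eq_zero.1 hx).resolve_left hs

theorem eq_zero_of_forall_pirLocus {r : R} (h : ∀ Q ∈ pirLocus Λ R, ∃ s ∉ Q.asIdeal, s * r = 0) :
    r = 0 := by
  obtain ⟨s, hs, hsr⟩ := exists_ne_zero_mem (Λ := Λ) (I := Ideal.span {r} |>.annihilator) (by
    intro Q hQ hle
    obtain ⟨s, hs, hsr⟩ := h Q hQ
    exact hs (hle ((Submodule.mem_annihilator_span_singleton _ _).2 hsr)))
  rw [Submodule.mem_annihilator_span_singleton, algebraMap_smul] at hsr
  exact (smul_eq_zero.1 hsr).resolve_left hs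

theorem eq_of_forall_pirLocus {r r' : R}
    (h : ∀ Q ∈ pirLocus Λ R, ∃ s ∉ Q.asIdeal, s * r = s * r') : r = r' := by
  rw [← sub_eq_zero]
  refine eq_zero_of_forall_pirLocus (Λ := Λ) fun Q hQ => ?_
  obtain ⟨s, hs, e⟩ := h Q hQ
  exact ⟨s, hs, by rw [mul_sub, e, sub_self]⟩

/-- Divisibility by `σ : Λ` is read off from the coordinates in a `Λ`-basis of `R`, which reduces it
to `IsRegularLocalRing.dvd_of_forall_prime`. -/
theorem dvd_of_forall_pirLocus {σ : Λ} (hσ : σ ≠ 0) {y : R}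
    (h : ∀ Q ∈ pirLocus Λ R, ∃ s ∉ Q.asIdeal, algebraMap Λ R σ ∣ s * y) :
    algebraMap Λ R σ ∣ y := by
  let b := Module.Free.chooseBasis Λ R
  have hcoord : ∀ z : R, algebraMap Λ R σ ∣ z ↔ ∀ i, σ ∣ b.repr z i := by
    intro z
    constructor
    · rintro ⟨c, rfl⟩ i
      rw [← Algebra.smul_def, map_smul, Finsupp.smul_apply, smul_eq_mul]
      exact dvd_mul_right _ _
    · intro hz
      choose f hf using hz
      rw [← b.linearCombination_repr z, Finsupp.linearCombination_apply, Finsupp.sum]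
      refine Finset.dvd_sum fun i _ => ?_
      rw [hf i, mul_smul, Algebra.smul_def]
      exact dvd_mul_right _ _
  rw [hcoord]
  intro i
  refine IsRegularLocalRing.dvd_of_forall_prime hσ fun p _ hp => ?_
  obtain ⟨s, hs, hsI⟩ := exists_mem_of_forall_not_le p
    (I := (Ideal.span {algebraMap Λ R σ}).colon {y}) (by
      intro Q hQ hle
      obtain ⟨s, hs, hsy⟩ := h Q hQ
      refine hs (hle ?_)
      rw [Submodule.mem_colon_singleton, smul_eq_mul, Ideal.mem_span_singleton]
      exact hsy)
  rw [Submodule.mem_colon_singleton, algebraMap_smul, Ideal.mem_span_singleton, hcoord] at hsI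
  refine ⟨s, hs, ?_⟩
  simpa using hsI i

/-- Gluing of elements of `R` given locally on `pirLocus`. -/
theorem existsUnique_glue {ι : Type*} (s : ι → R) (hs : ∀ Q ∈ pirLocus Λ R, ∃ i, s i ∉ Q.asIdeal)
    (r : ι → R) (hr : ∀ i j, s i * r j = s j * r i) : ∃! x : R, ∀ i, s i * x = r i := by
  refine existsUnique_of_exists_of_unique ?_ ?_
  · obtain ⟨σ, hσ, hσI⟩ := exists_ne_zero_mem (Λ := Λ) (I := Ideal.span (Set.range s)) (by
      intro Q hQ hle
      obtain ⟨i, hi⟩ := hs Q hQ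
      exact hi (hle (Ideal.subset_span ⟨i, rfl⟩)))
    -- With `σ = ∑ c j * s j`, the glued element must be `(∑ c j * r j) / σ`; the compatibility `hr`
    -- shows that the division is possible locally.
    obtain ⟨c, hc⟩ := (Finsupp.mem_ideal_span_range_iff_exists_finsupp).1 hσI
    have key : ∀ i, s i * (c.sum fun j a => a * r j) = algebraMap Λ R σ * r i := by
      intro i
      rw [← hc, Finsupp.sum, Finsupp.sum, Finset.mul_sum, Finset.sum_mul]
      refine Finset.sum_congr rfl fun j _ => ?_
      linear_combination c j * hr i j
    obtain ⟨x, hx⟩ := dvd_of_forall_pirLocus (Λ := Λ) hσ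
      (y := c.sum fun j a => a * r j) (by
        intro Q hQ
        obtain ⟨i, hi⟩ := hs Q hQ
        exact ⟨s i, hi, _, key i⟩)
    refine ⟨x, fun i => ?_⟩
    have h1 := key i
    rw [hx] at h1
    have h2 : algebraMap Λ R σ * (s i * x) = algebraMap Λ R σ * r i := by
      rw [← h1]; ring
    exact (mul_cancel_left_mem_nonZeroDivisors (algebraMap_mem_nonZeroDivisors hσ)).1 h2
  · intro x y hx hy
    refine eq_of_forall_pirLocus (Λ := Λ) fun Q hQ => ?_
    obtain ⟨i, hi⟩ := hs Q hQ
    exact ⟨s i, hi, by rw [hx, hy]⟩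

/-- Gluing of linear forms given locally on `pirLocus`. -/
theorem exists_linearMap_glue {ι : Type*} (s : ι → R)
    (hs : ∀ Q ∈ pirLocus Λ R, ∃ i, s i ∉ Q.asIdeal) {M : Type*} [AddCommGroup M] [Module R M]
    (g : ι → M →ₗ[R] R) (hg : ∀ i j m, s i * g j m = s j * g i m) :
    ∃ f : M →ₗ[R] R, ∀ i m, s i * f m = g i m := by
  choose f hf using fun m => (existsUnique_glue (Λ := Λ) s hs (fun i => g i m)
    (fun i j => hg i j m)).exists
  refine ⟨⟨⟨f, fun m n => ?_⟩, fun c m => ?_⟩, fun i m => hf m i⟩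
  · refine eq_of_forall_pirLocus (Λ := Λ) fun Q hQ => ?_
    obtain ⟨i, hi⟩ := hs Q hQ
    exact ⟨s i, hi, by rw [hf, mul_add, hf, hf, map_add]⟩
  · refine eq_of_forall_pirLocus (Λ := Λ) fun Q hQ => ?_
    obtain ⟨i, hi⟩ := hs Q hQ
    refine ⟨s i, hi, ?_⟩
    simp only [RingHom.id_apply]
    rw [hf, smul_eq_mul, mul_left_comm, hf, map_smul, smul_eq_mul]

/-- A rank one statement: the dual of `Y` is free of rank one, with a generator determined by the
conditions in `T`, if this is so locally on `pirLocus`. -/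
theorem existsUnique_dualEquiv {X Y : Type*} [AddCommGroup X] [Module R X] [AddCommGroup Y]
    [Module R Y] (α : X →ₗ[R] Module.Dual R Y) (T : Set (X × R × R))
    (h : ∀ Q ∈ pirLocus Λ R, ∃ s ∉ Q.asIdeal, ∃ y₀ : Y,
      (∀ y : Y, ∃ c ∉ Q.asIdeal, ∃ r : R, c • y = r • y₀) ∧
      (∃ a ∈ T, a.2.2 ∉ Q.asIdeal) ∧
      ∀ a ∈ T, a.2.1 * α a.1 y₀ = s * a.2.2) :
    ∃! η : Module.Dual R Y ≃ₗ[R] R, ∀ a ∈ T, η (α a.1) * a.2.1 = a.2.2 := by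
  choose! s hs y₀ hy ha hT using h
  choose! a haT hav using ha
  -- compatibility of the linear forms `t • α x`
  have compatT : ∀ a ∈ T, ∀ b ∈ T, ∀ y : Y,
      a.2.2 * (b.2.1 * α b.1 y) = b.2.2 * (a.2.1 * α a.1 y) := by
    intro a ha b hb y
    refine eq_of_forall_pirLocus (Λ := Λ) fun Q hQ => ?_
    obtain ⟨c, hc, r, hcr⟩ := hy Q hQ y
    refine ⟨c, hc, ?_⟩
    have h1 : c * α a.1 y = r * α a.1 (y₀ Q) := by
      rw [← smul_eq_mul, ← map_smul, hcr, map_smul, smul_eq_mul]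
    have h2 : c * α b.1 y = r * α b.1 (y₀ Q) := by
      rw [← smul_eq_mul, ← map_smul, hcr, map_smul, smul_eq_mul]
    linear_combination a.2.2 * b.2.1 * h2 - b.2.2 * a.2.1 * h1 +
      r * a.2.2 * hT Q hQ b hb - r * b.2.2 * hT Q hQ a ha
  -- evaluation of a functional in terms of the `y₀`
  have compaty : ∀ Q ∈ pirLocus Λ R, ∀ (f : Module.Dual R Y) (b) (_ : b ∈ T) (y : Y),
      s Q * b.2.2 * f y = f (y₀ Q) * (b.2.1 * α b.1 y) := by
    intro Q hQ f b hb y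
    refine eq_of_forall_pirLocus (Λ := Λ) fun Q' hQ' => ?_
    obtain ⟨c, hc, r, hcr⟩ := hy Q' hQ' y
    obtain ⟨c', hc', r', hcr'⟩ := hy Q' hQ' (y₀ Q)
    refine ⟨c * c' * (a Q').2.2, ?_, ?_⟩
    · exact fun hmem => (Q'.2.mem_or_mem hmem).elim
        (fun h => (Q'.2.mem_or_mem h).elim hc hc') (hav Q' hQ')
    have h1 : ∀ g : Module.Dual R Y, c * g y = r * g (y₀ Q') := fun g => by
      rw [← smul_eq_mul, ← map_smul, hcr, map_smul, smul_eq_mul]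
    have h2 : ∀ g : Module.Dual R Y, c' * g (y₀ Q) = r' * g (y₀ Q') := fun g => by
      rw [← smul_eq_mul, ← map_smul, hcr', map_smul, smul_eq_mul]
    have e1 := hT Q' hQ' _ (haT Q' hQ')
    have e2 := hT Q hQ _ (haT Q' hQ')
    have e3 := hT Q' hQ' b hb
    -- `c' s Q v' = r' s Q' v'`
    have e4 : c' * s Q * (a Q').2.2 = r' * s Q' * (a Q').2.2 := by
      linear_combination (a Q').2.1 * h2 (α (a Q').1) - c' * e2 + r' * e1
    linear_combination c' * (a Q').2.2 * s Q * b.2.2 * h1 f + r * b.2.2 * f (y₀ Q') * e4 -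
      c * (a Q').2.2 * b.2.1 * α b.1 y * h2 f - (a Q').2.2 * r' * f (y₀ Q') * b.2.1 * h1 (α b.1) -
      (a Q').2.2 * r' * f (y₀ Q') * r * e3
  have compats : ∀ Q ∈ pirLocus Λ R, ∀ Q' ∈ pirLocus Λ R, ∀ f : Module.Dual R Y,
      s Q * f (y₀ Q') = s Q' * f (y₀ Q) := by
    intro Q hQ Q' hQ' f
    refine eq_of_forall_pirLocus (Λ := Λ) fun Q'' hQ'' => ⟨(a Q'').2.2, hav Q'' hQ'', ?_⟩
    linear_combination compaty Q hQ f _ (haT Q'' hQ'') (y₀ Q') +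
      f (y₀ Q) * hT Q' hQ' _ (haT Q'' hQ'')
  -- At `Q` the isomorphism is `f ↦ f (y₀ Q) / s Q`.
  obtain ⟨η, hη⟩ := exists_linearMap_glue (Λ := Λ) (ι := pirLocus Λ R) (fun Q => s Q)
    (fun Q hQ => ⟨⟨Q, hQ⟩, hs Q hQ⟩) (M := Module.Dual R Y)
    (fun Q => Module.Dual.eval R Y (y₀ Q)) (fun Q Q' f => compats Q Q.2 Q' Q'.2 f)
  simp only [Module.Dual.eval_apply] at hη
  have hηT : ∀ b ∈ T, η (α b.1) * b.2.1 = b.2.2 := by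
    intro b hb
    refine eq_of_forall_pirLocus (Λ := Λ) fun Q hQ => ⟨s Q, hs Q hQ, ?_⟩
    linear_combination b.2.1 * hη ⟨Q, hQ⟩ (α b.1) + hT Q hQ b hb
  have hinj : Function.Injective η := by
    rw [injective_iff_map_eq_zero]
    intro f hf
    ext y
    refine eq_of_forall_pirLocus (Λ := Λ) fun Q hQ => ?_
    obtain ⟨c, hc, r, hcr⟩ := hy Q hQ y
    refine ⟨c, hc, ?_⟩
    rw [← smul_eq_mul, ← map_smul, hcr, map_smul, ← hη ⟨Q, hQ⟩, hf]
    simp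
  have hsurj : Function.Surjective η := by
    intro x
    -- The preimage of `x` is locally `(x * a.2.1 / a.2.2) • α a.1`, where `a ∈ T` has `a.2.2 ∉ Q`.
    obtain ⟨f, hf⟩ := exists_linearMap_glue (Λ := Λ) (ι := pirLocus Λ R) (fun Q => (a Q).2.2)
      (fun Q hQ => ⟨⟨Q, hQ⟩, hav Q hQ⟩) (M := Y)
      (fun Q => (x * (a Q).2.1) • α (a Q).1) (fun Q Q' y => by
        simp only [LinearMap.smul_apply, smul_eq_mul]
        linear_combination x * compatT _ (haT Q Q.2) _ (haT Q' Q'.2) y)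
    refine ⟨f, eq_of_forall_pirLocus (Λ := Λ) fun Q hQ => ⟨s Q * (a Q).2.2, ?_, ?_⟩⟩
    · exact fun hmem => (Q.2.mem_or_mem hmem).elim (hs Q hQ) (hav Q hQ)
    · have h1 := hf ⟨Q, hQ⟩ (y₀ Q)
      simp only [LinearMap.smul_apply, smul_eq_mul] at h1
      linear_combination (a Q).2.2 * hη ⟨Q, hQ⟩ f + h1 + x * hT Q hQ _ (haT Q hQ)
  have hbij : Function.Bijective η := ⟨hinj, hsurj⟩
  refine ⟨LinearEquiv.ofBijective η hbij, hηT, fun η' hη' => ?_⟩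
  ext f
  refine eq_of_forall_pirLocus (Λ := Λ) fun Q hQ => ⟨s Q * (a Q).2.2, ?_, ?_⟩
  · exact fun hmem => (Q.2.mem_or_mem hmem).elim (hs Q hQ) (hav Q hQ)
  -- Near `Q` every functional is a multiple of `α (a Q).1`, on which the condition from `T`
  -- prescribes the value of any `η'`.
  · have h1 : (s Q * (a Q).2.2) • f = (f (y₀ Q) * (a Q).2.1) • α (a Q).1 := by
      ext y
      simp only [LinearMap.smul_apply, smul_eq_mul]
      linear_combination compaty Q hQ f _ (haT Q hQ) y
    have h2 : ∀ g : Module.Dual R Y →ₗ[R] R,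
        s Q * (a Q).2.2 * g f = f (y₀ Q) * (a Q).2.1 * g (α (a Q).1) := fun g => by
      rw [← smul_eq_mul, ← map_smul, h1, map_smul, smul_eq_mul]
    have h3 := h2 η'.toLinearMap
    simp only [LinearEquiv.coe_coe] at h3
    change s Q * (a Q).2.2 * η' f = s Q * (a Q).2.2 * η f
    linear_combination h3 - h2 η + f (y₀ Q) * hη' _ (haT Q hQ) - f (y₀ Q) * hηT _ (haT Q hQ)

end

/-! ### Bases up to a denominator -/

/-- Families `v` in `M` and `q` in the dual of `M` that form a pair of dual bases up to the
denominator `s`. -/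
structure IsScaledBasis {A M : Type*} [CommRing A] [AddCommGroup M] [Module A M] {n : ℕ} (s : A)
    (v : Fin n → M) (q : Fin n → Module.Dual A M) : Prop where
  sum_smul : ∀ m, ∑ j, q j m • v j = s • m
  apply_eq : ∀ i j, q i (v j) = if i = j then s else 0

theorem IsScaledBasis.smul {A M : Type*} [CommRing A] [AddCommGroup M] [Module A M] {n : ℕ} {s : A}
    {v : Fin n → M} {q : Fin n → Module.Dual A M} (h : IsScaledBasis s v q) (c : A) :
    IsScaledBasis (c * s) v (c • q) where
  sum_smul m := by
    simp only [Pi.smul_apply, LinearMap.smul_apply, smul_eq_mul, mul_smul]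
    rw [← Finset.smul_sum, h.sum_smul]
  apply_eq i j := by
    simp only [Pi.smul_apply, LinearMap.smul_apply, smul_eq_mul, h.apply_eq]
    split_ifs <;> simp

section Localization

variable {A M : Type*} [CommRing A] [AddCommGroup M] [Module A M] (p : Ideal A) [p.IsPrime]

/-- A basis of the localization is scaled into the image of `M`. Finite presentation descends its
coordinate map to `ψ : M → A^n` up to a denominator, and the two inverse relations hold after
multiplication by further denominators `c₁`, `c₂`. -/
theorem exists_isScaledBasis [Module.FinitePresentation A M]
    [Module.Free (Localization.AtPrime p) (LocalizedModule p.primeCompl M)] :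
    ∃ s ∉ p, ∃ (n : ℕ) (v : Fin n → M) (q : Fin n → Module.Dual A M),
      n = Module.finrank (Localization.AtPrime p) (LocalizedModule p.primeCompl M) ∧
      IsScaledBasis s v q := by
  let B := Localization.AtPrime p
  let N := LocalizedModule p.primeCompl M
  let ℓ : M →ₗ[A] N := LocalizedModule.mkLinearMap p.primeCompl M
  have : Module.Finite B N := Module.Finite.of_isLocalizedModule p.primeCompl ℓ
  let n := Module.finrank B N
  let b₀ : Module.Basis (Fin n) B N := Module.finBasis B N
  choose x hx using fun i => IsLocalizedModule.surj p.primeCompl ℓ (b₀ i)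
  let b : Module.Basis (Fin n) B N := b₀.isUnitSMul
    (w := fun i => algebraMap A B (x i).2) (fun i => IsLocalization.map_units B (x i).2)
  have hb : ∀ i, b i = ℓ (x i).1 := by
    intro i
    rw [Module.Basis.isUnitSMul_apply, algebraMap_smul, ← hx i]; rfl
  let φ : (Fin n → A) →ₗ[A] M := Fintype.linearCombination A (fun i => (x i).1)
  let f : (Fin n → A) →ₗ[A] (Fin n → B) :=
    .pi fun i ↦ Algebra.linearMap A B ∘ₗ .proj i
  have : IsLocalizedModule p.primeCompl f := IsLocalizedModule.pi _ _
  obtain ⟨ψ, s, hψ⟩ := Module.FinitePresentation.exists_lift_of_isLocalizedModule p.primeCompl f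
    ((b.equivFun.toLinearMap.restrictScalars A) ∘ₗ ℓ)
  have hψ' : ∀ m, f (ψ m) = (s : A) • b.equivFun (ℓ m) := fun m => LinearMap.congr_fun hψ m
  have hφ : ∀ y, b.equivFun (ℓ (φ y)) = f y := by
    intro y
    have h1 : ℓ (φ y) = ∑ i, algebraMap A B (y i) • b i := by
      rw [Fintype.linearCombination_apply, map_sum]
      exact Finset.sum_congr rfl fun i _ => by rw [map_smul, hb, algebraMap_smul]
    have h2 : b.equivFun (∑ i, algebraMap A B (y i) • b i) = ∑ i, algebraMap A B (y i) •
        (Pi.single i 1 : Fin n → B) := by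
      rw [map_sum]
      exact Finset.sum_congr rfl fun i _ => by
        rw [LinearEquiv.map_smul]
        congr 1
        ext k
        rw [Module.Basis.equivFun_self]
        simp [Pi.single_apply, eq_comm]
    rw [h1, h2]
    ext i
    simp only [Finset.sum_apply, Pi.smul_apply, Pi.single_apply, smul_eq_mul, mul_ite, mul_one,
      mul_zero, Finset.sum_ite_eq, Finset.mem_univ, if_true]
    rfl
  obtain ⟨c₁, hc₁⟩ := Module.Finite.exists_smul_of_comp_eq_of_isLocalizedModule p.primeCompl f
    (ψ ∘ₗ φ) ((s : A) • LinearMap.id) (by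
      refine LinearMap.ext fun y => ?_
      simp only [LinearMap.comp_apply, hψ', LinearMap.smul_apply, LinearMap.id_apply, map_smul]
      rw [hφ])
  obtain ⟨c₂, hc₂⟩ := Module.Finite.exists_smul_of_comp_eq_of_isLocalizedModule p.primeCompl ℓ
    (φ ∘ₗ ψ) ((s : A) • LinearMap.id) (by
      ext m : 1
      apply b.equivFun.injective
      simp only [LinearMap.comp_apply, LinearMap.smul_apply, LinearMap.id_apply, map_smul]
      rw [hφ, hψ']
      exact (LinearMap.map_smul_of_tower b.equivFun.toLinearMap _ _).symm)
  refine ⟨c₁ * c₂ * s, (c₁ * c₂ * s).2, n, fun i => (x i).1,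
    fun i => ((c₁ * c₂ : p.primeCompl) : A) • (LinearMap.proj i ∘ₗ ψ), rfl, ?_, ?_⟩
  · intro m
    have := LinearMap.congr_fun hc₂ m
    simp only [LinearMap.smul_apply, LinearMap.comp_apply, LinearMap.id_apply] at this
    simp only [LinearMap.smul_apply, LinearMap.comp_apply, LinearMap.proj_apply, smul_eq_mul,
      mul_smul, ← Finset.smul_sum, Submonoid.coe_mul]
    congr 1
  · intro i j
    have := congrFun (LinearMap.congr_fun hc₁ (Pi.single j 1)) i
    simp only [LinearMap.smul_apply, LinearMap.comp_apply, LinearMap.id_apply, Pi.smul_apply] at this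
    have h1 : φ (Pi.single j 1) = (x j).1 := by
      simp [φ]
    rw [h1] at this
    have this' : (c₁ : A) * ψ (x j).1 i = c₁ * (s * (Pi.single j 1 : Fin n → A) i) := this
    simp only [LinearMap.smul_apply, LinearMap.comp_apply, LinearMap.proj_apply, smul_eq_mul,
      Submonoid.coe_mul]
    rw [mul_right_comm, this', Pi.single_apply]
    split_ifs <;> ring

/-- Generation and independence up to factors outside `p` become a genuine basis after localization.
-/
theorem finrank_localizedModule_eq_card {ι : Type*} [Fintype ι] (v : ι → M) {s t : A} (hs : s ∉ p)
    (ht : t ∉ p) (hspan : ∀ m : M, s • m ∈ Submodule.span A (Set.range v))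
    (hind : ∀ α : ι → A, ∑ i, α i • v i = 0 → ∀ i, t * α i = 0) :
    Module.finrank (Localization.AtPrime p) (LocalizedModule p.primeCompl M) = Fintype.card ι := by
  let B := Localization.AtPrime p
  let N := LocalizedModule p.primeCompl M
  let ℓ : M →ₗ[A] N := LocalizedModule.mkLinearMap p.primeCompl M
  have hli : LinearIndependent B (fun i => ℓ (v i)) := by
    rw [Fintype.linearIndependent_iff]
    intro g hg i
    obtain ⟨b, hb⟩ := IsLocalization.exist_integer_multiples_of_finite p.primeCompl g
    choose a ha using hb
    have h1 : ℓ (∑ i, a i • v i) = 0 := by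
      rw [map_sum]
      have : ∀ i, ℓ (a i • v i) = (b : A) • (g i • ℓ (v i)) := by
        intro i
        rw [map_smul, ← algebraMap_smul B (a i), ha i, smul_assoc]
      simp only [this]
      rw [← Finset.smul_sum, hg, smul_zero]
    obtain ⟨c, hc⟩ := (IsLocalizedModule.eq_zero_iff p.primeCompl ℓ).1 h1
    have h2 : ∑ i, (c * a i) • v i = 0 := by
      rw [← hc, Finset.smul_sum]
      exact Finset.sum_congr rfl fun i _ => by rw [mul_smul]; rfl
    have h3 := hind _ h2 i
    have h4 : algebraMap A B (a i) = 0 := by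
      have := congrArg (algebraMap A B) h3
      rw [← mul_assoc, map_mul, map_zero] at this
      have hu : IsUnit (algebraMap A B (t * c)) :=
        IsLocalization.map_units B (⟨t, ht⟩ * c : p.primeCompl)
      exact (hu.mul_right_eq_zero).1 this
    rw [ha i] at h4
    have hu : IsUnit (algebraMap A B b) := IsLocalization.map_units B b
    rw [← hu.mul_right_eq_zero, ← Algebra.smul_def]
    exact h4
  have hsp : ⊤ ≤ Submodule.span B (Set.range fun i => ℓ (v i)) := by
    intro y _
    obtain ⟨⟨m, c⟩, hm⟩ := IsLocalizedModule.surj p.primeCompl ℓ y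
    have hu : IsUnit (algebraMap A B (s * c)) :=
      IsLocalization.map_units B (⟨s, hs⟩ * c : p.primeCompl)
    rw [← Submodule.smul_mem_iff_of_isUnit _ hu, algebraMap_smul, mul_smul]
    have h1 : (c : A) • y = ℓ m := hm
    rw [h1, ← map_smul]
    have h2 : ∀ z ∈ Submodule.span A (Set.range v),
        ℓ z ∈ Submodule.span B (Set.range fun i => ℓ (v i)) := by
      intro z hz
      induction hz using Submodule.span_induction with
      | mem x hx => obtain ⟨i, rfl⟩ := hx; exact Submodule.subset_span ⟨i, rfl⟩
      | zero => rw [map_zero]; exact zero_mem _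
      | add x y _ _ hx hy => rw [map_add]; exact add_mem hx hy
      | smul a x _ hx =>
        rw [map_smul, ← algebraMap_smul B a]; exact Submodule.smul_mem _ _ hx
    exact h2 _ (hspan m)
  rw [Module.finrank_eq_card_basis (Module.Basis.mk hli hsp)]

/-- Once `s` is inverted, `M` is a direct summand of a finite projective module, and finite
projective modules over local rings are free. -/
theorem free_localizedModule_of_retract {P : Type*} [AddCommGroup P] [Module A P]
    [Module.Finite A P] [Module.Projective A P] (j : M →ₗ[A] P) (r : P →ₗ[A] M) {s : A} (hs : s ∉ p)
    (h : ∀ m, r (j m) = s • m) :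
    Module.Free (Localization.AtPrime p) (LocalizedModule p.primeCompl M) := by
  let B := Localization.AtPrime p
  have : Module.Projective B (LocalizedModule p.primeCompl P) :=
    Module.projective_of_isLocalizedModule p.primeCompl (LocalizedModule.mkLinearMap _ P)
  have hu : IsUnit (algebraMap A B s) := IsLocalization.map_units B (⟨s, hs⟩ : p.primeCompl)
  obtain ⟨c, hc⟩ := hu.exists_left_inv
  have hsplit : (c • LocalizedModule.map p.primeCompl r) ∘ₗ LocalizedModule.map p.primeCompl j =
      LinearMap.id := by
    refine LinearMap.ext fun x => ?_
    induction x using LocalizedModule.induction_on with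
    | h m t =>
    rw [LinearMap.comp_apply, LinearMap.smul_apply, LocalizedModule.map_mk,
      LocalizedModule.map_mk, h, ← LocalizedModule.smul'_mk, ← algebraMap_smul B s, ← mul_smul,
      hc, one_smul, LinearMap.id_apply]
  have hproj : Module.Projective B (LocalizedModule p.primeCompl M) :=
    Module.Projective.of_split _ _ hsplit
  have : Module.Finite B (LocalizedModule p.primeCompl P) :=
    Module.Finite.of_isLocalizedModule p.primeCompl (LocalizedModule.mkLinearMap _ P)
  have : Module.Finite B (LocalizedModule p.primeCompl M) := by
    refine Module.Finite.of_surjective (c • LocalizedModule.map p.primeCompl r) ?_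
    exact fun x => ⟨_, LinearMap.congr_fun hsplit x⟩
  exact Module.free_of_flat_of_isLocalRing

end Localization

/-! ### Extending linear maps by self-duality -/

section Extension

variable {Λ : Type v} {R : Type u} [CommRing Λ] [CommRing R] [Algebra Λ R] [IsDomain Λ]
  [IsNoetherianRing Λ] [Module.Finite Λ R]

/-- Linear forms extend from `N` to `E` up to a denominator outside `p`, if `Λ_p` is a principal
ideal ring, `E/N` is torsion-free up to a denominator, and `R` is self-dual over `Λ`. -/
theorem exists_extend_dual_of_selfDual
    (hdual : ∃ f : R ≃ₗ[Λ] (R →ₗ[Λ] Λ), ∀ r x y : R, f (r * x) y = f x (r * y))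
    (p : Ideal Λ) [p.IsPrime] [IsPrincipalIdealRing (Localization.AtPrime p)]
    {E : Type*} [AddCommGroup E] [Module R E] [Module.Finite R E] (N : Submodule R E) {s₀ : R}
    (hN : ∀ e, (∃ a : Λ, a ≠ 0 ∧ algebraMap Λ R a • e ∈ N) → s₀ • e ∈ N) :
    ∃ s ∉ p, ∀ g : Module.Dual R N, ∃ g' : Module.Dual R E, ∀ x : N,
      g' x = algebraMap Λ R s * s₀ * g x := by
  obtain ⟨f, hf⟩ := hdual
  let _ : Module Λ E := Module.compHom E (algebraMap Λ R)
  have : IsScalarTower Λ R E := ⟨fun a r e => by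
    rw [Algebra.smul_def, mul_smul]; rfl⟩
  have hsmul : ∀ (a : Λ) (e : E), a • e = algebraMap Λ R a • e := fun _ _ => rfl
  -- The saturation of `N`: `E ⧸ N'` is torsion-free over `Λ`, hence free over the principal ideal
  -- domain `Λ_p`, and `s₀` maps `N'` into `N`.
  let N' : Submodule R E :=
    { carrier := {e | ∃ a : Λ, a ≠ 0 ∧ algebraMap Λ R a • e ∈ N}
      add_mem' := by
        rintro x y ⟨a, ha, hx⟩ ⟨b, hb, hy⟩
        refine ⟨a * b, mul_ne_zero ha hb, ?_⟩
        rw [smul_add, map_mul, mul_smul, mul_smul]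
        exact add_mem (by rw [smul_comm]; exact N.smul_mem _ hx) (N.smul_mem _ hy)
      zero_mem' := ⟨1, one_ne_zero, by simp⟩
      smul_mem' := by
        rintro r x ⟨a, ha, hx⟩
        exact ⟨a, ha, by rw [smul_comm]; exact N.smul_mem _ hx⟩ }
  have : Module.Finite Λ E := Module.Finite.trans R E
  have : Module.Finite Λ (E ⧸ N') := Module.Finite.trans R _
  have : Module.IsTorsionFree Λ (E ⧸ N') := by
    refine Module.IsTorsionFree.mk fun a ha x y hxy => ?_
    have ha' : a ≠ 0 := ha.ne_zero
    obtain ⟨x, rfl⟩ := N'.mkQ_surjective x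
    obtain ⟨y, rfl⟩ := N'.mkQ_surjective y
    simp only [← algebraMap_smul R a, ← map_smul] at hxy
    rw [← sub_eq_zero, ← map_sub, Submodule.mkQ_apply, Submodule.Quotient.mk_eq_zero] at hxy ⊢
    rw [← smul_sub] at hxy
    obtain ⟨b, hb, h⟩ := hxy
    exact ⟨b * a, mul_ne_zero hb ha', by rw [map_mul, mul_smul]; exact h⟩
  have : Module.FinitePresentation Λ (E ⧸ N') := Module.finitePresentation_of_finite Λ _
  obtain ⟨s, hs, n, v, q, -, hvq⟩ := exists_isScaledBasis (M := E ⧸ N') p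
  choose e he using fun i => N'.mkQ_surjective (v i)
  let π : E →ₗ[Λ] E ⧸ N' := N'.mkQ.restrictScalars Λ
  -- `s` times a `Λ`-linear projection of `E` onto `N'`, obtained by lifting a basis of `E ⧸ N'`.
  let ρ : E →ₗ[Λ] E := s • LinearMap.id - ∑ j, (q j ∘ₗ π).smulRight (e j)
  have hρ : ∀ x, ρ x = s • x - ∑ j, q j (π x) • e j := by
    intro x
    simp [ρ, LinearMap.sum_apply]
  have hρN : ∀ x, s₀ • ρ x ∈ N := by
    intro x
    refine hN _ ?_
    change ρ x ∈ N'
    rw [← Submodule.Quotient.mk_eq_zero, ← Submodule.mkQ_apply]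
    change π (ρ x) = 0
    rw [hρ, map_sub, map_smul, map_sum, sub_eq_zero, ← hvq.sum_smul]
    refine Finset.sum_congr rfl fun j _ => ?_
    rw [map_smul, ← he]
    rfl
  refine ⟨s, hs, fun g => ?_⟩
  let ρ' : E →ₗ[Λ] N := LinearMap.codRestrict (N.restrictScalars Λ)
    ((LinearMap.lsmul R E s₀).restrictScalars Λ ∘ₗ ρ) hρN
  -- `f 1` generates `Hom_Λ(R, Λ)` and plays the role of a trace. It turns `g` into a `Λ`-linear
  -- form, which extends along `ρ'`.
  let G : E →ₗ[Λ] Λ := f 1 ∘ₗ g.restrictScalars Λ ∘ₗ ρ'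
  have hG : ∀ x : N, G x = f 1 (algebraMap Λ R s * s₀ * g x) := by
    intro x
    have h1 : ρ' x = (algebraMap Λ R s * s₀) • x := by
      apply Subtype.ext
      change s₀ • ρ (x : E) = (algebraMap Λ R s * s₀) • (x : E)
      have : π (x : E) = 0 := by
        change N'.mkQ (x : E) = 0
        rw [Submodule.mkQ_apply, Submodule.Quotient.mk_eq_zero]
        exact ⟨1, one_ne_zero, by simp⟩
      rw [hρ, this]
      simp only [map_zero, zero_smul, Finset.sum_const_zero, sub_zero]
      rw [hsmul, mul_comm, mul_smul]
    change f 1 (g (ρ' x)) = _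
    rw [h1, map_smul, smul_eq_mul]
  have hf1 : ∀ a y, f a y = f 1 (a * y) := fun a y => by rw [← hf, mul_one]
  -- Back from `Hom_Λ(E, Λ)` to `Hom_R(E, R)`: the value at `x` is the element of `R` corresponding
  -- under `f` to `r ↦ G (r • x)`.
  let H : E → R →ₗ[Λ] Λ := fun x => G ∘ₗ (LinearMap.toSpanSingleton R E x).restrictScalars Λ
  have hH : ∀ x r, H x r = G (r • x) := fun _ _ => rfl
  refine ⟨⟨⟨fun x => f.symm (H x), fun x y => ?_⟩, fun r x => ?_⟩, fun x => ?_⟩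
  · rw [← map_add]
    congr 1
    ext r
    simp [hH]
  · apply f.injective
    ext y
    rw [LinearEquiv.apply_symm_apply, RingHom.id_apply, smul_eq_mul, hf,
      LinearEquiv.apply_symm_apply, hH, hH, smul_smul, mul_comm]
  · change f.symm (H x) = _
    apply f.injective
    ext y
    rw [LinearEquiv.apply_symm_apply, hH, hf1]
    have := hG (y • x)
    rw [Submodule.coe_smul] at this
    rw [this, map_smul, smul_eq_mul]
    congr 1
    ring

/-- `F` is a direct summand of some `R^n`, so each coordinate can be extended with the same
denominator. -/
theorem exists_extend_of_selfDual
    (hdual : ∃ f : R ≃ₗ[Λ] (R →ₗ[Λ] Λ), ∀ r x y : R, f (r * x) y = f x (r * y))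
    (p : Ideal Λ) [p.IsPrime] [IsPrincipalIdealRing (Localization.AtPrime p)]
    {E F : Type*} [AddCommGroup E] [Module R E] [Module.Finite R E] [AddCommGroup F] [Module R F]
    [Module.Finite R F] [Module.Projective R F] (N : Submodule R E) {s₀ : R}
    (hN : ∀ e, (∃ a : Λ, a ≠ 0 ∧ algebraMap Λ R a • e ∈ N) → s₀ • e ∈ N) (g : N →ₗ[R] F) :
    ∃ s ∉ p, ∃ g' : E →ₗ[R] F, ∀ x : N, g' x = (algebraMap Λ R s * s₀) • g x := by
  obtain ⟨s, hs, h⟩ := exists_extend_dual_of_selfDual hdual p N hN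
  obtain ⟨n, π, ι, -, -, hπ⟩ := Module.Finite.exists_comp_eq_id_of_projective R F
  choose g' hg' using fun j => h (LinearMap.proj j ∘ₗ ι ∘ₗ g)
  refine ⟨s, hs, π ∘ₗ LinearMap.pi g', fun x => ?_⟩
  have : LinearMap.pi g' (x : E) = (algebraMap Λ R s * s₀) • ι (g x) := by
    ext j
    exact hg' j x
  rw [LinearMap.comp_apply, this, map_smul, ← LinearMap.comp_apply, hπ, LinearMap.id_apply]

end Extension

/-! ### Splitting of the differentials -/

/-- The linear map `d` has, up to a denominator outside `Q`, a partial inverse. -/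
def LinearMap.SplitsAt {R X Y : Type*} [CommRing R] [AddCommGroup X] [Module R X] [AddCommGroup Y]
    [Module R Y] (d : X →ₗ[R] Y) (Q : Ideal R) : Prop :=
  ∃ s ∉ Q, ∃ h : Y →ₗ[R] X, ∀ x, d (h (d x)) = s • d x

section Splitting

variable {R X₀ X₁ X₂ : Type*} [CommRing R] [AddCommGroup X₀] [Module R X₀] [AddCommGroup X₁]
  [Module R X₁] [AddCommGroup X₂] [Module R X₂] {d₁ : X₀ →ₗ[R] X₁} {d₂ : X₁ →ₗ[R] X₂}
  {Q : Ideal R} [Q.IsPrime]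

/-- The complementary projection `s₁ - d₁ h₁`, scaled by `s₂`, kills the cocycles and so descends to
the image of `d₂`. By `htf` the cokernel of `d₂` is torsion-free up to a denominator, so the
descended map extends to `X₂`; this is the step that needs self-duality. -/
theorem LinearMap.SplitsAt.of_left {Λ : Type*} [CommRing Λ] [Algebra Λ R] [IsDomain Λ]
    [IsNoetherianRing Λ] [Module.Finite Λ R]
    (hdual : ∃ f : R ≃ₗ[Λ] (R →ₗ[Λ] Λ), ∀ r x y : R, f (r * x) y = f x (r * y))
    [IsPrincipalIdealRing (Localization.AtPrime (Q.under Λ))]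
    [Module.Finite R X₁] [Module.Projective R X₁] [Module.Finite R X₂]
    (hsplit : d₁.SplitsAt Q) (hdd : ∀ x, d₂ (d₁ x) = 0)
    (hex : ∃ s ∉ Q, ∀ x, d₂ x = 0 → ∃ y, s • x = d₁ y)
    (htf : ∃ s ∉ Q, ∀ x, (∃ a : Λ, a ≠ 0 ∧ ∃ y, algebraMap Λ R a • x = d₂ y) →
      ∃ y, s • x = d₂ y) : d₂.SplitsAt Q := by
  obtain ⟨s₁, hs₁, h₁, hh₁⟩ := hsplit
  obtain ⟨s₂, hs₂, hex⟩ := hex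
  obtain ⟨s₃, hs₃, htf⟩ := htf
  let u : X₁ →ₗ[R] X₁ := s₂ • (s₁ • LinearMap.id - d₁ ∘ₗ h₁)
  have hd : ∀ x, d₂ x = 0 → u x = 0 := by
    intro x hx
    obtain ⟨y, hy⟩ := hex x hx
    change s₂ • (s₁ • x - d₁ (h₁ x)) = 0
    rw [smul_sub, smul_comm, ← map_smul d₁ s₂, ← map_smul h₁, hy, hh₁, sub_self]
  let e := d₂.quotKerEquivRange
  let g : LinearMap.range d₂ →ₗ[R] X₁ := (LinearMap.ker d₂).liftQ u hd ∘ₗ e.symm.toLinearMap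
  have hg : ∀ x, g ⟨d₂ x, x, rfl⟩ = s₂ • (s₁ • x - d₁ (h₁ x)) := by
    intro x
    have : e.symm ⟨d₂ x, x, rfl⟩ = (LinearMap.ker d₂).mkQ x := by
      rw [LinearEquiv.symm_apply_eq]; rfl
    change (LinearMap.ker d₂).liftQ u hd (e.symm ⟨d₂ x, x, rfl⟩) = _
    rw [this]; rfl
  obtain ⟨s, hs, g', hg'⟩ := exists_extend_of_selfDual hdual (Q.under Λ) (LinearMap.range d₂) (s₀ := s₃) (by
    rintro x ⟨a, ha, y, hy⟩
    obtain ⟨y', hy'⟩ := htf x ⟨a, ha, y, hy.symm⟩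
    exact ⟨y', hy'.symm⟩) g
  refine ⟨algebraMap Λ R s * s₃ * (s₂ * s₁), ?_, g', fun x => ?_⟩
  · exact Q.primeCompl.mul_mem (Q.primeCompl.mul_mem hs hs₃) (Q.primeCompl.mul_mem hs₂ hs₁)
  · rw [hg' ⟨d₂ x, x, rfl⟩, hg, map_smul, map_smul, map_sub, hdd, sub_zero, map_smul]
    simp only [mul_smul]

/-- The splitting of `d₂` gives a projection of `X₁` onto the cocycles, whose values are
coboundaries up to `s₂`; projectivity of `X₁` lifts it through `d₁`. -/
theorem LinearMap.SplitsAt.of_right [Module.Projective R X₁]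
    (hsplit : d₂.SplitsAt Q) (hex : ∃ s ∉ Q, ∀ x, d₂ x = 0 → ∃ y, s • x = d₁ y)
    (hdd : ∀ x, d₂ (d₁ x) = 0) : d₁.SplitsAt Q := by
  obtain ⟨s₁, hs₁, h₁, hh₁⟩ := hsplit
  obtain ⟨s₂, hs₂, hex⟩ := hex
  let u : X₁ →ₗ[R] X₁ := s₂ • (s₁ • LinearMap.id - h₁ ∘ₗ d₂)
  have hu : ∀ x, u x = s₂ • (s₁ • x - h₁ (d₂ x)) := fun _ => rfl
  obtain ⟨h, hh⟩ := Module.projective_lifting_property d₁.rangeRestrict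
    (u.codRestrict (LinearMap.range d₁) (by
      intro x
      obtain ⟨y, hy⟩ := hex (s₁ • x - h₁ (d₂ x)) (by rw [map_sub, map_smul, hh₁, sub_self])
      exact ⟨y, hy.symm⟩)) d₁.surjective_rangeRestrict
  refine ⟨s₂ * s₁, Q.primeCompl.mul_mem hs₂ hs₁, h, fun x => ?_⟩
  have : d₁ (h (d₁ x)) = u (d₁ x) := congrArg Subtype.val (LinearMap.congr_fun hh (d₁ x))
  rw [this, hu, hdd, map_zero, sub_zero, mul_smul]

end Splitting

theorem smul_cancel_of_ne_zero {Λ : Type*} [CommRing Λ] [IsRegularLocalRing Λ] {R : Type*} [CommRing R]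
    [Algebra Λ R] [Module.Free Λ R] {M : Type*} [AddCommGroup M] [Module R M] [Module.Finite R M]
    [Module.Projective R M] {a : Λ} (ha : a ≠ 0) {x : M} (h : algebraMap Λ R a • x = 0) : x = 0 := by
  obtain ⟨n, π, ι, -, -, hπ⟩ := Module.Finite.exists_comp_eq_id_of_projective R M
  have h1 : ι x = 0 := by
    ext j
    have := congrFun (congrArg ι h) j
    rw [map_smul, map_zero, Pi.smul_apply, smul_eq_mul, mul_comm] at this
    exact (mul_right_mem_nonZeroDivisors_eq_zero_iff (algebraMap_mem_nonZeroDivisors ha)).1 this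
  rw [← LinearMap.id_apply (R := R) x, ← hπ, LinearMap.comp_apply, h1, map_zero]

/-! ### Cocycles, coboundaries and cohomology in terms of elements -/

section Complex

variable {R : Type u} [CommRing R] (P : CochainComplex (ModuleCat.{u} R) ℤ)

theorem exists_iCycles_eq {i j : ℤ} (hij : i + 1 = j) (x : P.X i) (hx : (P.d i j).hom x = 0) :
    ∃ z : P.cycles i, (P.iCycles i).hom z = x :=
  (ShortComplex.moduleCat_exact_iff _).1 (ShortComplex.exact_of_f_is_kernel
    (ShortComplex.mk (P.iCycles i) (P.d i j) (P.iCycles_d i j))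
    (P.cyclesIsKernel i j (by simp [← hij]))) x hx

theorem exists_toCycles_eq {i j : ℤ} (hij : i + 1 = j) (z : P.cycles j)
    (hz : (P.homologyπ j).hom z = 0) : ∃ x : P.X i, (P.toCycles i j).hom x = z :=
  (ShortComplex.moduleCat_exact_iff _).1 (ShortComplex.exact_of_g_is_cokernel
    (ShortComplex.mk (P.toCycles i j) (P.homologyπ j) (P.toCycles_comp_homologyπ i j))
    (P.homologyIsCokernel i j (by simp [← hij]))) z hz

theorem iCycles_toCycles (i j : ℤ) (x : P.X i) :
    (P.iCycles j).hom ((P.toCycles i j).hom x) = (P.d i j).hom x := by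
  rw [← P.toCycles_i i j]; rfl

theorem iCycles_injective (i : ℤ) : Function.Injective (P.iCycles i).hom :=
  (ModuleCat.mono_iff_injective _).1 inferInstance

theorem d_iCycles (i j : ℤ) (z : P.cycles i) : (P.d i j).hom ((P.iCycles i).hom z) = 0 :=
  LinearMap.congr_fun (congrArg ModuleCat.Hom.hom (P.iCycles_d i j)) z

theorem d_d_apply (i j k : ℤ) (x : P.X i) : (P.d j k).hom ((P.d i j).hom x) = 0 :=
  LinearMap.congr_fun (congrArg ModuleCat.Hom.hom (P.d_comp_d i j k)) x

end Complex

namespace PerfectPresentation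

variable {R : Type u} [CommRing R] [HasDerivedCategory.{w} (ModuleCat.{u} R)]
  {C : DerivedCategory (ModuleCat.{u} R)} (D : PerfectPresentation C)

instance (i : ℤ) : Module.Finite R (D.P.X i) := D.finite i

instance (i : ℤ) : Module.Projective R (D.P.X i) := D.projective i

/-- The isomorphism between the homology of the complex `P` and the cohomology of `C`. -/
def homologyEquiv (i : ℤ) : D.P.homology i ≃ₗ[R] cohomology C i :=
  ((DerivedCategory.homologyFunctorFactors (ModuleCat.{u} R) i).symm.app D.P ≪≫
    (DerivedCategory.homologyFunctor (ModuleCat.{u} R) i).mapIso D.iso).toLinearEquiv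

theorem cocycleClass_apply (z : D.P.cycles 1) :
    D.cocycleClass z = D.homologyEquiv 1 ((D.P.homologyπ 1).hom z) := rfl

theorem homologyπ_surjective (i : ℤ) : Function.Surjective (D.P.homologyπ i).hom :=
  (ModuleCat.epi_iff_surjective _).1 inferInstance

theorem cocycleClass_surjective : Function.Surjective D.cocycleClass := by
  intro h
  obtain ⟨z, hz⟩ := D.homologyπ_surjective 1 ((D.homologyEquiv 1).symm h)
  exact ⟨z, by rw [cocycleClass_apply, hz, LinearEquiv.apply_symm_apply]⟩

theorem exists_d_eq_of_cocycleClass_eq_zero (z : D.P.cycles 1) (hz : D.cocycleClass z = 0) :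
    ∃ x : D.P.X 0, (D.P.d 0 1).hom x = (D.P.iCycles 1).hom z := by
  rw [cocycleClass_apply, LinearEquiv.map_eq_zero_iff] at hz
  obtain ⟨x, hx⟩ := exists_toCycles_eq D.P (zero_add 1) z hz
  exact ⟨x, by rw [← hx, iCycles_toCycles]⟩

theorem cocycleClass_eq_zero (z : D.P.cycles 1) (x : D.P.X 0)
    (hx : (D.P.d 0 1).hom x = (D.P.iCycles 1).hom z) : D.cocycleClass z = 0 := by
  have : z = (D.P.toCycles 0 1).hom x :=
    iCycles_injective D.P 1 (by rw [iCycles_toCycles, hx])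
  rw [cocycleClass_apply, this, LinearEquiv.map_eq_zero_iff]
  exact LinearMap.congr_fun (congrArg ModuleCat.Hom.hom (D.P.toCycles_comp_homologyπ 0 1)) x

instance [IsNoetherianRing R] (i : ℤ) : Module.Finite R (D.P.cycles i) :=
  Module.Finite.of_injective _ (iCycles_injective D.P i)

instance [IsNoetherianRing R] (i : ℤ) : Module.Finite R (D.P.homology i) :=
  Module.Finite.of_surjective _ (D.homologyπ_surjective i)

theorem finite_cohomology (D : PerfectPresentation C) [IsNoetherianRing R] (i : ℤ) : Module.Finite R (cohomology C i) :=
  Module.Finite.equiv (D.homologyEquiv i)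

theorem subsingleton_of_lt {i : ℤ} (hi : i < D.a) : Subsingleton (D.P.X i) :=
  have := D.isStrictlyGE
  ModuleCat.subsingleton_of_isZero (D.P.isZero_of_isStrictlyGE D.a i hi)

theorem subsingleton_of_gt {i : ℤ} (hi : D.b < i) : Subsingleton (D.P.X i) :=
  have := D.isStrictlyLE
  ModuleCat.subsingleton_of_isZero (D.P.isZero_of_isStrictlyLE D.b i hi)

section Splitting

variable {Λ : Type v} [CommRing Λ] [IsRegularLocalRing Λ] [Algebra Λ R]
  [Module.Finite Λ R]

/-- Exactness at `i ≠ 1`, up to a denominator. -/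
theorem exists_smul_eq_d (hpn : ∀ i : ℤ, i ≠ 1 → IsPseudoNull R (cohomology C i))
    {Q : PrimeSpectrum R} (hQ : Q ∈ pirLocus Λ R) {i j k : ℤ} (hij : i + 1 = j) (hjk : j + 1 = k)
    (hj : j ≠ 1) :
    ∃ s ∉ Q.asIdeal, ∀ x : D.P.X j, (D.P.d j k).hom x = 0 → ∃ y, s • x = (D.P.d i j).hom y := by
  have : IsNoetherianRing R := IsNoetherianRing.of_finite Λ R
  have : IsPrincipalIdealRing (Localization.AtPrime (Q.asIdeal.under Λ)) := hQ
  have := D.finite_cohomology j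
  obtain ⟨s, hs, h⟩ := (hpn j hj).exists_smul_eq_zero (Q.asIdeal.under Λ)
  refine ⟨algebraMap Λ R s, hs, fun x hx => ?_⟩
  obtain ⟨z, rfl⟩ := exists_iCycles_eq D.P hjk x hx
  obtain ⟨y, hy⟩ := exists_toCycles_eq D.P hij (algebraMap Λ R s • z) (by
    apply (D.homologyEquiv j).injective
    rw [map_smul, map_smul, h, map_zero])
  exact ⟨y, by rw [← iCycles_toCycles, hy, map_smul]⟩

variable [Module.Free Λ R]

theorem exists_smul_cocycleClass_eq_zero (D : PerfectPresentation C)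
    (htor : IsPseudoNull R (Submodule.torsion R (cohomology C 1)))
    {Q : PrimeSpectrum R} (hQ : Q ∈ pirLocus Λ R) :
    ∃ s ∉ Q.asIdeal, ∀ x : cohomology C 1, (∃ a : Λ, a ≠ 0 ∧ algebraMap Λ R a • x = 0) →
      s • x = 0 := by
  have : IsNoetherianRing R := IsNoetherianRing.of_finite Λ R
  have : IsPrincipalIdealRing (Localization.AtPrime (Q.asIdeal.under Λ)) := hQ
  have := D.finite_cohomology 1
  obtain ⟨s, hs, h⟩ := htor.exists_smul_eq_zero (Q.asIdeal.under Λ)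
  refine ⟨algebraMap Λ R s, hs, fun x ⟨a, ha, hx⟩ => ?_⟩
  exact congrArg Subtype.val (h ⟨x, (Submodule.mem_torsion_iff x).2
    ⟨⟨algebraMap Λ R a, algebraMap_mem_nonZeroDivisors ha⟩, hx⟩⟩)

/-- Two inductions: upward from `a - 1` for the differentials starting in degree at most `0`, by
`of_left`, and downward from `b` for the others, by `of_right`. Exactness in degree one is never
used. -/
theorem splitsAt (hdual : ∃ f : R ≃ₗ[Λ] (R →ₗ[Λ] Λ), ∀ r x y : R, f (r * x) y = f x (r * y))
    (hpn : ∀ i : ℤ, i ≠ 1 → IsPseudoNull R (cohomology C i))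
    (htor : IsPseudoNull R (Submodule.torsion R (cohomology C 1)))
    {Q : PrimeSpectrum R} (hQ : Q ∈ pirLocus Λ R) {i j : ℤ} (hij : i + 1 = j) :
    (D.P.d i j).hom.SplitsAt Q.asIdeal := by
  have : IsPrincipalIdealRing (Localization.AtPrime (Q.asIdeal.under Λ)) := hQ
  have hone : (1 : R) ∉ Q.asIdeal := Q.asIdeal.primeCompl.one_mem
  subst hij
  rcases lt_or_ge i (D.a - 1) with hlt | hge
  · have := D.subsingleton_of_lt (show i < D.a by omega)
    exact ⟨1, hone, 0, fun x => by rw [Subsingleton.elim x 0]; simp⟩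
  rcases le_or_gt i 0 with hi | hi
  · induction i, hge using Int.leInduction with
    | base =>
      have := D.subsingleton_of_lt (show D.a - 1 < D.a by omega)
      exact ⟨1, hone, 0, fun x => by rw [Subsingleton.elim x 0]; simp⟩
    | succ i hi' ih =>
      refine (ih (by omega)).of_left hdual (d_d_apply D.P _ _ _)
        (D.exists_smul_eq_d hpn hQ rfl rfl (by omega)) ?_
      -- Torsion modulo coboundaries consists of cocycles, because the next term of the complex is
      -- torsion-free over `Λ`. Its classes are therefore torsion in cohomology.
      have hd : ∀ x, (∃ a : Λ, a ≠ 0 ∧ ∃ y, algebraMap Λ R a • x =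
          (D.P.d (i + 1) (i + 1 + 1)).hom y) →
          (D.P.d (i + 1 + 1) (i + 1 + 1 + 1)).hom x = 0 := by
        rintro x ⟨a, ha, y, hy⟩
        refine smul_cancel_of_ne_zero (R := R) ha ?_
        rw [← map_smul, hy, d_d_apply]
      -- The target has degree one: here the pseudo-nullity of the torsion of `H^1` replaces that of
      -- the whole cohomology module.
      by_cases h1 : i + 1 + 1 = 1
      · obtain rfl : i = -1 := by omega
        obtain ⟨s, hs, h⟩ := exists_smul_cocycleClass_eq_zero D (Λ := Λ) htor hQ
        refine ⟨s, hs, fun x hx => ?_⟩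
        obtain ⟨z, rfl⟩ := exists_iCycles_eq D.P rfl x (hd x hx)
        obtain ⟨a, ha, y, hy⟩ := hx
        obtain ⟨y', hy'⟩ := D.exists_d_eq_of_cocycleClass_eq_zero (s • z) (by
          rw [map_smul]
          refine h _ ⟨a, ha, ?_⟩
          rw [← map_smul]
          exact D.cocycleClass_eq_zero _ y (by rw [map_smul]; exact hy.symm))
        exact ⟨y', by rw [← map_smul]; exact hy'.symm⟩
      · obtain ⟨s, hs, h⟩ := D.exists_smul_eq_d hpn hQ rfl rfl h1
        exact ⟨s, hs, fun x hx => h x (hd x hx)⟩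
  · rcases lt_or_ge D.b i with hlt | hle
    · have := D.subsingleton_of_gt (show D.b < i + 1 by omega)
      exact ⟨1, hone, 0, fun x => Subsingleton.elim _ _⟩
    induction i, hle using Int.leInductionDown with
    | base =>
      have := D.subsingleton_of_gt (show D.b < D.b + 1 by omega)
      exact ⟨1, hone, 0, fun x => Subsingleton.elim _ _⟩
    | pred i hi' ih =>
      obtain ⟨k, rfl⟩ : ∃ k, i = k + 1 := ⟨i - 1, by omega⟩
      rw [add_sub_cancel_right]
      exact (ih (by omega) (by omega)).of_right (D.exists_smul_eq_d hpn hQ rfl rfl (by omega))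
        (d_d_apply D.P _ _ _)

end Splitting

end PerfectPresentation

/-! ### Local splittings of the complex -/

namespace PerfectPresentation

variable {R : Type u} [CommRing R] [HasDerivedCategory.{w} (ModuleCat.{u} R)]
  {C : DerivedCategory (ModuleCat.{u} R)} (D : PerfectPresentation C)

/-- A splitting, up to the denominator `s`, of the complex in degree `i`: the vectors `b k` map to
a basis of the coboundaries in degree `i + 1`, with dual basis induced by the `q k`. -/
structure IsDegreeSplitting (i : ℤ) (s : R) {m : ℕ} (b : Fin m → D.P.X i)
    (q : Fin m → Module.Dual R (D.P.X i)) : Prop where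
  eq_zero : i < D.a ∨ D.b ≤ i → m = 0
  sum_smul : ∀ x, ∑ k, q k x • (D.P.d i (i + 1)).hom (b k) = s • (D.P.d i (i + 1)).hom x
  apply_eq : ∀ k l, q k (b l) = if k = l then s else 0
  apply_eq_zero : ∀ k x, (D.P.d i (i + 1)).hom x = 0 → q k x = 0
  exact : i ≠ 1 → ∀ x, (D.P.d i (i + 1)).hom x = 0 → ∃ y, s • x = (D.P.d (i - 1) i).hom y

variable {D} in
theorem IsDegreeSplitting.smul {i : ℤ} {s : R} {m : ℕ} {b : Fin m → D.P.X i}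
    {q : Fin m → Module.Dual R (D.P.X i)} (h : D.IsDegreeSplitting i s b q) (c : R) :
    D.IsDegreeSplitting i (c * s) b (c • q) where
  eq_zero := h.eq_zero
  sum_smul x := by
    simp only [Pi.smul_apply, LinearMap.smul_apply, smul_eq_mul, mul_smul, ← h.sum_smul,
      Finset.smul_sum]
  apply_eq k l := by
    simp only [Pi.smul_apply, LinearMap.smul_apply, smul_eq_mul, h.apply_eq]
    split_ifs <;> simp
  apply_eq_zero k x hx := by
    simp only [Pi.smul_apply, LinearMap.smul_apply, smul_eq_mul, h.apply_eq_zero k x hx, mul_zero]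
  exact hi x hx := by
    obtain ⟨y, hy⟩ := h.exact hi x hx
    exact ⟨c • y, by rw [mul_smul, hy, map_smul]⟩

theorem isDegreeSplitting_of_not_mem {i : ℤ} (hi : i ∉ Finset.Icc D.a D.b) (s : R) :
    D.IsDegreeSplitting i s (m := 0) Fin.elim0 Fin.elim0 := by
  have : Subsingleton (D.P.X i) := by
    rw [Finset.mem_Icc, not_and_or, not_le, not_le] at hi
    exact hi.elim D.subsingleton_of_lt D.subsingleton_of_gt
  exact ⟨fun _ => rfl, fun x => by rw [Subsingleton.elim x 0]; simp, fun k => k.elim0,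
    fun k => k.elim0, fun _ x _ => ⟨0, Subsingleton.elim _ _⟩⟩

variable {Λ : Type v} [CommRing Λ] [IsRegularLocalRing Λ] [Algebra Λ R] [Module.Free Λ R]
  [Module.Finite Λ R]

/-- The splitting makes the coboundaries in degree `i + 1` a retract of `P^(i+1)` up to a
denominator, hence free at `Q`; the `b k` lift a basis of them. -/
theorem exists_isDegreeSplitting
    (hdual : ∃ f : R ≃ₗ[Λ] (R →ₗ[Λ] Λ), ∀ r x y : R, f (r * x) y = f x (r * y))
    (hpn : ∀ i : ℤ, i ≠ 1 → IsPseudoNull R (cohomology C i))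
    (htor : IsPseudoNull R (Submodule.torsion R (cohomology C 1)))
    {Q : PrimeSpectrum R} (hQ : Q ∈ pirLocus Λ R) (i : ℤ) :
    ∃ s ∉ Q.asIdeal, ∃ (m : ℕ) (b : Fin m → D.P.X i) (q : Fin m → Module.Dual R (D.P.X i)),
      D.IsDegreeSplitting i s b q := by
  have : IsNoetherianRing R := IsNoetherianRing.of_finite Λ R
  have hex : ∃ s ∉ Q.asIdeal, i ≠ 1 → ∀ x, (D.P.d i (i + 1)).hom x = 0 →
      ∃ y, s • x = (D.P.d (i - 1) i).hom y := by
    by_cases hi : i = 1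
    · exact ⟨1, Q.asIdeal.primeCompl.one_mem, fun h => (h hi).elim⟩
    · obtain ⟨s, hs, h⟩ := D.exists_smul_eq_d hpn hQ (sub_add_cancel i 1) rfl hi
      exact ⟨s, hs, fun _ => h⟩
  obtain ⟨s₁, hs₁, hex⟩ := hex
  -- Here the differential vanishes. The empty basis is chosen explicitly so that `eq_zero` holds
  -- even if `R` degenerates to zero on some piece.
  by_cases hz : i < D.a ∨ D.b ≤ i
  · refine ⟨s₁, hs₁, 0, Fin.elim0, Fin.elim0, fun _ => rfl, fun x => ?_, fun k => k.elim0,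
      fun k => k.elim0, hex⟩
    have h0 : (D.P.d i (i + 1)).hom x = 0 := by
      rcases hz with hz | hz
      · have := D.subsingleton_of_lt hz
        rw [Subsingleton.elim x 0, map_zero]
      · have := D.subsingleton_of_gt (show D.b < i + 1 by omega)
        exact Subsingleton.elim _ _
    rw [h0]; simp
  · let d := (D.P.d i (i + 1)).hom
    obtain ⟨s, hs, h, hh⟩ := D.splitsAt hdual hpn htor hQ (rfl : i + 1 = i + 1)
    have : Module.Free (Localization.AtPrime Q.asIdeal)
        (LocalizedModule Q.asIdeal.primeCompl (LinearMap.range d)) := by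
      refine free_localizedModule_of_retract Q.asIdeal (h ∘ₗ (LinearMap.range d).subtype)
        d.rangeRestrict hs ?_
      rintro ⟨_, x, rfl⟩
      exact Subtype.ext (hh x)
    have : Module.FinitePresentation R (LinearMap.range d) :=
      Module.finitePresentation_of_finite R _
    obtain ⟨s₂, hs₂, n, v, q, -, hv⟩ := exists_isScaledBasis (M := LinearMap.range d) Q.asIdeal
    choose b hb using fun k => d.surjective_rangeRestrict (v k)
    refine ⟨s₁ * s₂, Q.asIdeal.primeCompl.mul_mem hs₁ hs₂, n, b,
      fun k => s₁ • (q k ∘ₗ d.rangeRestrict), fun h => (hz h).elim, fun x => ?_, fun k l => ?_,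
      fun k x hx => ?_, fun hi x hx => ?_⟩
    · have := congrArg Subtype.val (hv.sum_smul (d.rangeRestrict x))
      rw [mul_smul]
      have h2 : s₂ • (D.P.d i (i + 1)).hom x = ∑ k, q k (d.rangeRestrict x) • d (b k) := by
        refine this.symm.trans ?_
        rw [Submodule.coe_sum]
        refine Finset.sum_congr rfl fun k _ => ?_
        rw [← hb]; rfl
      rw [h2, Finset.smul_sum]
      refine Finset.sum_congr rfl fun k _ => ?_
      rw [smul_smul]; rfl
    · simp only [LinearMap.smul_apply, LinearMap.comp_apply, hb, hv.apply_eq, smul_eq_mul]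
      split_ifs <;> simp
    · have : d.rangeRestrict x = 0 := Subtype.ext hx
      simp only [LinearMap.smul_apply, LinearMap.comp_apply, this, map_zero, smul_zero]
    · obtain ⟨y, hy⟩ := hex hi x hx
      exact ⟨s₂ • y, by rw [mul_comm, mul_smul, hy, map_smul]⟩

/-- `H^1` is a retract of `P^1` at `Q`. The splitting of the incoming differential embeds it by `j`,
since `s₀ - d h₀` kills coboundaries; the splitting of the outgoing one projects `P^1` onto the
cocycles by `ρ`. -/
theorem exists_isScaledBasis_cohomology
    (hdual : ∃ f : R ≃ₗ[Λ] (R →ₗ[Λ] Λ), ∀ r x y : R, f (r * x) y = f x (r * y))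
    (hpn : ∀ i : ℤ, i ≠ 1 → IsPseudoNull R (cohomology C i))
    (htor : IsPseudoNull R (Submodule.torsion R (cohomology C 1)))
    {Q : PrimeSpectrum R} (hQ : Q ∈ pirLocus Λ R) :
    ∃ s ∉ Q.asIdeal, ∃ (n : ℕ) (z : Fin n → D.P.cycles 1)
      (q : Fin n → Module.Dual R (cohomology C 1)),
      IsScaledBasis s (fun k => D.cocycleClass (z k)) q := by
  have : IsNoetherianRing R := IsNoetherianRing.of_finite Λ R
  have := D.finite_cohomology 1
  obtain ⟨s₀, hs₀, h₀, hh₀⟩ := D.splitsAt hdual hpn htor hQ (zero_add (1 : ℤ))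
  obtain ⟨s₁, hs₁, h₁, hh₁⟩ := D.splitsAt hdual hpn htor hQ (rfl : (1 : ℤ) + 1 = 1 + 1)
  let ι := (D.P.iCycles 1).hom
  let π := D.cocycleClass
  let j' : D.P.cycles 1 →ₗ[R] D.P.X 1 := (s₀ • LinearMap.id - (D.P.d 0 1).hom ∘ₗ h₀) ∘ₗ ι
  have hj' : ∀ z, j' z = s₀ • ι z - (D.P.d 0 1).hom (h₀ (ι z)) := fun _ => rfl
  have hker : LinearMap.ker π ≤ LinearMap.ker j' := by
    intro z hz
    obtain ⟨x, hx⟩ := D.exists_d_eq_of_cocycleClass_eq_zero z hz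
    rw [LinearMap.mem_ker, hj']
    change s₀ • (D.P.iCycles 1).hom z - (D.P.d 0 1).hom (h₀ ((D.P.iCycles 1).hom z)) = 0
    rw [← hx, hh₀, sub_self]
  let j : cohomology C 1 →ₗ[R] D.P.X 1 := (LinearMap.ker π).liftQ j' hker ∘ₗ
    (π.quotKerEquivOfSurjective D.cocycleClass_surjective).symm.toLinearMap
  have hj : ∀ z, j (π z) = j' z := by
    intro z
    have : (π.quotKerEquivOfSurjective D.cocycleClass_surjective).symm (π z) =
        (LinearMap.ker π).mkQ z := by
      rw [LinearEquiv.symm_apply_eq]; rfl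
    change (LinearMap.ker π).liftQ j' hker
      ((π.quotKerEquivOfSurjective D.cocycleClass_surjective).symm (π z)) = _
    rw [this]; rfl
  let ρ' : D.P.X 1 →ₗ[R] D.P.X 1 := s₁ • LinearMap.id - h₁ ∘ₗ (D.P.d 1 (1 + 1)).hom
  have hρ' : ∀ x, ρ' x = s₁ • x - h₁ ((D.P.d 1 (1 + 1)).hom x) := fun _ => rfl
  let ρ : D.P.X 1 →ₗ[R] D.P.cycles 1 :=
    (D.P.liftCycles (ModuleCat.ofHom ρ') (1 + 1) (by simp) (by
      ext x
      change (D.P.d 1 (1 + 1)).hom (ρ' x) = 0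
      rw [hρ', map_sub, map_smul, hh₁, sub_self])).hom
  have hρ : ∀ x, ι (ρ x) = ρ' x := fun x =>
    LinearMap.congr_fun (congrArg ModuleCat.Hom.hom
      (D.P.liftCycles_i (ModuleCat.ofHom ρ') (1 + 1) _ _)) x
  have hs : s₀ * s₁ ∉ Q.asIdeal := Q.asIdeal.primeCompl.mul_mem hs₀ hs₁
  have : Module.Free (Localization.AtPrime Q.asIdeal)
      (LocalizedModule Q.asIdeal.primeCompl (cohomology C 1)) := by
    refine free_localizedModule_of_retract Q.asIdeal j (π ∘ₗ ρ) hs ?_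
    intro x
    obtain ⟨z, rfl⟩ := D.cocycleClass_surjective x
    rw [LinearMap.comp_apply]
    change π (ρ (j (π z))) = (s₀ * s₁) • π z
    have h1 : ρ (j (π z)) = (s₀ * s₁) • z - s₁ • (D.P.toCycles 0 1).hom (h₀ (ι z)) := by
      apply iCycles_injective D.P 1
      change ι _ = ι _
      rw [hj, hρ, hρ', map_sub, map_smul, map_smul]
      have h2 : (D.P.d 1 (1 + 1)).hom (j' z) = 0 := by
        rw [hj', map_sub, map_smul, d_d_apply]
        change s₀ • (D.P.d 1 (1 + 1)).hom ((D.P.iCycles 1).hom z) - 0 = 0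
        rw [d_iCycles, smul_zero, sub_zero]
      rw [h2, map_zero, sub_zero, hj', smul_sub, mul_comm, mul_smul]
      congr 2
      exact (iCycles_toCycles D.P 0 1 _).symm
    rw [h1, map_sub, map_smul, map_smul]
    have h3 : π ((D.P.toCycles 0 1).hom (h₀ (ι z))) = 0 :=
      D.cocycleClass_eq_zero _ _ (iCycles_toCycles D.P 0 1 _).symm
    rw [h3, smul_zero, sub_zero]
  have : Module.FinitePresentation R (cohomology C 1) := Module.finitePresentation_of_finite R _
  obtain ⟨s, hs, n, v, q, -, hv⟩ := exists_isScaledBasis (M := cohomology C 1) Q.asIdeal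
  choose z hz using fun k => D.cocycleClass_surjective (v k)
  exact ⟨s, hs, n, z, q, by simpa only [hz] using hv⟩

/-- A splitting of the complex up to a denominator `s` outside `Q`. -/
structure LocalSplitting (Q : PrimeSpectrum R) where
  /-- the denominator -/
  s : R
  s_not_mem : s ∉ Q.asIdeal
  /-- the rank of the coboundaries -/
  m : ℤ → ℕ
  /-- lifts of bases of the coboundaries -/
  b : ∀ i, Fin (m i) → D.P.X i
  /-- the dual bases -/
  q : ∀ i, Fin (m i) → Module.Dual R (D.P.X i)
  isDegreeSplitting : ∀ i, D.IsDegreeSplitting i s (b i) (q i)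
  /-- the rank of the cohomology -/
  n : ℕ
  /-- cocycles that form a basis of the cohomology -/
  z : Fin n → D.P.cycles 1
  /-- the dual basis -/
  qz : Fin n → Module.Dual R (cohomology C 1)
  isScaledBasis : IsScaledBasis s (fun k => D.cocycleClass (z k)) qz

theorem nonempty_localSplitting
    (hdual : ∃ f : R ≃ₗ[Λ] (R →ₗ[Λ] Λ), ∀ r x y : R, f (r * x) y = f x (r * y))
    (hpn : ∀ i : ℤ, i ≠ 1 → IsPseudoNull R (cohomology C i))
    (htor : IsPseudoNull R (Submodule.torsion R (cohomology C 1)))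
    {Q : PrimeSpectrum R} (hQ : Q ∈ pirLocus Λ R) : Nonempty (D.LocalSplitting Q) := by
  choose s hs h using D.exists_isDegreeSplitting hdual hpn htor hQ
  obtain ⟨t, ht, n, z, qz, hz⟩ := D.exists_isScaledBasis_cohomology hdual hpn htor hQ
  -- One denominator for all degrees: only the finitely many degrees in `[a, b]` contribute, and
  -- elsewhere the module is zero and any denominator will do.
  have key : ∀ i, ∃ (m : ℕ) (b : Fin m → D.P.X i) (q : Fin m → Module.Dual R (D.P.X i)),
      D.IsDegreeSplitting i (t * ∏ j ∈ Finset.Icc D.a D.b, s j) b q := by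
    intro i
    by_cases hi : i ∈ Finset.Icc D.a D.b
    · obtain ⟨m, b, q, hbq⟩ := h i
      rw [← Finset.mul_prod_erase _ s hi, mul_left_comm, mul_comm]
      exact ⟨m, b, _, hbq.smul _⟩
    · exact ⟨0, _, _, D.isDegreeSplitting_of_not_mem hi _⟩
  choose m b q hbq using key
  have hprod : ∏ j ∈ Finset.Icc D.a D.b, s j ∉ Q.asIdeal :=
    Q.asIdeal.primeCompl.prod_mem fun j _ => hs j
  exact ⟨⟨_, Q.asIdeal.primeCompl.mul_mem ht hprod, m, b, q, hbq, n, z, _, by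
    rw [mul_comm]; exact hz.smul _⟩⟩

end PerfectPresentation

/-! ### Ranks of the coboundaries -/

/-- The recursion determines the values upward from `a` for `i ≤ 0` and downward from `b` for `i ≥
1`; the relation at `i = 1` is not needed. -/
theorem eq_of_sub_one_add_eq {a b : ℤ} {σ τ : ℤ → ℤ}
    (hσ : ∀ i, i < a ∨ b ≤ i → σ i = 0) (hτ : ∀ i, i < a ∨ b ≤ i → τ i = 0)
    (h : ∀ i, i ≠ 1 → σ (i - 1) + σ i = τ (i - 1) + τ i) : σ = τ := by
  ext i
  rcases lt_or_ge i a with hlt | hge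
  · rw [hσ i (.inl hlt), hτ i (.inl hlt)]
  rcases le_or_gt b i with hle | hgt
  · rw [hσ i (.inr hle), hτ i (.inr hle)]
  rcases le_or_gt i 0 with hi | hi
  · induction i, (show a - 1 ≤ i by omega) using Int.leInduction with
    | base => rw [hσ _ (.inl (by omega)), hτ _ (.inl (by omega))]
    | succ i hi' ih =>
      have h1 := h (i + 1) (by omega)
      rw [add_sub_cancel_right] at h1
      rcases lt_or_ge i a with hlt | hge'
      · rw [hσ i (.inl hlt), hτ i (.inl hlt)] at h1
        simpa using h1
      · have := ih hge' (by omega) (by omega)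
        omega
  · induction i, hgt.le using Int.leInductionDown with
    | base => rw [hσ _ (.inr le_rfl), hτ _ (.inr le_rfl)]
    | pred i hi' ih =>
      have h1 := h i (by omega)
      rcases le_or_gt b i with hle | hgt'
      · rw [hσ i (.inr hle), hτ i (.inr hle)] at h1
        simpa using h1
      · have := ih (by omega) hgt' (by omega)
        omega

theorem exists_sub_one_add_eq {a b : ℤ} (ha : a ≤ 1) (hb : 1 ≤ b) (n : ℤ → ℤ)
    (hn : ∀ i, i ∉ Finset.Icc a b → n i = 0) :
    ∃ σ : ℤ → ℤ, (∀ i, i < a ∨ b ≤ i → σ i = 0) ∧ (∀ i, i ≠ 1 → σ (i - 1) + σ i = n i) ∧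
      σ 0 + ∑ i ∈ Finset.Icc a b, ((i - 1).negOnePow : ℤ) * n i + σ 1 = n 1 := by
  -- The solution is an alternating partial sum, counted from `a` in degrees at most `0` and from
  -- `b` above. The total `u b` is minus the Euler characteristic, which accounts for the jump at
  -- degree one.
  let u : ℤ → ℤ := fun i => ∑ j ∈ Finset.Icc a i, (j.negOnePow : ℤ) * n j
  have hu : ∀ i, u i = u (i - 1) + (i.negOnePow : ℤ) * n i := by
    intro i
    rcases lt_or_ge i a with hlt | hge
    · simp only [u]
      rw [Finset.Icc_eq_empty (by omega), Finset.Icc_eq_empty (by omega),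
        hn i (by simp only [Finset.mem_Icc]; omega)]
      simp
    · have : Finset.Icc a i = insert i (Finset.Icc a (i - 1)) := by
        ext j; simp only [Finset.mem_Icc, Finset.mem_insert]; omega
      simp only [u]
      rw [this, Finset.sum_insert (by simp), add_comm]
  have hua : ∀ i, i < a → u i = 0 := fun i hi => by
    simp only [u]; rw [Finset.Icc_eq_empty (by omega)]; simp
  have hub : ∀ i, b ≤ i → u i = u b := by
    intro i hi
    simp only [u]
    symm
    apply Finset.sum_subset
    · intro j; simp only [Finset.mem_Icc]; omega
    · intro j _ hj; rw [hn j hj, mul_zero]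
  have hl : ∑ i ∈ Finset.Icc a b, ((i - 1).negOnePow : ℤ) * n i = - u b := by
    simp only [u, ← Finset.sum_neg_distrib]
    refine Finset.sum_congr rfl fun i _ => ?_
    rw [Int.negOnePow_sub, Int.negOnePow_one]
    simp
  have hsq : ∀ i : ℤ, (i.negOnePow : ℤ) * (i.negOnePow : ℤ) = 1 := fun i => by
    rw [← Units.val_mul, Int.units_mul_self, Units.val_one]
  have hpred : ∀ i : ℤ, ((i - 1).negOnePow : ℤ) = - (i.negOnePow : ℤ) := fun i => by
    rw [Int.negOnePow_sub, Int.negOnePow_one]; simp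
  refine ⟨fun i => if i ≤ 0 then (i.negOnePow : ℤ) * u i else (i.negOnePow : ℤ) * (u i - u b),
    fun i hi => ?_, fun i hi => ?_, ?_⟩ <;> dsimp only
  · rcases hi with hi | hi
    · rw [if_pos (by omega), hua i hi, mul_zero]
    · rw [if_neg (by omega), hub i hi, sub_self, mul_zero]
  · have h1 := hu i
    have h2 := hsq i
    rcases le_or_gt i 0 with h0 | h0
    · rw [if_pos (by omega), if_pos h0, hpred]
      linear_combination (i.negOnePow : ℤ) * h1 + n i * h2
    · rw [if_neg (by omega), if_neg (by omega), hpred]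
      linear_combination (i.negOnePow : ℤ) * h1 + n i * h2
  · have h1 := hu 1
    rw [hl, if_pos le_rfl, if_neg (by omega)]
    rw [Int.negOnePow_one] at h1 ⊢
    simp only [Int.negOnePow_zero, Units.val_neg, Units.val_one, sub_self] at h1 ⊢
    linarith

namespace PerfectPresentation

variable {R : Type u} [CommRing R] [HasDerivedCategory.{w} (ModuleCat.{u} R)]
  {C : DerivedCategory (ModuleCat.{u} R)} (D : PerfectPresentation C)

theorem rankFun_eq_zero {i : ℤ} (hi : i ∉ Finset.Icc D.a D.b) : rankFun R (D.P.X i) = 0 := by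
  have : Subsingleton (D.P.X i) := by
    rw [Finset.mem_Icc, not_and_or, not_le, not_le] at hi
    exact hi.elim D.subsingleton_of_lt D.subsingleton_of_gt
  ext p
  simp [rankFun, Module.rankAtStalk_eq_zero_of_subsingleton]

/-- The functions `s` that occur in the characterization of natural maps. -/
theorem exists_ranks : ∃ s : ℤ → PrimeSpectrum R → ℤ, (∀ i, i < D.a ∨ D.b ≤ i → s i = 0) ∧
    (∀ i, i ≠ 1 → s (i - 1) + s i = rankFun R (D.P.X i)) ∧
    s 0 + D.eulerChar + s 1 = rankFun R (D.P.X 1) := by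
  choose σ h0 h1 h2 using fun p : PrimeSpectrum R => exists_sub_one_add_eq D.a_le D.le_b
    (fun i => rankFun R (D.P.X i) p) (fun i hi => by rw [D.rankFun_eq_zero hi]; rfl)
  exact ⟨fun i p => σ p i, fun i hi => funext fun p => h0 p i hi,
    fun i hi => funext fun p => h1 p i hi, funext fun p => h2 p⟩

/-- Ranks are locally constant and only finitely many degrees matter, so the locus where all of them
agree with those at `Q` is open and closed. -/
theorem exists_isIdempotentElem (Q : PrimeSpectrum R) : ∃ ε : R, IsIdempotentElem ε ∧
    ε ∉ Q.asIdeal ∧ ∀ p : PrimeSpectrum R, ε ∉ p.asIdeal →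
      ∀ i, rankFun R (D.P.X i) p = rankFun R (D.P.X i) Q := by
  have hfp : ∀ i, Module.FinitePresentation R (D.P.X i) := fun i =>
    Module.finitePresentation_of_projective R _
  have hcl : IsClopen (⋂ i ∈ Finset.Icc D.a D.b, {p : PrimeSpectrum R |
      Module.rankAtStalk (R := R) (D.P.X i) p = Module.rankAtStalk (D.P.X i) Q}) :=
    isClopen_biInter_finset fun i _ => (Module.isLocallyConstant_rankAtStalk).isClopen_fiber _
  obtain ⟨ε, hε, h⟩ := PrimeSpectrum.isClopen_iff.1 hcl
  have hmem : ∀ p : PrimeSpectrum R, ε ∉ p.asIdeal ↔ ∀ i ∈ Finset.Icc D.a D.b,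
      Module.rankAtStalk (R := R) (D.P.X i) p = Module.rankAtStalk (D.P.X i) Q := by
    intro p
    have := Set.ext_iff.1 h p
    simp only [Set.mem_iInter, Set.mem_ofPred_eq] at this
    exact this.symm
  refine ⟨ε, hε, (hmem Q).2 fun i _ => rfl, fun p hp i => ?_⟩
  by_cases hi : i ∈ Finset.Icc D.a D.b
  · exact congrArg Nat.cast ((hmem p).1 hp i hi)
  · rw [D.rankFun_eq_zero hi]; rfl

end PerfectPresentation

/-! ### Bases of the terms of the complex at `Q` -/

namespace PerfectPresentation.LocalSplitting

variable {R : Type u} [CommRing R] [HasDerivedCategory.{w} (ModuleCat.{u} R)]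
  {C : DerivedCategory (ModuleCat.{u} R)} {D : PerfectPresentation C} {Q : PrimeSpectrum R}
  (L : D.LocalSplitting Q)

theorem sum_smul {i j : ℤ} (hij : i + 1 = j) (x : D.P.X i) :
    ∑ k, L.q i k x • (D.P.d i j).hom (L.b i k) = L.s • (D.P.d i j).hom x := by
  subst hij
  exact (L.isDegreeSplitting i).sum_smul x

theorem apply_eq (i : ℤ) (k l : Fin (L.m i)) : L.q i k (L.b i l) = if k = l then L.s else 0 :=
  (L.isDegreeSplitting i).apply_eq k l

theorem apply_eq_zero {i j : ℤ} (hij : i + 1 = j) (k : Fin (L.m i)) {x : D.P.X i}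
    (hx : (D.P.d i j).hom x = 0) : L.q i k x = 0 := by
  subst hij
  exact (L.isDegreeSplitting i).apply_eq_zero k x hx

theorem exact {i j k : ℤ} (hij : i + 1 = j) (hjk : j + 1 = k) (hj : j ≠ 1) {x : D.P.X j}
    (hx : (D.P.d j k).hom x = 0) : ∃ y, L.s • x = (D.P.d i j).hom y := by
  subst hjk
  obtain rfl : i = j - 1 := by omega
  exact (L.isDegreeSplitting j).exact hj x hx

theorem m_eq_zero {i : ℤ} (hi : i < D.a ∨ D.b ≤ i) : L.m i = 0 :=
  (L.isDegreeSplitting i).eq_zero hi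

theorem d_sub_eq_zero {i j : ℤ} (hij : i + 1 = j) (x : D.P.X i) :
    (D.P.d i j).hom (L.s • x - ∑ k, L.q i k x • L.b i k) = 0 := by
  simp only [map_sub, map_smul, map_sum, L.sum_smul hij, sub_self]

theorem smul_d_mem_span {i j : ℤ} (hij : i + 1 = j) (x : D.P.X i) :
    L.s • (D.P.d i j).hom x ∈
      Submodule.span R (Set.range fun k => (D.P.d i j).hom (L.b i k)) := by
  rw [← L.sum_smul hij]
  exact Submodule.sum_mem _ fun k _ => Submodule.smul_mem _ _ (Submodule.subset_span ⟨k, rfl⟩)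

theorem smul_sub_mem_span {i j k : ℤ} (hij : i + 1 = j) (hjk : j + 1 = k) (hj : j ≠ 1)
    (x : D.P.X j) (hx : (D.P.d j k).hom x = 0) :
    L.s ^ 2 • x ∈ Submodule.span R (Set.range fun k => (D.P.d i j).hom (L.b i k)) := by
  obtain ⟨y, hy⟩ := L.exact hij hjk hj hx
  rw [pow_two, mul_smul, hy]
  exact L.smul_d_mem_span hij y

theorem smul_iCycles_mem_span (z : D.P.cycles 1) :
    L.s ^ 2 • (D.P.iCycles 1).hom z ∈
      Submodule.span R (Set.range (Sum.elim (fun k => (D.P.d 0 1).hom (L.b 0 k))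
        (fun k => (D.P.iCycles 1).hom (L.z k)))) := by
  have h1 : D.cocycleClass (L.s • z - ∑ k, L.qz k (D.cocycleClass z) • L.z k) = 0 := by
    simp only [map_sub, map_smul, map_sum, L.isScaledBasis.sum_smul, sub_self]
  obtain ⟨y, hy⟩ := D.exists_d_eq_of_cocycleClass_eq_zero _ h1
  have h2 : L.s ^ 2 • (D.P.iCycles 1).hom z = L.s • (D.P.d 0 1).hom y +
      L.s • ∑ k, L.qz k (D.cocycleClass z) • (D.P.iCycles 1).hom (L.z k) := by
    rw [hy, map_sub, map_smul, map_sum, smul_sub, pow_two, mul_smul]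
    simp only [map_smul, sub_add_cancel]
  rw [h2]
  refine add_mem ?_ (Submodule.smul_mem _ _ (Submodule.sum_mem _ fun k _ =>
    Submodule.smul_mem _ _ (Submodule.subset_span ⟨Sum.inr k, rfl⟩)))
  refine Submodule.span_mono ?_ (L.smul_d_mem_span (zero_add 1) y)
  rintro _ ⟨k, rfl⟩
  exact ⟨Sum.inl k, rfl⟩

/-- Subtracting the `b`-part of `x`, at the cost of one `s`, leaves a cocycle. A second `s` makes it
a coboundary and a third expands this in the `d b`. -/
theorem smul_mem_span {i j : ℤ} (hij : i + 1 = j) (hj : j ≠ 1) (x : D.P.X j) :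
    L.s ^ 3 • x ∈ Submodule.span R
      (Set.range (Sum.elim (fun k => (D.P.d i j).hom (L.b i k)) (L.b j))) := by
  have h1 := L.smul_sub_mem_span hij rfl hj _ (L.d_sub_eq_zero rfl x)
  have h2 : L.s ^ 3 • x = L.s ^ 2 • (L.s • x - ∑ k, L.q j k x • L.b j k) +
      L.s ^ 2 • ∑ k, L.q j k x • L.b j k := by
    rw [← smul_add, sub_add_cancel, smul_smul, pow_succ]
  rw [h2]
  refine add_mem ?_ (Submodule.smul_mem _ _ (Submodule.sum_mem _ fun k _ =>
    Submodule.smul_mem _ _ (Submodule.subset_span ⟨Sum.inr k, rfl⟩)))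
  refine Submodule.span_mono ?_ h1
  rintro _ ⟨k, rfl⟩
  exact ⟨Sum.inl k, rfl⟩

/-- The vectors `d b` and `b` form a basis at `Q`. For independence, `q j` kills cocycles and so
isolates the coefficients of `b j`; then `q i` recovers those of the `d b`. -/
theorem rankFun_eq {i j : ℤ} (hij : i + 1 = j) (hj : j ≠ 1) :
    rankFun R (D.P.X j) Q = L.m i + L.m j := by
  have h := finrank_localizedModule_eq_card Q.asIdeal (M := D.P.X j)
    (Sum.elim (fun k => (D.P.d i j).hom (L.b i k)) (L.b j)) (s := L.s ^ 3) (t := L.s ^ 2)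
    (Q.asIdeal.primeCompl.pow_mem L.s_not_mem 3) (Q.asIdeal.primeCompl.pow_mem L.s_not_mem 2)
    (L.smul_mem_span hij hj)
    (by
      intro α hα
      simp only [Fintype.sum_sum_type, Sum.elim_inl, Sum.elim_inr] at hα
      have h1 : ∀ k, L.s * α (Sum.inr k) = 0 := by
        intro k
        have := congrArg (L.q j k) hα
        have hz : ∀ l, L.q j k ((D.P.d i j).hom (L.b i l)) = 0 := fun l =>
          L.apply_eq_zero rfl k (d_d_apply D.P i j _ _)
        simp only [map_add, map_sum, map_smul, hz, Finset.sum_const_zero, zero_add,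
          L.apply_eq, smul_eq_mul, mul_ite, mul_zero, Finset.sum_ite_eq, Finset.mem_univ, if_true,
          map_zero] at this
        rw [mul_comm]; exact this
      rintro (k | k)
      · have h2 : (D.P.d i j).hom (L.s • ∑ k, α (Sum.inl k) • L.b i k) = 0 := by
          have := congrArg (L.s • ·) hα
          simp only [smul_add, smul_zero, Finset.smul_sum (s := Finset.univ) (r := L.s)
            (f := fun k => α (Sum.inr k) • L.b j k), smul_smul, h1, zero_smul,
            Finset.sum_const_zero, add_zero] at this
          rw [map_smul, map_sum]
          simpa only [map_smul] using this
        have h3 := L.apply_eq_zero hij k h2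
        simp only [map_sum, map_smul, L.apply_eq, smul_eq_mul, mul_ite, mul_zero, Finset.sum_ite_eq,
          Finset.mem_univ, if_true] at h3
        rw [pow_two, mul_assoc, mul_comm L.s (α _), h3]
      · rw [pow_two, mul_assoc, h1, mul_zero])
  rw [Fintype.card_sum, Fintype.card_fin, Fintype.card_fin] at h
  rw [rankFun, Module.rankAtStalk, h, Nat.cast_add]

theorem smul_mem_span_one (x : D.P.X 1) :
    L.s ^ 3 • x ∈ Submodule.span R (Set.range (Sum.elim (Sum.elim
      (fun k => (D.P.d 0 1).hom (L.b 0 k)) (fun k => (D.P.iCycles 1).hom (L.z k))) (L.b 1))) := by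
  obtain ⟨z, hz⟩ := exists_iCycles_eq D.P rfl _ (L.d_sub_eq_zero rfl x)
  have h1 := L.smul_iCycles_mem_span z
  have h2 : L.s ^ 3 • x = L.s ^ 2 • (D.P.iCycles 1).hom z +
      L.s ^ 2 • ∑ k, L.q 1 k x • L.b 1 k := by
    rw [hz, ← smul_add, sub_add_cancel, smul_smul, pow_succ]
  rw [h2]
  refine add_mem ?_ (Submodule.smul_mem _ _ (Submodule.sum_mem _ fun k _ =>
    Submodule.smul_mem _ _ (Submodule.subset_span ⟨Sum.inr k, rfl⟩)))
  refine Submodule.span_mono ?_ h1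
  rintro _ ⟨k, rfl⟩
  exact ⟨Sum.inl k, rfl⟩

/-- As in `rankFun_eq`, with one more layer: the coefficients of the `L.z` are detected by the dual
basis `qz` of the cohomology. -/
theorem rankFun_one_eq : rankFun R (D.P.X 1) Q = L.m 0 + L.n + L.m 1 := by
  have h := finrank_localizedModule_eq_card Q.asIdeal (M := D.P.X 1)
    (Sum.elim (Sum.elim (fun k => (D.P.d 0 1).hom (L.b 0 k))
        (fun k => (D.P.iCycles 1).hom (L.z k))) (L.b 1)) (s := L.s ^ 3) (t := L.s ^ 3)
    (Q.asIdeal.primeCompl.pow_mem L.s_not_mem 3) (Q.asIdeal.primeCompl.pow_mem L.s_not_mem 3)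
    L.smul_mem_span_one
    (by
      intro α hα
      simp only [Fintype.sum_sum_type, Sum.elim_inl, Sum.elim_inr] at hα
      have h1 : ∀ k, L.s * α (Sum.inr k) = 0 := by
        intro k
        have := congrArg (L.q 1 k) hα
        have hz : ∀ l, L.q 1 k ((D.P.d 0 1).hom (L.b 0 l)) = 0 := fun l =>
          L.apply_eq_zero rfl k (d_d_apply D.P 0 1 _ _)
        have hz' : ∀ l, L.q 1 k ((D.P.iCycles 1).hom (L.z l)) = 0 := fun l =>
          L.apply_eq_zero rfl k (d_iCycles D.P 1 _ _)
        simp only [map_add, map_sum, map_smul, hz, hz', Finset.sum_const_zero, zero_add,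
          L.apply_eq, smul_eq_mul, mul_ite, mul_zero, Finset.sum_ite_eq, Finset.mem_univ, if_true,
          map_zero] at this
        rw [mul_comm]; exact this
      have h2 : (D.P.d 0 1).hom (L.s • ∑ k, α (Sum.inl (Sum.inl k)) • L.b 0 k) +
          (D.P.iCycles 1).hom (L.s • ∑ k, α (Sum.inl (Sum.inr k)) • L.z k) = 0 := by
        have := congrArg (L.s • ·) hα
        simp only [smul_add, smul_zero, Finset.smul_sum (s := Finset.univ) (r := L.s)
          (f := fun k => α (Sum.inr k) • L.b 1 k), smul_smul, h1, zero_smul,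
          Finset.sum_const_zero, add_zero] at this
        rw [map_smul, map_smul, map_sum, map_sum]
        simpa only [map_smul] using this
      have h3 : ∀ k, L.s ^ 2 * α (Sum.inl (Sum.inr k)) = 0 := by
        intro k
        have h4 := D.cocycleClass_eq_zero (L.s • ∑ k, α (Sum.inl (Sum.inr k)) • L.z k)
          (-(L.s • ∑ k, α (Sum.inl (Sum.inl k)) • L.b 0 k)) (by
            rw [map_neg, neg_eq_iff_add_eq_zero]; exact h2)
        have h5 := congrArg (L.qz k) h4
        simp only [map_sum, map_smul, L.isScaledBasis.apply_eq, smul_eq_mul, mul_ite, mul_zero,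
          Finset.sum_ite_eq, Finset.mem_univ, if_true, map_zero] at h5
        rw [pow_two, mul_assoc, mul_comm L.s (α _), h5]
      rintro ((k | k) | k)
      · have h2' : (D.P.d 0 1).hom (L.s ^ 2 • ∑ k, α (Sum.inl (Sum.inl k)) • L.b 0 k) = 0 := by
          have := congrArg (L.s • ·) h2
          simp only [← map_smul, smul_add, smul_smul, smul_zero] at this
          rw [← pow_two, Finset.smul_sum (r := L.s ^ 2) (f := fun k => _ • L.z k)] at this
          simpa only [smul_smul, h3, zero_smul, Finset.sum_const_zero, map_zero, add_zero] using this
        have h4 := L.apply_eq_zero rfl k h2'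
        simp only [map_sum, map_smul, L.apply_eq, smul_eq_mul, mul_ite, mul_zero, Finset.sum_ite_eq,
          Finset.mem_univ, if_true] at h4
        rw [pow_succ, mul_assoc, mul_comm L.s (α _), h4]
      · rw [pow_succ, mul_right_comm, h3, zero_mul]
      · rw [pow_succ, mul_assoc, h1, mul_zero])
  rw [Fintype.card_sum, Fintype.card_sum, Fintype.card_fin, Fintype.card_fin,
    Fintype.card_fin] at h
  rw [rankFun, Module.rankAtStalk, h, Nat.cast_add, Nat.cast_add]

/-- Scaling of the denominator. -/
def smul {c : R} (hc : c ∉ Q.asIdeal) : D.LocalSplitting Q where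
  s := c * L.s
  s_not_mem := Q.asIdeal.primeCompl.mul_mem hc L.s_not_mem
  m := L.m
  b := L.b
  q i := c • L.q i
  isDegreeSplitting i := (L.isDegreeSplitting i).smul c
  n := L.n
  z := L.z
  qz := c • L.qz
  isScaledBasis := L.isScaledBasis.smul c

/-- The idempotent `ε` cuts out a neighbourhood of `Q` on which all ranks are constant, and
divides the denominator. -/
structure IsAdapted (ε : R) : Prop where
  isIdempotentElem : IsIdempotentElem ε
  not_mem : ε ∉ Q.asIdeal
  mul_s : ε * L.s = L.s
  rankFun_eq : ∀ p : PrimeSpectrum R, ε ∉ p.asIdeal →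
      ∀ i, rankFun R (D.P.X i) p = rankFun R (D.P.X i) Q

theorem exists_isAdapted (L : D.LocalSplitting Q) : ∃ (L' : D.LocalSplitting Q) (ε : R), L'.IsAdapted ε := by
  obtain ⟨ε, hε, hQ, h⟩ := D.exists_isIdempotentElem Q
  exact ⟨L.smul hQ, ε, hε, hQ, by simp only [smul]; rw [← mul_assoc, hε], h⟩

variable {L} in
-- On `D(ε)` the ranks of `P^i` are those at `Q`, and by `eq_of_sub_one_add_eq` they determine the
-- ranks of the coboundaries.
theorem IsAdapted.eq_m {ε : R} (hε : L.IsAdapted ε) {s : ℤ → PrimeSpectrum R → ℤ}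
    (h₀ : ∀ i, i < D.a ∨ D.b ≤ i → s i = 0)
    (h₁ : ∀ i, i ≠ 1 → s (i - 1) + s i = rankFun R (D.P.X i))
    (p : PrimeSpectrum R) (hp : ε ∉ p.asIdeal) (i : ℤ) : s i p = L.m i := by
  refine congrFun (eq_of_sub_one_add_eq (a := D.a) (b := D.b) (σ := fun i => s i p)
    (τ := fun i => L.m i) ?_ ?_ ?_) i
  · intro i hi
    exact congrFun (h₀ i hi) p
  · intro i hi
    exact congrArg _ (L.m_eq_zero hi)
  · intro i hi
    rw [← L.rankFun_eq (sub_add_cancel i 1) hi, ← hε.rankFun_eq p hp, ← h₁ i hi]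
    rfl

variable {L} in
theorem IsAdapted.eulerChar_eq {ε : R} (hε : L.IsAdapted ε) (p : PrimeSpectrum R)
    (hp : ε ∉ p.asIdeal) : D.eulerChar p = L.n := by
  obtain ⟨s, h₀, h₁, h₂⟩ := D.exists_ranks
  have h3 := congrFun h₂ p
  rw [hε.rankFun_eq p hp, L.rankFun_one_eq] at h3
  simp only [Pi.add_apply, hε.eq_m h₀ h₁ p hp] at h3
  omega

end PerfectPresentation.LocalSplitting

/-! ### Determinants and pairings in the exterior algebra -/

section ExteriorAlgebra

variable {R : Type*} [CommRing R] {M N : Type*} [AddCommGroup M] [Module R M] [AddCommGroup N]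
  [Module R N] {n : ℕ}

/-- Both sides are alternating in the rows of `A`, so it suffices to compare them on permutations of
the standard basis. -/
theorem AlternatingMap.map_sum_smul (g : M [⋀^Fin n]→ₗ[R] N) (A : Matrix (Fin n) (Fin n) R)
    (v : Fin n → M) : g (fun k => ∑ j, A k j • v j) = A.det • g v := by
  have h : g.compLinearMap (Fintype.linearCombination R v) =
      (LinearMap.toSpanSingleton R N (g v)).compAlternatingMap Matrix.detRowAlternating := by
    refine (Pi.basisFun R (Fin n)).ext_alternating fun σ hσ => ?_
    let e : Equiv.Perm (Fin n) := Equiv.ofBijective σ (Finite.injective_iff_bijective.1 hσ)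
    have h1 : (g.compLinearMap (Fintype.linearCombination R v)) (fun i => Pi.basisFun R _ (σ i)) =
        g (v ∘ e) := by
      rw [AlternatingMap.compLinearMap_apply]
      congr 1
      ext i
      simp [e]
    have h2 : (Matrix.detRowAlternating : (Fin n → R) [⋀^Fin n]→ₗ[R] R)
        (fun i => Pi.basisFun R (Fin n) (σ i)) = Equiv.Perm.sign e • (1 : R) := by
      rw [← Matrix.det_one (n := Fin n) (R := R)]
      refine Eq.trans ?_
        ((Matrix.detRowAlternating : (Fin n → R) [⋀^Fin n]→ₗ[R] R).map_perm
          (1 : Matrix (Fin n) (Fin n) R) e)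
      congr 1
      ext i j
      change Pi.basisFun R (Fin n) (σ i) j = (1 : Matrix (Fin n) (Fin n) R) (σ i) j
      rw [Pi.basisFun_apply, Pi.single_apply, Matrix.one_apply]
      simp only [eq_comm]
    rw [h1, LinearMap.compAlternatingMap_apply, h2, g.map_perm, LinearMap.toSpanSingleton_apply,
      smul_assoc, one_smul]
  have h2 := congrArg (fun f : (Fin n → R) [⋀^Fin n]→ₗ[R] N => f A) h
  exact h2

/-- The entries `s • m k` are replaced one at a time by `∑ j, q j (m k) • v j`; `hg` says that `g`
ignores the difference. So `v` need only be a basis modulo what `g` kills. -/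
theorem AlternatingMap.pow_smul_eq (g : M [⋀^Fin n]→ₗ[R] N) {s : R} {v : Fin n → M}
    {q : Fin n → Module.Dual R M}
    (hg : ∀ m k x, m k = s • x - ∑ j, q j x • v j → g m = 0) (m : Fin n → M) :
    s ^ n • g m = (Matrix.of fun k j => q j (m k)).det • g v := by
  rw [← g.map_sum_smul]
  have key : ∀ S : Finset (Fin n),
      g (fun k => if k ∈ S then ∑ j, q j (m k) • v j else s • m k) = s ^ n • g m := by
    intro S
    induction S using Finset.induction_on with
    | empty =>
      have := g.map_smul_univ (fun _ => s) m
      simpa using this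
    | insert k S hk ih =>
      rw [← ih, ← sub_eq_zero]
      have h1 : (fun i => if i ∈ insert k S then ∑ j, q j (m i) • v j else s • m i) =
          Function.update (fun i => if i ∈ S then ∑ j, q j (m i) • v j else s • m i) k
            (∑ j, q j (m k) • v j) := by
        ext i
        by_cases hi : i = k
        · subst hi; simp
        · simp [hi]
      have h2 : (fun i => if i ∈ S then ∑ j, q j (m i) • v j else s • m i) =
          Function.update (fun i => if i ∈ S then ∑ j, q j (m i) • v j else s • m i) k
            (s • m k) := by
        ext i
        by_cases hi : i = k
        · subst hi; simp [hk]
        · simp [hi]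
      rw [h1]
      conv_lhs => rw [h2]
      rw [Function.update_idem, ← g.map_update_sub]
      -- The difference has the form required by `hg` for `x = -m k`.
      refine hg _ k (-m k) ?_
      simp only [Function.update_self, smul_neg, map_neg, neg_smul, Finset.sum_neg_distrib]
      abel
  rw [← key Finset.univ]
  simp

@[elab_as_elim]
theorem exteriorPower_induction {p : ∀ c : ExteriorAlgebra R M, c ∈ ⋀[R]^n M → Prop}
    (ιMulti : ∀ m, p (ExteriorAlgebra.ιMulti R n m) (ExteriorAlgebra.ιMulti_range R n ⟨m, rfl⟩))
    (zero : p 0 (zero_mem _))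
    (add : ∀ x y hx hy, p x hx → p y hy → p (x + y) (add_mem hx hy))
    (smul : ∀ (r : R) x hx, p x hx → p (r • x) (Submodule.smul_mem _ r hx))
    {c : ExteriorAlgebra R M} (hc : c ∈ ⋀[R]^n M) : p c hc := by
  have h1 := hc
  rw [← ExteriorAlgebra.ιMulti_span_fixedDegree] at h1
  have h2 : ∀ c (_ : c ∈ Submodule.span R (Set.range (ExteriorAlgebra.ιMulti R n (M := M)))),
      ∃ hc : c ∈ ⋀[R]^n M, p c hc := by
    intro c h1
    induction h1 using Submodule.span_induction with
    | mem x hx => obtain ⟨m, rfl⟩ := hx; exact ⟨_, ιMulti m⟩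
    | zero => exact ⟨_, zero⟩
    | add x y _ _ hx hy => exact ⟨_, add x y hx.1 hy.1 hx.2 hy.2⟩
    | smul r x _ hx => exact ⟨_, smul r x hx.1 hx.2⟩
  exact (h2 c h1).2

theorem extPairing_ιMulti_ιMulti (m : Fin n → M) (q : Fin n → Module.Dual R M) :
    extPairing R M (ExteriorAlgebra.ιMulti R n m) (ExteriorAlgebra.ιMulti R n q) =
      (Matrix.of fun k j => q j (m k)).det := by
  have h1 : DirectSum.decomposeLinearEquiv (fun k : ℕ => ⋀[R]^k M) (ExteriorAlgebra.ιMulti R n m) =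
      DirectSum.lof R ℕ _ n (exteriorPower.ιMulti R n m) :=
    DirectSum.decompose_coe (fun k : ℕ => ⋀[R]^k M) (exteriorPower.ιMulti R n m)
  have h2 : DirectSum.decomposeLinearEquiv (fun k : ℕ => ⋀[R]^k (Module.Dual R M))
      (ExteriorAlgebra.ιMulti R n q) =
      DirectSum.lof R ℕ _ n (exteriorPower.ιMulti R n q) :=
    DirectSum.decompose_coe (fun k : ℕ => ⋀[R]^k (Module.Dual R M)) (exteriorPower.ιMulti R n q)
  rw [extPairing, LinearMap.comp_apply, LinearEquiv.coe_coe, h1, DirectSum.toModule_lof,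
    LinearMap.comp_apply, LinearMap.dualMap_apply, LinearMap.comp_apply, LinearEquiv.coe_coe, h2,
    DirectSum.component.lof_self, LinearMap.flip_apply, exteriorPower.pairingDual_ιMulti_ιMulti]

theorem extPairing_ιMulti_ιMulti_of_apply_eq {m : Fin n → M} {q : Fin n → Module.Dual R M} {s : R}
    (h : ∀ k j, q k (m j) = if k = j then s else 0) :
    extPairing R M (ExteriorAlgebra.ιMulti R n m) (ExteriorAlgebra.ιMulti R n q) = s ^ n := by
  rw [extPairing_ιMulti_ιMulti]
  have : (Matrix.of fun k j => q j (m k)) = Matrix.diagonal fun _ => s := by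
    ext k j
    rw [Matrix.of_apply, h, Matrix.diagonal_apply]
    simp only [eq_comm]
  rw [this, Matrix.det_diagonal]
  simp

theorem range_append {α : Type*} {l : ℕ} (a : Fin l → α) (b : Fin n → α) :
    Set.range (Fin.append a b) = Set.range (Sum.elim a b) := by
  rw [← EquivLike.range_comp (Fin.append a b) finSumFinEquiv]
  congr 1
  ext (k | k) <;> simp

theorem extPairing_map {Z : Type*} [AddCommGroup Z] [Module R Z] (π : Z →ₗ[R] M)
    {c : ExteriorAlgebra R Z} (hc : c ∈ ⋀[R]^n Z) (q : Fin n → Module.Dual R M) :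
    extPairing R M (ExteriorAlgebra.map π c) (ExteriorAlgebra.ιMulti R n q) =
      extPairing R Z c (ExteriorAlgebra.ιMulti R n fun j => q j ∘ₗ π) := by
  induction hc using exteriorPower_induction with
  | ιMulti m =>
    rw [ExteriorAlgebra.map_apply_ιMulti, extPairing_ιMulti_ιMulti, extPairing_ιMulti_ιMulti]
    rfl
  | zero => simp
  | add x y _ _ hx hy => simp only [map_add, LinearMap.add_apply, hx, hy]
  | smul r x _ hx => simp only [map_smul, LinearMap.smul_apply, hx]

/-- The main tool for comparing with a basis. It is applied to `⋀ d`, and to exterior multiplication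
by a product of coboundaries or cocycles; such maps `G` depend only on classes modulo a submodule.
-/
theorem pow_smul_eq_extPairing_smul (G : ExteriorAlgebra R M →ₗ[R] N) {s : R} {v : Fin n → M}
    {q : Fin n → Module.Dual R M}
    (hG : ∀ m k x, m k = s • x - ∑ j, q j x • v j → G (ExteriorAlgebra.ιMulti R n m) = 0)
    {c : ExteriorAlgebra R M} (hc : c ∈ ⋀[R]^n M) :
    s ^ n • G c = extPairing R M c (ExteriorAlgebra.ιMulti R n q) •
      G (ExteriorAlgebra.ιMulti R n v) := by
  induction hc using exteriorPower_induction with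
  | ιMulti m =>
    rw [extPairing_ιMulti_ιMulti]
    exact (G.compAlternatingMap (ExteriorAlgebra.ιMulti R n)).pow_smul_eq hG m
  | zero => simp
  | add x y _ _ hx hy => simp only [map_add, smul_add, hx, hy, LinearMap.add_apply, add_smul]
  | smul r x _ hx =>
    rw [map_smul, smul_comm, hx, map_smul, LinearMap.smul_apply, smul_smul, smul_eq_mul]

/-- The multiple of one factor of the second product is a combination of the factors of the first,
so every resulting term has a repeated factor. -/
theorem smul_ιMulti_mul_ιMulti_eq_zero {l : ℕ} {t : Fin l → M} {m : Fin n → M} {σ : R} (k : Fin n)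
    (h : σ • m k ∈ Submodule.span R (Set.range t)) :
    σ • (ExteriorAlgebra.ιMulti R l t * ExteriorAlgebra.ιMulti R n m) = 0 := by
  rw [ExteriorAlgebra.ιMulti_mul_ιMulti]
  have h1 : ∀ x ∈ Submodule.span R (Set.range t), ExteriorAlgebra.ιMulti R (l + n)
      (Function.update (Fin.append t m) (Fin.natAdd l k) x) = 0 := by
    intro x hx
    induction hx using Submodule.span_induction with
    | mem x hx =>
      obtain ⟨j, rfl⟩ := hx
      have hne : Fin.castAdd n j ≠ Fin.natAdd l k := by
        intro e
        have := congrArg Fin.val e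
        simp only [Fin.val_castAdd, Fin.val_natAdd] at this
        omega
      refine AlternatingMap.map_eq_zero_of_eq _ _ (i := Fin.castAdd n j) (j := Fin.natAdd l k) ?_ hne
      rw [Function.update_self, Function.update_of_ne hne, Fin.append_left]
    | zero => exact AlternatingMap.map_update_zero _ _ _
    | add x y _ _ hx hy => rw [AlternatingMap.map_update_add, hx, hy, add_zero]
    | smul r x _ hx => rw [AlternatingMap.map_update_smul, hx, smul_zero]
  rw [← h1 _ h, AlternatingMap.map_update_smul]
  congr 2
  ext i
  by_cases hi : i = Fin.natAdd l k
  · subst hi; simp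
  · rw [Function.update_of_ne hi]

theorem exists_pow_smul_eq_smul_ιMulti {v : Fin n → M} {s : R}
    (h : ∀ x, s • x ∈ Submodule.span R (Set.range v)) {y : ExteriorAlgebra R M}
    (hy : y ∈ ⋀[R]^n M) : ∃ r : R, s ^ n • y = r • ExteriorAlgebra.ιMulti R n v := by
  induction hy using exteriorPower_induction with
  | ιMulti m =>
    choose A hA using fun k => (Submodule.mem_span_range_iff_exists_fun R).1 (h (m k))
    refine ⟨(Matrix.of A).det, ?_⟩
    rw [← AlternatingMap.map_sum_smul]
    have := (ExteriorAlgebra.ιMulti R n).map_smul_univ (fun _ => s) m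
    simp only [Finset.prod_const, Finset.card_univ, Fintype.card_fin] at this
    rw [← this]
    congr 1
    ext k
    exact (hA k).symm
  | zero => exact ⟨0, by simp⟩
  | add x y _ _ hx hy =>
    obtain ⟨a, ha⟩ := hx
    obtain ⟨b, hb⟩ := hy
    exact ⟨a + b, by rw [smul_add, ha, hb, add_smul]⟩
  | smul r x _ hx =>
    obtain ⟨a, ha⟩ := hx
    exact ⟨r * a, by rw [smul_comm, ha, mul_smul]⟩

end ExteriorAlgebra

/-! ### Exterior powers with locally constant exponent -/

section ExtPow

variable {R : Type u} [CommRing R] {M : Type*} {N : Type*} [AddCommGroup M] [Module R M]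
  [AddCommGroup N] [Module R N]

theorem eq_zero_of_isIdempotentElem {e : R} (he : IsIdempotentElem e)
    (h : ∀ p : PrimeSpectrum R, e ∈ p.asIdeal) : e = 0 := by
  have h1 : IsNilpotent e := by
    rw [nilpotent_iff_mem_prime]
    exact fun J hJ => h ⟨J, hJ⟩
  obtain ⟨k, hk⟩ := h1
  rcases Nat.eq_zero_or_pos k with rfl | hpos
  · rw [pow_zero] at hk
    rw [← mul_one e, hk, mul_zero]
  · rw [← he.pow_eq hpos.ne', hk]

theorem smul_mem_extPow {s : PrimeSpectrum R → ℤ} {n : ℕ} {ε : R} (hε : IsIdempotentElem ε)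
    (hs : ∀ p : PrimeSpectrum R, ε ∉ p.asIdeal → s p = n) {y : ExteriorAlgebra R M}
    (hy : y ∈ ⋀[R]^n M) : ε • y ∈ extPow R M s :=
  Submodule.subset_span ⟨n, ε, hε, hs, y, hy, rfl⟩

theorem smul_mem_exteriorPower {s : PrimeSpectrum R → ℤ} {n : ℕ} {ε : R} (hε : IsIdempotentElem ε)
    (hs : ∀ p : PrimeSpectrum R, ε ∉ p.asIdeal → s p = n) {y : ExteriorAlgebra R M}
    (hy : y ∈ extPow R M s) : ε • y ∈ ⋀[R]^n M := by
  induction hy using Submodule.span_induction with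
  | mem x hx =>
    obtain ⟨n', ε', hε', hs', y, hy, rfl⟩ := hx
    by_cases hn : n' = n
    · subst hn
      exact Submodule.smul_mem _ _ (Submodule.smul_mem _ _ hy)
    -- The exponent has two different values on `D(ε)` and `D(ε')`, so these sets are disjoint.
    · have h0 : ε * ε' = 0 := eq_zero_of_isIdempotentElem (hε.mul hε') (by
        intro p
        by_contra hp
        have h1 := hs p fun h => hp (p.asIdeal.mul_mem_right _ h)
        have h2 := hs' p fun h => hp (p.asIdeal.mul_mem_left _ h)
        rw [h1] at h2
        exact hn (by exact_mod_cast h2.symm))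
      rw [smul_smul, h0, zero_smul]
      exact zero_mem _
  | zero => rw [smul_zero]; exact zero_mem _
  | add x y _ _ hx hy => rw [smul_add]; exact add_mem hx hy
  | smul r x _ hx => rw [smul_comm]; exact Submodule.smul_mem _ _ hx

theorem one_mem_extPow : (1 : ExteriorAlgebra R M) ∈ extPow R M 0 := by
  have h1 : (1 : ExteriorAlgebra R M) ∈ ⋀[R]^0 M := by
    rw [ExteriorAlgebra.exteriorPower, pow_zero]; exact Submodule.one_le.1 le_rfl
  have := smul_mem_extPow (s := 0) (n := 0) (M := M) (IsIdempotentElem.one (M := R))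
    (fun _ _ => rfl) h1
  rwa [one_smul] at this

theorem mul_mem_extPow {s t : PrimeSpectrum R → ℤ} {x y : ExteriorAlgebra R M}
    (hx : x ∈ extPow R M s) (hy : y ∈ extPow R M t) : x * y ∈ extPow R M (s + t) := by
  induction hx, hy using Submodule.span_induction₂ with
  | mem_mem x y hx hy =>
    obtain ⟨n, ε, hε, hs, x, hx, rfl⟩ := hx
    obtain ⟨n', ε', hε', hs', y, hy, rfl⟩ := hy
    rw [smul_mul_smul_comm]
    refine smul_mem_extPow (n := n + n') (hε.mul hε') (fun p hp => ?_) ?_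
    · rw [Pi.add_apply, hs p fun h => hp (p.asIdeal.mul_mem_right _ h),
        hs' p fun h => hp (p.asIdeal.mul_mem_left _ h), Nat.cast_add]
    · rw [ExteriorAlgebra.exteriorPower, pow_add]; exact Submodule.mul_mem_mul hx hy
  | zero_left y hy => rw [zero_mul]; exact zero_mem _
  | zero_right x hx => rw [mul_zero]; exact zero_mem _
  | add_left x y z _ _ _ h1 h2 => rw [add_mul]; exact add_mem h1 h2
  | add_right x y z _ _ _ h1 h2 => rw [mul_add]; exact add_mem h1 h2
  | smul_left r x y _ _ h => rw [smul_mul_assoc]; exact Submodule.smul_mem _ _ h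
  | smul_right r x y _ _ h => rw [mul_smul_comm]; exact Submodule.smul_mem _ _ h

theorem map_mem_exteriorPower (f : M →ₗ[R] N) {n : ℕ} {x : ExteriorAlgebra R M}
    (hx : x ∈ ⋀[R]^n M) : ExteriorAlgebra.map f x ∈ ⋀[R]^n N := by
  induction hx using exteriorPower_induction with
  | ιMulti m =>
    rw [ExteriorAlgebra.map_apply_ιMulti]
    exact ExteriorAlgebra.ιMulti_range R n ⟨_, rfl⟩
  | zero => rw [map_zero]; exact zero_mem _
  | add x y _ _ hx hy => rw [map_add]; exact add_mem hx hy
  | smul r x _ hx => rw [map_smul]; exact Submodule.smul_mem _ _ hx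

theorem map_mem_extPow (f : M →ₗ[R] N) {s : PrimeSpectrum R → ℤ} {x : ExteriorAlgebra R M}
    (hx : x ∈ extPow R M s) : ExteriorAlgebra.map f x ∈ extPow R N s := by
  induction hx using Submodule.span_induction with
  | mem x hx =>
    obtain ⟨n, ε, hε, hs, x, hx, rfl⟩ := hx
    rw [map_smul]
    exact smul_mem_extPow hε hs (map_mem_exteriorPower f hx)
  | zero => rw [map_zero]; exact zero_mem _
  | add x y _ _ hx hy => rw [map_add]; exact add_mem hx hy
  | smul r x _ hx => rw [map_smul]; exact Submodule.smul_mem _ _ hx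

end ExtPow

/-! ### Determinant lines over a semilocal ring are free -/

section Semilocal

theorem finite_maximalSpectrum_of_finite (Λ R : Type*) [CommRing Λ] [IsLocalRing Λ] [CommRing R]
    [Algebra Λ R] [Module.Finite Λ R] : Finite (MaximalSpectrum R) := by
  have h1 : ((IsLocalRing.maximalIdeal Λ).primesOver R).Finite :=
    Algebra.QuasiFinite.finite_primesOver _
  have := h1.to_subtype
  refine Finite.of_injective (fun m : MaximalSpectrum R =>
    (⟨m.asIdeal, m.isMaximal.isPrime, ⟨?_⟩⟩ : (IsLocalRing.maximalIdeal Λ).primesOver R)) ?_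
  · have := m.isMaximal
    have h2 := Ideal.isMaximal_comap_of_isIntegral_of_isMaximal (R := Λ) m.asIdeal
    exact (IsLocalRing.eq_maximalIdeal h2).symm
  · intro m m' h
    exact MaximalSpectrum.ext (Subtype.ext_iff.1 h)

variable {R : Type u} [CommRing R]

/-- A module over a semilocal ring that is locally free of rank one is free of rank one. -/
theorem nonempty_linearEquiv_of_forall_isMaximal [Finite (MaximalSpectrum R)] {L : Type*}
    [AddCommGroup L] [Module R L]
    (h : ∀ m : MaximalSpectrum R, ∃ s ∉ m.asIdeal, ∃ (w : L) (ψ : Module.Dual R L),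
      ψ w ∉ m.asIdeal ∧ ∀ y, s • y = ψ y • w) : Nonempty (L ≃ₗ[R] R) := by
  classical
  have := Fintype.ofFinite (MaximalSpectrum R)
  choose s hs w ψ hψ hy using h
  -- As in the Chinese remainder theorem, `e m` avoids `m` and lies in every other maximal ideal, so
  -- `Ψ` and `W` below combine the local generators.
  have he : ∀ m : MaximalSpectrum R, ∃ e ∉ m.asIdeal, ∀ m', m' ≠ m → e ∈ m'.asIdeal := by
    intro m
    have hx : ∀ m' : MaximalSpectrum R, ∃ x ∉ m.asIdeal, m' ≠ m → x ∈ m'.asIdeal := by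
      intro m'
      by_cases hm : m' = m
      · exact ⟨1, m.isMaximal.isPrime.one_notMem, fun h => (h hm).elim⟩
      · have : ¬ m'.asIdeal ≤ m.asIdeal := fun hle =>
          hm (MaximalSpectrum.ext (m'.isMaximal.eq_of_le m.isMaximal.ne_top hle))
        obtain ⟨x, hx, hx'⟩ := Set.not_subset.1 this
        exact ⟨x, hx', fun _ => hx⟩
    choose x hx hx' using hx
    have := m.isMaximal.isPrime
    exact ⟨∏ m', x m', m.asIdeal.primeCompl.prod_mem fun m' _ => hx m', fun m' hm' =>
      Ideal.mem_of_dvd _ (Finset.dvd_prod_of_mem x (Finset.mem_univ m')) (hx' m' hm')⟩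
  choose e he he' using he
  let Ψ : Module.Dual R L := ∑ m, e m • ψ m
  let W : L := ∑ m, e m • w m
  have hmod : ∀ m, Ψ W - e m * e m * ψ m (w m) ∈ m.asIdeal := by
    intro m
    have h1 : Ψ W - e m * e m * ψ m (w m) =
        (∑ k ∈ Finset.univ.erase m, e k * ψ k W) + e m *
          ∑ k ∈ Finset.univ.erase m, e k * ψ m (w k) := by
      have hW : Ψ W = ∑ k, e k * ψ k W := by simp [Ψ, LinearMap.sum_apply]
      have hm : ψ m W = ∑ k, e k * ψ m (w k) := by simp [W]
      rw [hW, ← Finset.add_sum_erase _ _ (Finset.mem_univ m), hm,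
        ← Finset.add_sum_erase _ _ (Finset.mem_univ m)]
      ring
    rw [h1]
    exact add_mem (Ideal.sum_mem _ fun k hk => Ideal.mul_mem_right _ _
      (he' k m (Finset.ne_of_mem_erase hk).symm)) (Ideal.mul_mem_left _ _ (Ideal.sum_mem _
        fun k hk => Ideal.mul_mem_right _ _ (he' k m (Finset.ne_of_mem_erase hk).symm)))
  have hunit : ∀ x : R, (∀ m : MaximalSpectrum R, x ∉ m.asIdeal) → IsUnit x := by
    intro x hx
    by_contra hcon
    obtain ⟨I, hI, hxI⟩ := exists_max_ideal_of_mem_nonunits hcon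
    exact hx ⟨I, hI⟩ hxI
  have hu : IsUnit (Ψ W) := hunit _ fun m hmem => by
    have := m.isMaximal.isPrime
    have h1 := (Submodule.sub_mem_iff_right _ hmem).1 (hmod m)
    exact m.asIdeal.primeCompl.mul_mem (m.asIdeal.primeCompl.mul_mem (he m) (he m)) (hψ m) h1
  -- Two vectors in a module of rank one are proportional. This is checked at each maximal ideal,
  -- where `s m` makes every element a multiple of `w m`; since `Ψ W` is a unit, `W` generates.
  have key : ∀ y, Ψ W • y = Ψ y • W := by
    intro y
    rw [← sub_eq_zero, ← Submodule.span_singleton_eq_bot (R := R),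
      ← Submodule.annihilator_eq_top_iff, Ideal.eq_top_iff_one]
    by_contra hcon
    have hne : (R ∙ (Ψ W • y - Ψ y • W)).annihilator ≠ ⊤ := by
      rwa [Ne, Ideal.eq_top_iff_one]
    obtain ⟨I, hI, hle⟩ := Ideal.exists_le_maximal _ hne
    let m : MaximalSpectrum R := ⟨I, hI⟩
    have := hI.isPrime
    refine I.primeCompl.mul_mem (hs m) (hs m) (hle ?_)
    rw [Submodule.mem_annihilator_span_singleton]
    have h1 : s m • Ψ W = ψ m W * Ψ (w m) := by
      rw [← map_smul, hy, map_smul, smul_eq_mul]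
    have h2 : s m • Ψ y = ψ m y * Ψ (w m) := by
      rw [← map_smul, hy, map_smul, smul_eq_mul]
    have h3 : ∀ (a : R) (x : L), (s m * s m) • a • x = (s m • a) • s m • x := by
      intro a x
      simp only [smul_smul, smul_eq_mul]
      congr 1
      ring
    rw [smul_sub, h3, h3, h1, h2, hy, hy, smul_smul, smul_smul,
      sub_eq_zero]
    congr 1
    ring
  obtain ⟨u, hu⟩ := hu
  refine ⟨LinearEquiv.ofLinearMap Ψ (LinearMap.toSpanSingleton R L ((↑u⁻¹ : R) • W)) ?_ ?_⟩
  · ext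
    simp [← hu]
  · ext y
    simp only [LinearMap.comp_apply, LinearMap.toSpanSingleton_apply, LinearMap.id_apply]
    rw [smul_comm, ← key, smul_smul, ← hu, Units.inv_mul, one_smul]

variable (M : Type*) [AddCommGroup M] [Module R M] [Module.Finite R M] [Module.Projective R M]

theorem exists_isIdempotentElem_rankFun (Q : PrimeSpectrum R) : ∃ ε : R, IsIdempotentElem ε ∧
    ε ∉ Q.asIdeal ∧ ∀ p : PrimeSpectrum R, ε ∉ p.asIdeal → rankFun R M p = rankFun R M Q := by
  have : Module.FinitePresentation R M := Module.finitePresentation_of_projective R _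
  have hcl : IsClopen {p : PrimeSpectrum R |
      Module.rankAtStalk (R := R) M p = Module.rankAtStalk M Q} :=
    (Module.isLocallyConstant_rankAtStalk).isClopen_fiber _
  obtain ⟨ε, hε, h⟩ := PrimeSpectrum.isClopen_iff.1 hcl
  have hmem : ∀ p : PrimeSpectrum R, ε ∉ p.asIdeal ↔
      Module.rankAtStalk (R := R) M p = Module.rankAtStalk M Q := by
    intro p
    have := Set.ext_iff.1 h p
    simp only [Set.mem_ofPred_eq] at this
    exact this.symm
  exact ⟨ε, hε, (hmem Q).2 rfl, fun p hp => congrArg Nat.cast ((hmem p).1 hp)⟩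

/-- Near each maximal ideal the exterior product of a scaled basis generates the determinant and the
product of its dual basis provides the coordinate. The idempotent restricts to the piece of constant
rank. -/
theorem nonempty_detLine_linearEquiv [Finite (MaximalSpectrum R)] :
    Nonempty (detLine R M ≃ₗ[R] R) := by
  refine nonempty_linearEquiv_of_forall_isMaximal fun m => ?_
  have := m.isMaximal.isPrime
  obtain ⟨ε, hε, hεm, hr⟩ := exists_isIdempotentElem_rankFun M m.toPrimeSpectrum
  have : Module.FinitePresentation R M := Module.finitePresentation_of_projective R _
  have : Module.Free (Localization.AtPrime m.asIdeal) (LocalizedModule m.asIdeal.primeCompl M) :=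
    free_localizedModule_of_retract m.asIdeal (P := M) LinearMap.id LinearMap.id (s := 1)
      m.asIdeal.primeCompl.one_mem (by simp)
  obtain ⟨s, hs, n, v, q, hn, hvq⟩ := exists_isScaledBasis (M := M) m.asIdeal
  have hr' : ∀ p : PrimeSpectrum R, ε ∉ p.asIdeal → rankFun R M p = n := fun p hp => by
    rw [hr p hp, hn]; rfl
  have hG : ∀ y ∈ ⋀[R]^n M, s ^ n • y =
      extPairing R M y (ExteriorAlgebra.ιMulti R n q) • ExteriorAlgebra.ιMulti R n v := fun y hy =>
    pow_smul_eq_extPairing_smul (s := s) (v := v) LinearMap.id (fun k i x hk => by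
      rw [hvq.sum_smul, sub_self] at hk
      rw [LinearMap.id_apply, AlternatingMap.map_coord_zero _ i hk]) hy
  refine ⟨s ^ n * ε, m.asIdeal.primeCompl.mul_mem (m.asIdeal.primeCompl.pow_mem hs n) hεm,
    ⟨ε • ExteriorAlgebra.ιMulti R n v, smul_mem_extPow hε hr'
      (ExteriorAlgebra.ιMulti_range R n ⟨v, rfl⟩)⟩,
    ε • ((extPairing R M).flip (ExteriorAlgebra.ιMulti R n q) ∘ₗ (detLine R M).subtype), ?_, ?_⟩
  · have h1 : extPairing R M (ExteriorAlgebra.ιMulti R n v) (ExteriorAlgebra.ιMulti R n q) =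
        s ^ n :=
      extPairing_ιMulti_ιMulti_of_apply_eq hvq.apply_eq
    change ε * extPairing R M (ε • ExteriorAlgebra.ιMulti R n v) (ExteriorAlgebra.ιMulti R n q) ∉
      m.asIdeal
    rw [map_smul, LinearMap.smul_apply, h1]
    exact m.asIdeal.primeCompl.mul_mem hεm (m.asIdeal.primeCompl.mul_mem hεm
      (m.asIdeal.primeCompl.pow_mem hs n))
  · intro y
    apply Subtype.ext
    change (s ^ n * ε) • (y : ExteriorAlgebra R M) =
      (ε * extPairing R M (y : ExteriorAlgebra R M) (ExteriorAlgebra.ιMulti R n q)) •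
        ε • ExteriorAlgebra.ιMulti R n v
    rw [mul_smul, hG _ (smul_mem_exteriorPower hε hr' y.2), map_smul, LinearMap.smul_apply,
      smul_smul]
    congr 1
    rw [smul_eq_mul, mul_right_comm, hε]

end Semilocal

/-! ### Comparing the elements `w i` with local bases -/

namespace PerfectPresentation

variable {R : Type u} [CommRing R] [HasDerivedCategory.{w} (ModuleCat.{u} R)]
  {C : DerivedCategory (ModuleCat.{u} R)} (D : PerfectPresentation C)

/-- The elements that occur in the characterization of natural maps. -/
structure NaturalDatum where
  /-- the ranks of the coboundaries -/
  s : ℤ → PrimeSpectrum R → ℤ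
  s_eq_zero : ∀ i, i < D.a ∨ D.b ≤ i → s i = 0
  s_add : ∀ i, i ≠ 1 → s (i - 1) + s i = rankFun R (D.P.X i)
  s_add_one : s 0 + D.eulerChar + s 1 = rankFun R (D.P.X 1)
  /-- the complements of the cocycles -/
  c : ∀ i, ExteriorAlgebra R (D.P.X i)
  c_mem : ∀ i, c i ∈ extPow R (D.P.X i) (s i)
  c_eq_one : ∀ i, i < D.a ∨ D.b ≤ i → c i = 1
  /-- the part in the cocycles of degree one -/
  z : ExteriorAlgebra R (D.P.cycles 1)
  z_mem : z ∈ extPow R (D.P.cycles 1) D.eulerChar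
  /-- the class of `z` -/
  x : extPow R (cohomology C 1) D.eulerChar
  x_eq : (x : ExteriorAlgebra R (cohomology C 1)) = ExteriorAlgebra.map D.cocycleClass z
  /-- the elements of the determinants -/
  w : ∀ i, detLine R (D.P.X i)
  w_eq : ∀ i, i ≠ 1 → (w i : ExteriorAlgebra R (D.P.X i)) =
      ExteriorAlgebra.map (D.P.d (i - 1) i).hom (c (i - 1)) * c i
  w_one_eq : (w 1 : ExteriorAlgebra R (D.P.X 1)) =
      ExteriorAlgebra.map (D.P.d 0 1).hom (c 0) *
        ExteriorAlgebra.map (D.P.iCycles 1).hom z * c 1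

theorem isNaturalMap_iff (Ψ : extPow R (cohomology C 1) D.eulerChar →ₗ[R] D.detInv) :
    D.IsNaturalMap Ψ ↔ ∀ (δ : D.NaturalDatum)
      (φ : ∀ i : D.oddDegrees, Module.Dual R (detLine R (D.P.X i))),
      Ψ δ.x ((PiTensorProduct.tprod R fun i : D.evenDegrees => δ.w i) ⊗ₜ[R]
        PiTensorProduct.tprod R φ) = ∏ i : D.oddDegrees, φ i (δ.w i) :=
  ⟨fun h δ φ => h δ.s δ.s_eq_zero δ.s_add δ.s_add_one δ.c δ.c_mem δ.c_eq_one δ.z δ.z_mem δ.x δ.x_eq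
    δ.w δ.w_eq δ.w_one_eq φ,
    fun h s h0 h1 h2 c hc hc1 z hz x hx w hw hw1 φ =>
      h ⟨s, h0, h1, h2, c, hc, hc1, z, hz, x, hx, w, hw, hw1⟩ φ⟩

variable {D}

/-- The elements `w i` are determined by the other data. -/
theorem NaturalDatum.exists_of (s : ℤ → PrimeSpectrum R → ℤ)
    (h₀ : ∀ i, i < D.a ∨ D.b ≤ i → s i = 0)
    (h₁ : ∀ i, i ≠ 1 → s (i - 1) + s i = rankFun R (D.P.X i))
    (h₂ : s 0 + D.eulerChar + s 1 = rankFun R (D.P.X 1))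
    (c : ∀ i, ExteriorAlgebra R (D.P.X i)) (hc : ∀ i, c i ∈ extPow R (D.P.X i) (s i))
    (hc' : ∀ i, i < D.a ∨ D.b ≤ i → c i = 1) (z : ExteriorAlgebra R (D.P.cycles 1))
    (hz : z ∈ extPow R (D.P.cycles 1) D.eulerChar) :
    ∃ δ : D.NaturalDatum, δ.c = c ∧ δ.z = z := by
  have h : ∀ i, ∃ w : detLine R (D.P.X i), i ≠ 1 → (w : ExteriorAlgebra R (D.P.X i)) =
      ExteriorAlgebra.map (D.P.d (i - 1) i).hom (c (i - 1)) * c i := by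
    intro i
    by_cases hi : i = 1
    · exact ⟨0, fun h => (h hi).elim⟩
    · refine ⟨⟨_, ?_⟩, fun _ => rfl⟩
      rw [detLine, ← h₁ i hi]
      exact mul_mem_extPow (map_mem_extPow _ (hc _)) (hc _)
  choose w hw using h
  refine ⟨⟨s, h₀, h₁, h₂, c, hc, hc', z, hz, ⟨_, map_mem_extPow _ hz⟩, rfl,
    Function.update w 1 ⟨ExteriorAlgebra.map (D.P.d 0 1).hom (c 0) *
        ExteriorAlgebra.map (D.P.iCycles 1).hom z * c 1, ?_⟩, fun i hi => ?_, ?_⟩, rfl, rfl⟩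
  · rw [detLine, ← h₂]
    exact mul_mem_extPow (mul_mem_extPow (map_mem_extPow _ (hc _)) (map_mem_extPow _ hz)) (hc _)
  · rw [Function.update_of_ne hi]
    exact hw i hi
  · rw [Function.update_self]

namespace LocalSplitting

variable {Q : PrimeSpectrum R} (L : D.LocalSplitting Q) {ε : R}

/-- The coordinate of `c` with respect to the basis `b i`, on `D(ε)`. -/
def coeff (ε : R) (c : ∀ i, ExteriorAlgebra R (D.P.X i)) (i : ℤ) : R :=
  -- The summand `1 - ε` is invisible after multiplication by `s = ε s`. It makes the coefficient of
  -- `c i = 1` equal to `1` rather than `ε`, so that the degrees outside the complex drop out of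
  -- products.
  extPairing R (D.P.X i) (ε • c i) (ExteriorAlgebra.ιMulti R (L.m i) (L.q i)) + (1 - ε)

/-- The exterior product of the basis of the coboundaries. -/
def θ (i j : ℤ) : ExteriorAlgebra R (D.P.X j) :=
  ExteriorAlgebra.ιMulti R (L.m i) fun k => (D.P.d i j).hom (L.b i k)

theorem pow_smul_map_d {i j : ℤ} (hij : i + 1 = j) {c : ExteriorAlgebra R (D.P.X i)}
    (hc : c ∈ ⋀[R]^(L.m i) (D.P.X i)) :
    L.s ^ L.m i • ExteriorAlgebra.map (D.P.d i j).hom c =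
      extPairing R (D.P.X i) c (ExteriorAlgebra.ιMulti R (L.m i) (L.q i)) • L.θ i j := by
  have h := pow_smul_eq_extPairing_smul (s := L.s) (v := L.b i) (q := L.q i)
    (ExteriorAlgebra.map (D.P.d i j).hom).toLinearMap (fun m k x hk => by
      rw [AlgHom.toLinearMap_apply, ExteriorAlgebra.map_apply_ιMulti]
      refine AlternatingMap.map_coord_zero _ k ?_
      rw [Function.comp_apply, hk]
      exact L.d_sub_eq_zero hij x) hc
  rw [AlgHom.toLinearMap_apply, AlgHom.toLinearMap_apply, ExteriorAlgebra.map_apply_ιMulti] at h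
  exact h

/-- If `t` spans the cocycles up to `s ^ 2`, exterior multiplication by it sees only the classes
modulo cocycles, for which `b j` is a basis. One more `s` makes the exponent `3` uniform with the
other comparisons. -/
theorem pow_smul_mul {j k : ℤ} (hjk : j + 1 = k) {l : ℕ} (t : Fin l → D.P.X j)
    (ht : ∀ x : D.P.X j, (D.P.d j k).hom x = 0 → L.s ^ 2 • x ∈ Submodule.span R (Set.range t))
    {c : ExteriorAlgebra R (D.P.X j)} (hc : c ∈ ⋀[R]^(L.m j) (D.P.X j)) :
    L.s ^ L.m j • L.s ^ 3 • (ExteriorAlgebra.ιMulti R l t * c) =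
      extPairing R (D.P.X j) c (ExteriorAlgebra.ιMulti R (L.m j) (L.q j)) •
        L.s ^ 3 • (ExteriorAlgebra.ιMulti R l t * ExteriorAlgebra.ιMulti R (L.m j) (L.b j)) :=
  pow_smul_eq_extPairing_smul (s := L.s) (v := L.b j) (q := L.q j)
    (L.s ^ 3 • LinearMap.mulLeft R (ExteriorAlgebra.ιMulti R l t)) (fun m i x hi => by
      rw [LinearMap.smul_apply, LinearMap.mulLeft_apply]
      refine smul_ιMulti_mul_ιMulti_eq_zero i ?_
      rw [hi, pow_succ', mul_smul]
      exact Submodule.smul_mem _ _ (ht _ (L.d_sub_eq_zero hjk x))) hc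

/-- After multiplication by the product `θ` of the coboundaries, only the cohomology class of the
cocycle part matters. -/
theorem pow_smul_mul_map_iCycles {c : ExteriorAlgebra R (D.P.cycles 1)}
    (hc : c ∈ ⋀[R]^(L.n) (D.P.cycles 1)) :
    L.s ^ L.n • L.s ^ 3 • (L.θ 0 1 * ExteriorAlgebra.map (D.P.iCycles 1).hom c) =
      extPairing R (cohomology C 1) (ExteriorAlgebra.map D.cocycleClass c)
        (ExteriorAlgebra.ιMulti R L.n L.qz) •
        L.s ^ 3 • (L.θ 0 1 * ExteriorAlgebra.ιMulti R L.n
          fun k => (D.P.iCycles 1).hom (L.z k)) := by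
  rw [extPairing_map _ hc]
  have h := pow_smul_eq_extPairing_smul (s := L.s) (v := L.z)
    (q := fun k => L.qz k ∘ₗ D.cocycleClass)
    (L.s ^ 3 • (LinearMap.mulLeft R (L.θ 0 1) ∘ₗ
      (ExteriorAlgebra.map (D.P.iCycles 1).hom).toLinearMap)) (fun m i x hi => by
      rw [LinearMap.smul_apply, LinearMap.comp_apply, LinearMap.mulLeft_apply,
        AlgHom.toLinearMap_apply, ExteriorAlgebra.map_apply_ιMulti]
      refine smul_ιMulti_mul_ιMulti_eq_zero i ?_
      obtain ⟨y, hy⟩ := D.exists_d_eq_of_cocycleClass_eq_zero (m i) (by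
        rw [hi]
        simp only [map_sub, map_smul, map_sum, LinearMap.comp_apply, L.isScaledBasis.sum_smul,
          sub_self])
      rw [Function.comp_apply, ← hy, pow_succ, mul_smul]
      exact Submodule.smul_mem _ _ (L.smul_d_mem_span (zero_add 1) y)) hc
  simp only [LinearMap.smul_apply, LinearMap.comp_apply, LinearMap.mulLeft_apply,
    AlgHom.toLinearMap_apply, ExteriorAlgebra.map_apply_ιMulti] at h
  exact h

variable {L}

theorem IsAdapted.s_mul_coeff (hε : L.IsAdapted ε) (c : ∀ i, ExteriorAlgebra R (D.P.X i)) (i : ℤ) :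
    L.s * L.coeff ε c i =
      L.s * extPairing R (D.P.X i) (ε • c i) (ExteriorAlgebra.ιMulti R (L.m i) (L.q i)) := by
  rw [coeff]
  linear_combination -hε.mul_s

/-- The exterior product of the dual basis of the cohomology, on `D(ε)`. -/
def IsAdapted.y (hε : L.IsAdapted ε) : extPow R (Module.Dual R (cohomology C 1)) D.eulerChar :=
  ⟨ε • ExteriorAlgebra.ιMulti R L.n L.qz, smul_mem_extPow hε.isIdempotentElem hε.eulerChar_eq
    (ExteriorAlgebra.ιMulti_range R L.n ⟨_, rfl⟩)⟩

theorem IsAdapted.toExtBidual_y (hε : L.IsAdapted ε) (x : extPow R (cohomology C 1) D.eulerChar) :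
    toExtBidual R (cohomology C 1) D.eulerChar x hε.y =
      extPairing R (cohomology C 1) (ε • (x : ExteriorAlgebra R (cohomology C 1)))
        (ExteriorAlgebra.ιMulti R L.n L.qz) := by
  change extPairing R (cohomology C 1) (x : ExteriorAlgebra R (cohomology C 1))
    (ε • ExteriorAlgebra.ιMulti R L.n L.qz) = _
  rw [map_smul, map_smul, LinearMap.smul_apply]

theorem IsAdapted.exists_pow_smul_eq (hε : L.IsAdapted ε) {j : ℤ} {n : ℕ} {v : Fin n → D.P.X j}
    (hv : ∀ x, L.s ^ 3 • x ∈ Submodule.span R (Set.range v)) (hn : rankFun R (D.P.X j) Q = n) :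
    ∃ w₀ : detLine R (D.P.X j), (w₀ : ExteriorAlgebra R (D.P.X j)) =
      ε • ExteriorAlgebra.ιMulti R n v ∧
      ∀ y : detLine R (D.P.X j), ∃ (k : ℕ) (r : R), L.s ^ k • y = r • w₀ := by
  have hr : ∀ p : PrimeSpectrum R, ε ∉ p.asIdeal → rankFun R (D.P.X j) p = n := fun p hp => by
    rw [hε.rankFun_eq p hp, hn]
  refine ⟨⟨_, smul_mem_extPow hε.isIdempotentElem hr (ExteriorAlgebra.ιMulti_range R n ⟨v, rfl⟩)⟩,
    rfl, fun y => ?_⟩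
  obtain ⟨r, hr⟩ := exists_pow_smul_eq_smul_ιMulti hv
    (smul_mem_exteriorPower hε.isIdempotentElem hr y.2)
  refine ⟨3 * n + 1, L.s * r, Subtype.ext ?_⟩
  change L.s ^ (3 * n + 1) • (y : ExteriorAlgebra R (D.P.X j)) =
    (L.s * r) • ε • ExteriorAlgebra.ιMulti R n v
  have h1 := congrArg (L.s • ·) hr
  simp only [smul_smul] at h1 ⊢
  have e1 : L.s * ((L.s ^ 3) ^ n * ε) = L.s ^ (3 * n + 1) := by
    rw [← pow_mul]
    linear_combination L.s ^ (3 * n) * hε.mul_s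
  have e2 : L.s * r * ε = L.s * r := by linear_combination r * hε.mul_s
  rw [e2, ← h1, e1]

/-- The comparison of `w j` with the exterior product of a basis. -/
theorem IsAdapted.exists_comparison (hε : L.IsAdapted ε) (j : ℤ) :
    ∃ (N : ℕ) (w₀ : detLine R (D.P.X j)),
      (∀ y : detLine R (D.P.X j), ∃ (k : ℕ) (r : R), L.s ^ k • y = r • w₀) ∧
      ∀ δ : D.NaturalDatum, L.s ^ N • δ.w j =
        ((L.coeff ε δ.c (j - 1) * L.coeff ε δ.c j) *
          if j = 1 then toExtBidual R (cohomology C 1) D.eulerChar δ.x hε.y else 1) •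
            L.s ^ 3 • w₀ := by
  have hc : ∀ (δ : D.NaturalDatum) i, ε • δ.c i ∈ ⋀[R]^(L.m i) (D.P.X i) := fun δ i =>
    smul_mem_exteriorPower hε.isIdempotentElem
      (fun p hp => hε.eq_m δ.s_eq_zero δ.s_add p hp i) (δ.c_mem i)
  have e1 : ε * L.s = L.s := hε.mul_s
  by_cases hj : j = 1
  · subst hj
    let t : Fin (L.m 0 + L.n) → D.P.X 1 := Fin.append (fun k => (D.P.d 0 1).hom (L.b 0 k))
      (fun k => (D.P.iCycles 1).hom (L.z k))
    have ht : L.θ 0 1 * ExteriorAlgebra.ιMulti R L.n (fun k => (D.P.iCycles 1).hom (L.z k)) =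
        ExteriorAlgebra.ιMulti R _ t := ExteriorAlgebra.ιMulti_mul_ιMulti _ _
    obtain ⟨w₀, hw₀, hspan⟩ := hε.exists_pow_smul_eq (v := Fin.append t (L.b 1)) (j := 1) (by
      intro x
      have := L.smul_mem_span_one x
      rw [range_append, Set.Sum.elim_range, range_append, ← Set.Sum.elim_range]
      exact this) (by rw [L.rankFun_one_eq]; push_cast; ring)
    refine ⟨L.m 0 + L.n + L.m 1 + 3, w₀, hspan, fun δ => ?_⟩
    have hz : ε • δ.z ∈ ⋀[R]^(L.n) (D.P.cycles 1) :=
      smul_mem_exteriorPower hε.isIdempotentElem hε.eulerChar_eq δ.z_mem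
    have A1 := L.pow_smul_map_d (zero_add 1) (hc δ 0)
    have A2 := L.pow_smul_mul_map_iCycles hz
    have A3 := L.pow_smul_mul rfl t (by
      intro x hx
      obtain ⟨z, rfl⟩ := exists_iCycles_eq D.P rfl x hx
      rw [range_append]
      exact L.smul_iCycles_mem_span z) (hc δ 1)
    rw [map_smul (ExteriorAlgebra.map D.cocycleClass), ← δ.x_eq, ← hε.toExtBidual_y, ht] at A2
    have s0 := hε.s_mul_coeff δ.c 0
    have s1 := hε.s_mul_coeff δ.c 1
    rw [map_smul] at A1 A2
    rw [if_pos rfl]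
    apply Subtype.ext
    simp only [Submodule.coe_smul]
    rw [δ.w_one_eq, hw₀, ← ExteriorAlgebra.ιMulti_mul_ιMulti, sub_self]
    generalize extPairing R (D.P.X 0) (ε • δ.c 0) _ = u0 at *
    generalize extPairing R (D.P.X 1) (ε • δ.c 1) _ = u1 at *
    generalize toExtBidual R (cohomology C 1) D.eulerChar δ.x hε.y = uz at *
    generalize L.coeff ε δ.c 0 = v0 at *
    generalize L.coeff ε δ.c 1 = v1 at *
    generalize ExteriorAlgebra.map (D.P.d 0 1).hom (δ.c 0) = a at *
    generalize ExteriorAlgebra.map (D.P.iCycles 1).hom δ.z = z at *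
    generalize ExteriorAlgebra.ιMulti R _ t = τ at *
    -- The denominators absorb an `ε` for each of the three factors `d (c 0)`, `z` and `c 1`. The
    -- factors are then replaced in this order by their coordinates times basis elements.
    have e3 : ε * ε * ε * L.s ^ 3 = L.s ^ 3 := by
      linear_combination (ε ^ 2 * L.s ^ 2 + ε * L.s ^ 2 + L.s ^ 2) * e1
    calc L.s ^ (L.m 0 + L.n + L.m 1 + 3) • (a * z * δ.c 1)
        = L.s ^ L.m 1 • ((L.s ^ L.n • L.s ^ 3 • ((L.s ^ L.m 0 • ε • a) * (ε • z))) *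
            (ε • δ.c 1)) := by
          simp only [smul_mul_assoc, mul_smul_comm, smul_smul]
          congr 1
          linear_combination (-(L.s ^ (L.m 0 + L.n + L.m 1))) * e3
      _ = u0 • L.s ^ L.m 1 • ((L.s ^ L.n • L.s ^ 3 • (L.θ 0 1 * (ε • z))) *
            (ε • δ.c 1)) := by
          rw [A1]
          simp only [smul_mul_assoc, mul_smul_comm, smul_smul]
          congr 1
          ring
      _ = (u0 * uz) • L.s ^ L.m 1 • L.s ^ 3 • (τ * (ε • δ.c 1)) := by
          rw [A2]
          simp only [smul_mul_assoc, mul_smul_comm, smul_smul]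
          congr 1
          ring
      _ = _ := by
          rw [A3]
          simp only [smul_smul]
          congr 1
          linear_combination (-(L.s ^ 2 * u1 * uz)) * s0 - L.s ^ 2 * v0 * uz * s1 -
            v0 * v1 * uz * L.s ^ 2 * e1
  · obtain ⟨i, rfl⟩ : ∃ i, j = i + 1 := ⟨j - 1, by omega⟩
    obtain ⟨w₀, hw₀, hspan⟩ := hε.exists_pow_smul_eq (j := i + 1)
      (v := Fin.append (fun k => (D.P.d i (i + 1)).hom (L.b i k)) (L.b (i + 1))) (by
      intro x
      rw [range_append]
      exact L.smul_mem_span rfl hj x) (by rw [L.rankFun_eq rfl hj]; push_cast; ring)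
    refine ⟨L.m i + L.m (i + 1) + 3, w₀, hspan, fun δ => ?_⟩
    have A1 := L.pow_smul_map_d (rfl : i + 1 = i + 1) (hc δ i)
    have A2 := L.pow_smul_mul rfl _ (fun x hx => L.smul_sub_mem_span rfl rfl hj x hx)
      (hc δ (i + 1))
    have s0 := hε.s_mul_coeff δ.c i
    have s1 := hε.s_mul_coeff δ.c (i + 1)
    have hw := δ.w_eq (i + 1) hj
    rw [add_sub_cancel_right] at hw
    rw [if_neg hj, mul_one, add_sub_cancel_right]
    rw [map_smul] at A1
    apply Subtype.ext
    simp only [Submodule.coe_smul]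
    rw [hw, hw₀, ← ExteriorAlgebra.ιMulti_mul_ιMulti]
    change L.s ^ L.m (i + 1) • L.s ^ 3 • (L.θ i (i + 1) * _) =
      _ • L.s ^ 3 • (L.θ i (i + 1) * _) at A2
    change _ = _ • L.s ^ 3 • ε • (L.θ i (i + 1) * _)
    generalize extPairing R (D.P.X i) (ε • δ.c i) _ = u0 at *
    generalize extPairing R (D.P.X (i + 1)) (ε • δ.c (i + 1)) _ = u1 at *
    generalize L.coeff ε δ.c i = v0 at *
    generalize L.coeff ε δ.c (i + 1) = v1 at *
    generalize ExteriorAlgebra.map (D.P.d i (i + 1)).hom (δ.c i) = a at *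
    generalize L.θ i (i + 1) = θ at *
    calc L.s ^ (L.m i + L.m (i + 1) + 3) • (a * δ.c (i + 1))
        = L.s ^ L.m (i + 1) • L.s ^ 3 • ((L.s ^ L.m i • ε • a) * (ε • δ.c (i + 1))) := by
          simp only [smul_mul_assoc, mul_smul_comm, smul_smul]
          congr 1
          linear_combination (-(L.s ^ (L.m i + L.m (i + 1) + 2) * (1 + ε))) * e1
      _ = u0 • L.s ^ L.m (i + 1) • L.s ^ 3 • (θ * (ε • δ.c (i + 1))) := by
          rw [A1]
          simp only [smul_mul_assoc, mul_smul_comm, smul_smul]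
          congr 1
          ring
      _ = _ := by
          rw [A2]
          simp only [smul_smul]
          congr 1
          linear_combination (-(L.s ^ 2 * u1)) * s0 - L.s ^ 2 * v0 * s1 - v0 * v1 * L.s ^ 2 * e1

end LocalSplitting

end PerfectPresentation

/-! ### Trivializing the determinant and the local generator -/

/-- Each index `i` occurs once: as itself if it satisfies `p`, and otherwise as the predecessor of
`i + 1`. The terms at the ends are `1`. It is used for the even and for the odd degrees. -/
theorem prod_sub_one_mul {R : Type*} [CommRing R] {a b : ℤ} {f : ℤ → R}
    (hf : ∀ i, i < a ∨ b ≤ i → f i = 1) (p q : ℤ → Prop) [DecidablePred p] [DecidablePred q]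
    (hpq : ∀ i, q i ↔ ¬ p i) (hsub : ∀ i, p i ↔ q (i - 1)) :
    ∏ i ∈ (Finset.Icc a b).filter p, f (i - 1) * f i = ∏ i ∈ Finset.Icc a b, f i := by
  have h1 : ∏ i ∈ (Finset.Icc a b).filter p, f (i - 1) = ∏ i ∈ (Finset.Icc a b).filter q, f i := by
    refine Finset.prod_bij_ne_one (fun i _ _ => i - 1) ?_ ?_ ?_ ?_
    · intro i hi hne
      rw [Finset.mem_filter, Finset.mem_Icc] at hi ⊢
      have : ¬ (i - 1 < a ∨ b ≤ i - 1) := fun h => hne (hf _ h)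
      exact ⟨by omega, (hsub i).1 hi.2⟩
    · intro i _ _ j _ _ h
      omega
    · intro j hj hne
      rw [Finset.mem_filter, Finset.mem_Icc] at hj
      have : ¬ (j < a ∨ b ≤ j) := fun h => hne (hf _ h)
      refine ⟨j + 1, ?_, ?_, by omega⟩
      · rw [Finset.mem_filter, Finset.mem_Icc, hsub, add_sub_cancel_right]
        exact ⟨by omega, hj.2⟩
      · rwa [add_sub_cancel_right]
    · intro i _ _
      rfl
  rw [Finset.prod_mul_distrib, h1, mul_comm, Finset.filter_congr (fun i _ => hpq i),
    Finset.prod_filter_mul_prod_filter_not]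

theorem extPairing_one_of_eq_zero {R M : Type*} [CommRing R] [AddCommGroup M] [Module R M] {n : ℕ} (hn : n = 0)
    (q : Fin n → Module.Dual R M) :
    extPairing R M 1 (ExteriorAlgebra.ιMulti R n q) = 1 := by
  subst hn
  rw [← ExteriorAlgebra.ιMulti_zero_apply (R := R) (M := M) Fin.elim0,
    extPairing_ιMulti_ιMulti_of_apply_eq (s := 1) (fun k => k.elim0), pow_zero]

namespace PerfectPresentation

variable {R : Type u} [CommRing R] [HasDerivedCategory.{w} (ModuleCat.{u} R)]
  {C : DerivedCategory (ModuleCat.{u} R)} (D : PerfectPresentation C)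

/-- The trivialization of the determinant induced by trivializations of the factors. -/
def detEquiv (κ : ∀ i, detLine R (D.P.X i) ≃ₗ[R] R) : D.det ≃ₗ[R] R :=
  TensorProduct.congr
    (PiTensorProduct.congr (fun i : D.evenDegrees => κ i) ≪≫ₗ
      (PiTensorProduct.constantBaseRingEquiv D.evenDegrees R).toLinearEquiv)
    (PiTensorProduct.congr (fun i : D.oddDegrees =>
        (κ i).symm.dualMap ≪≫ₗ LinearMap.ringLmapEquivSelf R R R) ≪≫ₗ
      (PiTensorProduct.constantBaseRingEquiv D.oddDegrees R).toLinearEquiv) ≪≫ₗ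
  TensorProduct.lid R R

theorem detEquiv_tmul (κ : ∀ i, detLine R (D.P.X i) ≃ₗ[R] R) (w : ∀ i, detLine R (D.P.X i))
    (φ : ∀ i : D.oddDegrees, Module.Dual R (detLine R (D.P.X i))) :
    D.detEquiv κ ((PiTensorProduct.tprod R fun i : D.evenDegrees => w i) ⊗ₜ[R]
      PiTensorProduct.tprod R φ) =
      (∏ i ∈ D.evenDegrees, κ i (w i)) * ∏ i : D.oddDegrees, φ i ((κ i).symm 1) := by
  rw [← Finset.prod_coe_sort]
  simp [detEquiv, PiTensorProduct.congr_tprod, PiTensorProduct.constantBaseRingEquiv_tprod]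

/-- The pairs of coordinates that determine the natural isomorphism. -/
def coordinates (κ : ∀ i, detLine R (D.P.X i) ≃ₗ[R] R) :
    Set (extPow R (cohomology C 1) D.eulerChar × R × R) :=
  Set.range fun δ : D.NaturalDatum =>
    (δ.x, ∏ i ∈ D.evenDegrees, κ i (δ.w i), ∏ i ∈ D.oddDegrees, κ i (δ.w i))

variable {D} in
-- As `κ i` generates the dual of `det (P^i)`, naturality need only be tested with `φ i = κ i`. It
-- then relates the products of the coordinates of `w i` over even and over odd degrees.
theorem isNaturalMap_iff_coordinates (κ : ∀ i, detLine R (D.P.X i) ≃ₗ[R] R)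
    (η : extBidual R (cohomology C 1) D.eulerChar →ₗ[R] R) :
    D.IsNaturalMap (((LinearMap.ringLmapEquivSelf R R R).symm ≪≫ₗ (D.detEquiv κ).dualMap).toLinearMap ∘ₗ
      η ∘ₗ toExtBidual R (cohomology C 1) D.eulerChar) ↔
    ∀ a ∈ D.coordinates κ, η (toExtBidual R (cohomology C 1) D.eulerChar a.1) * a.2.1 = a.2.2 := by
  have key : ∀ (δ : D.NaturalDatum)
      (φ : ∀ i : D.oddDegrees, Module.Dual R (detLine R (D.P.X i))),
      ∏ i : D.oddDegrees, φ i (δ.w i) = (∏ i ∈ D.oddDegrees, κ i (δ.w i)) *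
        ∏ i : D.oddDegrees, φ i ((κ i).symm 1) := by
    intro δ φ
    rw [← Finset.prod_coe_sort D.oddDegrees, ← Finset.prod_mul_distrib]
    refine Finset.prod_congr rfl fun i _ => ?_
    rw [← smul_eq_mul, ← map_smul, ← map_smul, smul_eq_mul, mul_one, LinearEquiv.symm_apply_apply]
  have hval : ∀ (r : R) (t : D.det),
      ((LinearMap.ringLmapEquivSelf R R R).symm ≪≫ₗ (D.detEquiv κ).dualMap) r t =
        D.detEquiv κ t * r := by
    intro r t
    simp [LinearMap.ringLmapEquivSelf]
  rw [isNaturalMap_iff]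
  simp only [LinearMap.comp_apply, LinearEquiv.coe_coe, hval, detEquiv_tmul, key]
  constructor
  · rintro h _ ⟨δ, rfl⟩
    have := h δ (fun i => (κ i).toLinearMap)
    simp only [LinearEquiv.coe_coe, LinearEquiv.apply_symm_apply, Finset.prod_const_one,
      mul_one] at this
    dsimp only
    rw [← this, mul_comm]
  · intro h δ φ
    have := h _ ⟨δ, rfl⟩
    dsimp only at this
    rw [← this]
    ring

namespace LocalSplitting

variable {D}
variable {Q : PrimeSpectrum R} {L : D.LocalSplitting Q} {ε : R}

theorem coeff_eq_one {c : ∀ i, ExteriorAlgebra R (D.P.X i)} {i : ℤ} (hi : i < D.a ∨ D.b ≤ i)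
    (hc : c i = 1) : L.coeff ε c i = 1 := by
  rw [coeff, hc, map_smul, LinearMap.smul_apply, extPairing_one_of_eq_zero (L.m_eq_zero hi),
    smul_eq_mul, mul_one, add_sub_cancel]

theorem IsAdapted.exists_smul_eq (hε : L.IsAdapted ε)
    (y : extPow R (Module.Dual R (cohomology C 1)) D.eulerChar) :
    ∃ (k : ℕ) (r : R), L.s ^ k • y = r • hε.y := by
  obtain ⟨r, hr⟩ := exists_pow_smul_eq_smul_ιMulti (v := L.qz) (s := L.s) (fun f => by
      -- The dual basis `qz` spans the dual of the cohomology up to `s`.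
      have : L.s • f = ∑ k, f (D.cocycleClass (L.z k)) • L.qz k := by
        ext h
        rw [LinearMap.smul_apply, ← map_smul, ← L.isScaledBasis.sum_smul, map_sum,
          LinearMap.sum_apply]
        refine Finset.sum_congr rfl fun k _ => ?_
        rw [map_smul, LinearMap.smul_apply, smul_eq_mul, smul_eq_mul, mul_comm]
      rw [this]
      exact Submodule.sum_mem _ fun k _ => Submodule.smul_mem _ _ (Submodule.subset_span ⟨k, rfl⟩))
    (smul_mem_exteriorPower hε.isIdempotentElem hε.eulerChar_eq y.2)
  refine ⟨L.n + 1, L.s * r, Subtype.ext ?_⟩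
  change L.s ^ (L.n + 1) • (y : ExteriorAlgebra R (Module.Dual R (cohomology C 1))) =
    (L.s * r) • ε • ExteriorAlgebra.ιMulti R L.n L.qz
  have h1 := congrArg (L.s • ·) hr
  simp only [smul_smul] at h1 ⊢
  have e1 : L.s * (L.s ^ L.n * ε) = L.s ^ (L.n + 1) := by
    linear_combination L.s ^ L.n * hε.mul_s
  have e2 : L.s * r * ε = L.s * r := by linear_combination r * hε.mul_s
  rw [e2, ← h1, e1]

/-- A datum all of whose members are generators at `Q`. -/
theorem IsAdapted.exists_naturalDatum (hε : L.IsAdapted ε) : ∃ δ : D.NaturalDatum,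
    (∀ i, L.coeff ε δ.c i ∉ Q.asIdeal) ∧
    toExtBidual R (cohomology C 1) D.eulerChar δ.x hε.y ∉ Q.asIdeal := by
  classical
  obtain ⟨s, h₀, h₁, h₂⟩ := D.exists_ranks
  let c : ∀ i, ExteriorAlgebra R (D.P.X i) := fun i =>
    if i < D.a ∨ D.b ≤ i then 1 else ε • ExteriorAlgebra.ιMulti R (L.m i) (L.b i)
  have hone : ∀ i, i < D.a ∨ D.b ≤ i → c i = 1 := fun i hi => if_pos hi
  obtain ⟨δ, hδc, hδz⟩ := NaturalDatum.exists_of s h₀ h₁ h₂ c (by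
    intro i
    by_cases hi : i < D.a ∨ D.b ≤ i
    · rw [hone i hi, h₀ i hi]
      exact one_mem_extPow
    · simp only [c, if_neg hi]
      exact smul_mem_extPow hε.isIdempotentElem (fun p hp => hε.eq_m h₀ h₁ p hp i)
        (ExteriorAlgebra.ιMulti_range R _ ⟨_, rfl⟩)) hone
    (ε • ExteriorAlgebra.ιMulti R L.n L.z) (smul_mem_extPow hε.isIdempotentElem hε.eulerChar_eq
        (ExteriorAlgebra.ιMulti_range R _ ⟨_, rfl⟩))
  have hεs : ∀ k, ε * L.s ^ k ∉ Q.asIdeal := fun k =>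
    Q.asIdeal.primeCompl.mul_mem hε.not_mem (Q.asIdeal.primeCompl.pow_mem L.s_not_mem k)
  refine ⟨δ, fun i hmem => ?_, fun hmem => ?_⟩
  · by_cases hi : i < D.a ∨ D.b ≤ i
    · rw [hδc, coeff_eq_one hi (hone i hi)] at hmem
      exact Q.2.one_notMem hmem
    · rw [hδc, coeff] at hmem
      simp only [c, if_neg hi] at hmem
      rw [map_smul, map_smul, LinearMap.smul_apply, LinearMap.smul_apply,
        extPairing_ιMulti_ιMulti_of_apply_eq (L.apply_eq i)] at hmem
      refine hεs (L.m i) ?_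
      have h := Q.asIdeal.mul_mem_left ε hmem
      have hid : ε * ε = ε := hε.isIdempotentElem
      convert h using 1
      simp only [smul_eq_mul]
      linear_combination (-(L.s ^ L.m i * (ε + 1)) + 1) * hid
  · rw [hε.toExtBidual_y, δ.x_eq, hδz, map_smul, map_smul, map_smul, LinearMap.smul_apply,
      LinearMap.smul_apply, ExteriorAlgebra.map_apply_ιMulti,
      extPairing_ιMulti_ιMulti_of_apply_eq (m := D.cocycleClass ∘ L.z)
        L.isScaledBasis.apply_eq] at hmem
    exact Q.asIdeal.primeCompl.mul_mem hε.not_mem (hεs L.n) hmem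

theorem IsAdapted.exists_generator (hε : L.IsAdapted ε)
    (κ : ∀ i, detLine R (D.P.X i) ≃ₗ[R] R) :
    ∃ s ∉ Q.asIdeal, ∃ y₀ : extPow R (Module.Dual R (cohomology C 1)) D.eulerChar,
      (∀ y, ∃ c ∉ Q.asIdeal, ∃ r : R, c • y = r • y₀) ∧
      (∃ a ∈ D.coordinates κ, a.2.2 ∉ Q.asIdeal) ∧
      ∀ a ∈ D.coordinates κ,
        a.2.1 * toExtBidual R (cohomology C 1) D.eulerChar a.1 y₀ = s * a.2.2 := by
  choose N w₀ hspan hcomp using hε.exists_comparison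
  have hs : ∀ k, L.s ^ k ∉ Q.asIdeal := Q.asIdeal.primeCompl.pow_mem L.s_not_mem
  have hw₀ : ∀ i, κ i (w₀ i) ∉ Q.asIdeal := by
    intro i hmem
    obtain ⟨k, r, hr⟩ := hspan i ((κ i).symm 1)
    have := congrArg (κ i) hr
    rw [map_smul, map_smul, LinearEquiv.apply_symm_apply, smul_eq_mul, smul_eq_mul,
      mul_one] at this
    exact hs k (this ▸ Q.asIdeal.mul_mem_left r hmem)
  have hκ : ∀ (δ : D.NaturalDatum) j, L.s ^ N j * κ j (δ.w j) =
      (L.coeff ε δ.c (j - 1) * L.coeff ε δ.c j) *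
        (if j = 1 then toExtBidual R (cohomology C 1) D.eulerChar δ.x hε.y else 1) *
          (L.s ^ 3 * κ j (w₀ j)) := by
    intro δ j
    have := congrArg (κ j) (hcomp j δ)
    simpa only [map_smul, smul_eq_mul] using this
  have hprod : ∀ (I : Finset ℤ) (f : ℤ → R), (∀ i, f i ∉ Q.asIdeal) → ∏ i ∈ I, f i ∉ Q.asIdeal :=
    fun I f hf => Q.asIdeal.primeCompl.prod_mem fun i _ => hf i
  have hκ₀ : ∀ i, L.s ^ 3 * κ i (w₀ i) ∉ Q.asIdeal := fun i =>
    Q.asIdeal.primeCompl.mul_mem (hs 3) (hw₀ i)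
  let PE := ∏ i ∈ D.evenDegrees, L.s ^ N i
  let PO := ∏ i ∈ D.oddDegrees, L.s ^ N i
  let WE := ∏ i ∈ D.evenDegrees, L.s ^ 3 * κ i (w₀ i)
  let WO := ∏ i ∈ D.oddDegrees, L.s ^ 3 * κ i (w₀ i)
  have hPE : PE ∉ Q.asIdeal := hprod _ _ fun i => hs (N i)
  have hPO : PO ∉ Q.asIdeal := hprod _ _ fun i => hs (N i)
  have hWE : WE ∉ Q.asIdeal := hprod _ _ hκ₀
  have hWO : WO ∉ Q.asIdeal := hprod _ _ hκ₀
  have hmulmem : ∀ {x y : R}, x ∉ Q.asIdeal → y ∉ Q.asIdeal → x * y ∉ Q.asIdeal :=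
    fun hx hy => Q.asIdeal.primeCompl.mul_mem hx hy
  -- The extra factors clear the denominators in `hE` and `hO`, and are units at `Q`.
  refine ⟨WE * PO, hmulmem hWE hPO, (PE * WO) • hε.y, fun y => ?_, ?_, ?_⟩
  · obtain ⟨k, r, hr⟩ := hε.exists_smul_eq y
    refine ⟨(PE * WO) * L.s ^ k, hmulmem (hmulmem hPE hWO) (hs k), r, ?_⟩
    rw [mul_smul, hr, smul_comm]
  · obtain ⟨δ, hδ, hδx⟩ := hε.exists_naturalDatum
    refine ⟨_, ⟨δ, rfl⟩, ?_⟩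
    refine hprod D.oddDegrees (fun i => κ i (δ.w i)) fun j hmem => ?_
    have h1 := Q.asIdeal.mul_mem_left (L.s ^ N j) hmem
    rw [hκ] at h1
    refine hmulmem (hmulmem (hmulmem (hδ _) (hδ _)) ?_) (hκ₀ j) h1
    split_ifs
    · exact hδx
    · exact Q.2.one_notMem
  · rintro _ ⟨δ, rfl⟩
    dsimp only
    have hb : ∀ i, i < D.a ∨ D.b ≤ i → L.coeff ε δ.c i = 1 := fun i hi =>
      coeff_eq_one hi (δ.c_eq_one i hi)
    -- In `hE` and `hO` the same product of coefficients appears. The value of the class on `hε.y`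
    -- enters only in `hO`, because degree one is odd.
    have hE : PE * ∏ i ∈ D.evenDegrees, κ i (δ.w i) =
        (∏ i ∈ Finset.Icc D.a D.b, L.coeff ε δ.c i) * WE := by
      rw [← Finset.prod_mul_distrib, Finset.prod_congr rfl fun i _ => hκ δ i,
        Finset.prod_mul_distrib, Finset.prod_mul_distrib,
        prod_sub_one_mul hb Even Odd (fun i => Int.not_even_iff_odd.symm)
          (fun i => by rw [Int.even_iff, Int.odd_iff]; omega),
        Finset.prod_ite_eq' , if_neg, mul_one]
      simp
    have hO : PO * ∏ i ∈ D.oddDegrees, κ i (δ.w i) =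
        (∏ i ∈ Finset.Icc D.a D.b, L.coeff ε δ.c i) *
          toExtBidual R (cohomology C 1) D.eulerChar δ.x hε.y * WO := by
      rw [← Finset.prod_mul_distrib, Finset.prod_congr rfl fun i _ => hκ δ i,
        Finset.prod_mul_distrib, Finset.prod_mul_distrib,
        prod_sub_one_mul hb Odd Even (fun i => Int.not_odd_iff_even.symm)
          (fun i => by rw [Int.even_iff, Int.odd_iff]; omega),
        Finset.prod_ite_eq' , if_pos]
      rw [Finset.mem_filter, Finset.mem_Icc]
      exact ⟨⟨D.a_le, D.le_b⟩, odd_one⟩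
    rw [map_smul, smul_eq_mul]
    linear_combination (WO * toExtBidual R (cohomology C 1) D.eulerChar δ.x hε.y) * hE - WE * hO

end LocalSplitting

end PerfectPresentation

/-! ### The main theorem -/

theorem proposition2p4 {Λ : Type v} {R : Type u} [CommRing Λ] [IsRegularLocalRing Λ] [CommRing R]
    [Algebra Λ R] (hinj : Function.Injective (algebraMap Λ R))
    [Module.Free Λ R] [Module.Finite Λ R]
    (hdual : ∃ f : R ≃ₗ[Λ] (R →ₗ[Λ] Λ), ∀ r x y : R, f (r * x) y = f x (r * y))
    [HasDerivedCategory.{w} (ModuleCat.{u} R)] (C : DerivedCategory (ModuleCat.{u} R))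
    (D : PerfectPresentation C)
    (hpn : ∀ i : ℤ, i ≠ 1 → IsPseudoNull R (cohomology C i))
    (htor : IsPseudoNull R (Submodule.torsion R (cohomology C 1))) :
    (∃! η : extBidual R (cohomology C 1) D.eulerChar ≃ₗ[R] D.detInv,
      D.IsNaturalMap (η.toLinearMap ∘ₗ toExtBidual R (cohomology C 1) D.eulerChar)) ∧
    Nonempty (extBidual R (cohomology C 1) D.eulerChar ≃ₗ[R] R) := by
  have := finite_maximalSpectrum_of_finite Λ R
  let κ : ∀ i, detLine R (D.P.X i) ≃ₗ[R] R := fun i => (nonempty_detLine_linearEquiv _).some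
  obtain ⟨η, hη, huniq⟩ := existsUnique_dualEquiv (Λ := Λ)
    (toExtBidual R (cohomology C 1) D.eulerChar) (D.coordinates κ) (fun Q hQ => by
      obtain ⟨L⟩ := D.nonempty_localSplitting hdual hpn htor hQ
      obtain ⟨L, ε, hε⟩ := L.exists_isAdapted
      exact hε.exists_generator κ)
  -- The trivializations `κ` are auxiliary: naturality does not involve them, so uniqueness of `η`
  -- in coordinates gives uniqueness of the isomorphism onto `detInv`.
  let e : R ≃ₗ[R] D.detInv := (LinearMap.ringLmapEquivSelf R R R).symm ≪≫ₗ (D.detEquiv κ).dualMap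
  refine ⟨⟨η ≪≫ₗ e, ?_, fun η' hη' => ?_⟩, ⟨η⟩⟩
  · exact (PerfectPresentation.isNaturalMap_iff_coordinates κ η.toLinearMap).2 hη
  · have h1 : η' ≪≫ₗ e.symm = η := huniq _ fun a ha =>
      (PerfectPresentation.isNaturalMap_iff_coordinates κ (η' ≪≫ₗ e.symm).toLinearMap).1 (by
        have : (e.toLinearMap ∘ₗ (η' ≪≫ₗ e.symm).toLinearMap ∘ₗ
          toExtBidual R (cohomology C 1) D.eulerChar) = η'.toLinearMap ∘ₗ
            toExtBidual R (cohomology C 1) D.eulerChar := by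
          ext x : 1
          exact e.apply_symm_apply _
        exact this ▸ hη') a ha
    rw [← h1]
    ext x : 1
    exact (e.apply_symm_apply _).symm

end
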